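/- Let $\ell$ be a prime, let $E$ be a finite extension of $\mathbb{Q}_\ell$ with ring of integers $\mathcal{O}$, uniformizer $\varpi$ and residue field $\mathbb{F}=\mathcal{O}/\varpi$, and let $\overline{E}$ be an algebraic closure of $E$. Let $n\ge 0$ and $q\ge 0$ be integers such that $q$ is \emph{banal}, i.e. $q\not\equiv 0\pmod{\ell}$ and $q^i\not\equiv 1\pmod{\ell}$ for $i=1,\ldots,n$. Let $\mathcal{M}(n,q)$ be the affine $\mathcal{O}$-scheme of pairs $(\Phi,\Sigma)\in \mathrm{GL}_n\times \mathrm{GL}_n$ with $\Phi\Sigma\Phi^{-1}=\Sigma^q$, and let $\mathcal{M}^{\mathrm{unip}}(n,q)\subseteq\mathcal{M}(n,q)$ be the Zariski closure, with its reduced structure, of the set of points $(\Phi,\Sigma)\in\mathcal{M}(n,q)(\overline{E})$ for which $\Sigma$ has characteristic polynomial $(t-1)^n$. Let $\widetilde{\mathcal{N}}(n,q)$ be the affine $\mathcal{O}$-scheme of pairs $(\Phi,N)\in \mathrm{GL}_n\times M_n$ with $\Phi N\Phi^{-1}=qN$, and let $\mathcal{N}(n,q)\subseteq\widetilde{\mathcal{N}}(n,q)$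 be the maximal closed subscheme which is reduced and flat over $\mathcal{O}$. An algebra over a field $k$ is called a complete intersection of dimension $d$ if it has Krull dimension $d$ and is the quotient of a polynomial ring over $k$ in $c+d$ variables by $c$ equations, for some $c$. An $\mathcal{O}$-algebra is called a complete intersection of relative dimension $d$ over $\mathcal{O}$ if it is the quotient of a polynomial ring over $\mathcal{O}$ in $c+d$ variables by $c$ equations, for some $c$, and all its fibres over $\operatorname{Spec}\mathcal{O}$ have dimension $d$. It is called equidimensional of relative dimension $d$ if every irreducible component of every such fibre has dimension $d$. The same terms are used for the corresponding affine schemes. Then: \begin{enumerate} \item $\mathcal{N}(n,q)=\widetilde{\mathcal{N}}(n,q)$. \item $\mathcal{N}(n,q)$ is a complete intersection of relative dimension $n^2$ over $\mathcal{O}$; it is reduced, flat over $\mathcal{O}$, and equidimensional over $\mathcal{O}$ of relative dimension $n^2$. \item The special fibre $\mathcal{N}(n,q)_{\mathbb{F}}=\mathcal{N}(n,q)\times_{\mathcal{O}}\operatorname{Spec}\mathbb{F}$ is reduced and is a complete intersection over $\mathbb{F}$ of dimension $n^2$. \item On $\mathcal{M}^{\mathrm{unip}}(n,q)$ the integers $1,\ldots,n$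 are invertible and $(\Sigma-I)^n=0$, so that $\log\Sigma=\sum_{k=1}^n(-1)^{k-1}\frac{(\Sigma-I)^k}{k}$ is defined, and $(\Phi,\Sigma)\mapsto(\Phi,\log\Sigma)$ is an isomorphism $\mathcal{M}^{\mathrm{unip}}(n,q)\xrightarrow{\sim}\mathcal{N}(n,q)$ of $\mathcal{O}$-schemes. Moreover $\mathcal{M}^{\mathrm{unip}}(n,q)$ is a connected component of $\mathcal{M}(n,q)$: its underlying set is a connected component of the topological space $\mathcal{M}(n,q)$, and as a closed subscheme it is cut out by an idempotent, i.e. it is also an open subscheme. \end{enumerate} -/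

import Mathlib

open scoped TensorProduct

noncomputable section

/-! ### Banal integers -/

/-- `q` is banal (with respect to the prime `ℓ` and the size `n`):
`q ≢ 0 (mod ℓ)` and `q ^ i ≢ 1 (mod ℓ)` for all `i = 1, …, n`. -/
def IsBanal (ℓ n q : ℕ) : Prop :=
  ¬ q ≡ 0 [MOD ℓ] ∧ ∀ i ∈ Finset.Icc 1 n, ¬ q ^ i ≡ 1 [MOD ℓ]

/-! ### Complete intersections and equidimensionality -/

/-- A finitely presented algebra `A` over a field `k` is a (global) complete intersection of
dimension `d`: it is the quotient of a polynomial ring in `c + d` variables by `c` equations, and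
has Krull dimension `d`. -/
def IsCompleteIntersection (k A : Type*) [CommRing k] [CommRing A] [Algebra k A] (d : ℕ) : Prop :=
  (∃ (c : ℕ) (f : Fin c → MvPolynomial (Fin (c + d)) k),
    Nonempty (A ≃ₐ[k] (MvPolynomial (Fin (c + d)) k ⧸ Ideal.span (Set.range f)))) ∧
  ringKrullDim A = d

/-- An algebra `A` over a ring `R` is a (global) complete intersection of relative dimension `d`:
it is the quotient of a polynomial ring over `R` in `c + d` variables by `c` equations, and all
fibres over points of `Spec R` are (non-empty and) of dimension `d`. -/
def IsRelativeCompleteIntersection (R A : Type*) [CommRing R] [CommRing A] [Algebra R A]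
    (d : ℕ) : Prop :=
  (∃ (c : ℕ) (f : Fin c → MvPolynomial (Fin (c + d)) R),
    Nonempty (A ≃ₐ[R] (MvPolynomial (Fin (c + d)) R ⧸ Ideal.span (Set.range f)))) ∧
  ∀ p : PrimeSpectrum R, ringKrullDim (p.asIdeal.Fiber A) = d

/-- `Spec A → Spec R` is equidimensional of relative dimension `d`: every irreducible component
of every fibre has dimension `d`. -/
def IsRelativelyEquidimensional (R A : Type*) [CommRing R] [CommRing A] [Algebra R A]
    (d : ℕ) : Prop :=
  ∀ p : PrimeSpectrum R, ∀ P ∈ minimalPrimes (p.asIdeal.Fiber A),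
    ringKrullDim (p.asIdeal.Fiber A ⧸ P) = d

/-! ### The moduli space of pairs `(Φ, N)` with `Φ N Φ⁻¹ = q N` -/

namespace NTilde

variable (n q : ℕ) (R : Type*) [CommRing R]

/-- Variables: the entries of `Φ`, the entries of `N`, and the inverse of `det Φ`. -/
abbrev Var : Type := (Fin n × Fin n) ⊕ (Fin n × Fin n) ⊕ Unit

/-- The generic matrix `Φ` with polynomial entries. -/
def polyPhi : Matrix (Fin n) (Fin n) (MvPolynomial (Var n) R) :=
  Matrix.of fun i j => MvPolynomial.X (Sum.inl (i, j))

/-- The generic matrix `N` with polynomial entries. -/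
def polyN : Matrix (Fin n) (Fin n) (MvPolynomial (Var n) R) :=
  Matrix.of fun i j => MvPolynomial.X (Sum.inr (Sum.inl (i, j)))

/-- The variable which becomes the inverse of `det Φ`. -/
def polyDetInv : MvPolynomial (Var n) R := MvPolynomial.X (Sum.inr (Sum.inr ()))

/-- The equations `(det Φ)⁻¹ · det Φ = 1` and `Φ N = q N Φ`. -/
def relations : Ideal (MvPolynomial (Var n) R) :=
  Ideal.span ({polyDetInv n R * (polyPhi n R).det - 1} ∪
    Set.range fun ij : Fin n × Fin n =>
      (polyPhi n R * polyN n R - (q : MvPolynomial (Var n) R) • (polyN n R * polyPhi n R))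
        ij.1 ij.2)

/-- The coordinate ring of the affine `R`-scheme of pairs `(Φ, N) ∈ GL_n × M_n` with
`Φ N Φ⁻¹ = q N`. -/
def CoordRing : Type _ := MvPolynomial (Var n) R ⧸ relations n q R

instance : CommRing (CoordRing n q R) :=
  inferInstanceAs (CommRing (MvPolynomial (Var n) R ⧸ relations n q R))

instance : Algebra R (CoordRing n q R) :=
  inferInstanceAs (Algebra R (MvPolynomial (Var n) R ⧸ relations n q R))

/-- The quotient map from the polynomial ring. -/
def mk : MvPolynomial (Var n) R →ₐ[R] CoordRing n q R :=
  Ideal.Quotient.mkₐ R (relations n q R)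

/-- The universal matrix `Φ`. -/
def Phi : Matrix (Fin n) (Fin n) (CoordRing n q R) :=
  (polyPhi n R).map (mk n q R)

/-- The universal matrix `N`. -/
def N : Matrix (Fin n) (Fin n) (CoordRing n q R) :=
  (polyN n R).map (mk n q R)

/-- The ideal of the maximal reduced `R`-flat closed subscheme of the space of pairs `(Φ, N)`:
the smallest ideal with reduced and `R`-flat quotient (over a Dedekind domain `R`, flat means
torsion-free, so the intersection of all such ideals is again such an ideal). -/
def flatReducedIdeal : Ideal (CoordRing n q R) :=
  sInf {I | IsReduced (CoordRing n q R ⧸ I) ∧ Module.Flat R (CoordRing n q R ⧸ I)}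

end NTilde

/-- The coordinate ring of the maximal reduced `R`-flat closed subscheme `𝒩(n, q)` of the space of
pairs `(Φ, N)`. -/
abbrev NCoordRing (n q : ℕ) (R : Type*) [CommRing R] : Type _ :=
  NTilde.CoordRing n q R ⧸ NTilde.flatReducedIdeal n q R

/-- The matrix `Φ` on `𝒩(n, q)`. -/
def NCoordRing.Phi (n q : ℕ) (R : Type*) [CommRing R] :
    Matrix (Fin n) (Fin n) (NCoordRing n q R) :=
  (NTilde.Phi n q R).map (Ideal.Quotient.mk (NTilde.flatReducedIdeal n q R))

/-- The matrix `N` on `𝒩(n, q)`. -/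
def NCoordRing.N (n q : ℕ) (R : Type*) [CommRing R] :
    Matrix (Fin n) (Fin n) (NCoordRing n q R) :=
  (NTilde.N n q R).map (Ideal.Quotient.mk (NTilde.flatReducedIdeal n q R))

/-! ### The moduli space of pairs `(Φ, Σ)` with `Φ Σ Φ⁻¹ = Σ ^ q` -/

namespace MSpace

variable (n q : ℕ) (R : Type*) [CommRing R]

/-- Variables: the entries of `Φ`, the entries of `Σ`, and the inverses of `det Φ` (index `false`)
and of `det Σ` (index `true`). -/
abbrev Var : Type := (Fin n × Fin n) ⊕ (Fin n × Fin n) ⊕ Bool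

/-- The generic matrix `Φ` with polynomial entries. -/
def polyPhi : Matrix (Fin n) (Fin n) (MvPolynomial (Var n) R) :=
  Matrix.of fun i j => MvPolynomial.X (Sum.inl (i, j))

/-- The generic matrix `Σ` with polynomial entries. -/
def polySigma : Matrix (Fin n) (Fin n) (MvPolynomial (Var n) R) :=
  Matrix.of fun i j => MvPolynomial.X (Sum.inr (Sum.inl (i, j)))

/-- The variable which becomes the inverse of `det Φ`. -/
def polyDetPhiInv : MvPolynomial (Var n) R := MvPolynomial.X (Sum.inr (Sum.inr false))

/-- The variable which becomes the inverse of `det Σ`. -/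
def polyDetSigmaInv : MvPolynomial (Var n) R := MvPolynomial.X (Sum.inr (Sum.inr true))

/-- The equations `(det Φ)⁻¹ · det Φ = 1`, `(det Σ)⁻¹ · det Σ = 1` and `Φ Σ = Σ ^ q Φ`. -/
def relations : Ideal (MvPolynomial (Var n) R) :=
  Ideal.span ({polyDetPhiInv n R * (polyPhi n R).det - 1,
      polyDetSigmaInv n R * (polySigma n R).det - 1} ∪
    Set.range fun ij : Fin n × Fin n =>
      (polyPhi n R * polySigma n R - polySigma n R ^ q * polyPhi n R) ij.1 ij.2)

/-- The coordinate ring of the affine `R`-scheme `ℳ(n, q)` of pairs `(Φ, Σ) ∈ GL_n × GL_n` with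
`Φ Σ Φ⁻¹ = Σ ^ q`. -/
def CoordRing : Type _ := MvPolynomial (Var n) R ⧸ relations n q R

instance : CommRing (CoordRing n q R) :=
  inferInstanceAs (CommRing (MvPolynomial (Var n) R ⧸ relations n q R))

instance : Algebra R (CoordRing n q R) :=
  inferInstanceAs (Algebra R (MvPolynomial (Var n) R ⧸ relations n q R))

/-- The quotient map from the polynomial ring. -/
def mk : MvPolynomial (Var n) R →ₐ[R] CoordRing n q R :=
  Ideal.Quotient.mkₐ R (relations n q R)

/-- The universal matrix `Φ`. -/
def Phi : Matrix (Fin n) (Fin n) (CoordRing n q R) :=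
  (polyPhi n R).map (mk n q R)

/-- The universal matrix `Σ`. -/
def Sigma : Matrix (Fin n) (Fin n) (CoordRing n q R) :=
  (polySigma n R).map (mk n q R)

/-- For an `R`-algebra `E` which is a field: the ideal of the Zariski closure (with its reduced
structure) of the set of `Ē`-points `(Φ, Σ)` of `ℳ(n, q)` for which `Σ` is strongly unipotent,
i.e. has characteristic polynomial `(t - 1) ^ n`. It consists of all functions vanishing at these
points. -/
def unipIdeal (E : Type*) [Field E] [Algebra R E] : Ideal (CoordRing n q R) :=
  ⨅ x : {x : CoordRing n q R →ₐ[R] AlgebraicClosure E //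
      ((Sigma n q R).map x).charpoly = (Polynomial.X - 1) ^ n}, RingHom.ker x.1

end MSpace

/-- The coordinate ring of `ℳ^unip(n, q)`. -/
abbrev MUnipCoordRing (n q : ℕ) (R E : Type*) [CommRing R] [Field E] [Algebra R E] : Type _ :=
  MSpace.CoordRing n q R ⧸ MSpace.unipIdeal n q R E

/-- The matrix `Φ` on `ℳ^unip(n, q)`. -/
def MUnipCoordRing.Phi (n q : ℕ) (R E : Type*) [CommRing R] [Field E] [Algebra R E] :
    Matrix (Fin n) (Fin n) (MUnipCoordRing n q R E) :=
  (MSpace.Phi n q R).map (Ideal.Quotient.mk (MSpace.unipIdeal n q R E))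

/-- The matrix `Σ` on `ℳ^unip(n, q)`. -/
def MUnipCoordRing.Sigma (n q : ℕ) (R E : Type*) [CommRing R] [Field E] [Algebra R E] :
    Matrix (Fin n) (Fin n) (MUnipCoordRing n q R E) :=
  (MSpace.Sigma n q R).map (Ideal.Quotient.mk (MSpace.unipIdeal n q R E))

/-! ### The logarithm of a unipotent matrix -/

/-- `log X = ∑_{k=1}^n (-1)^(k-1) (X - 1)^k / k` for an `n × n` matrix `X` with `(X - 1)^n = 0`,
over a ring in which `1, …, n` are invertible. -/
def unipLog {n : ℕ} {A : Type*} [CommRing A] (X : Matrix (Fin n) (Fin n) A) :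
    Matrix (Fin n) (Fin n) A :=
  ∑ k ∈ Finset.Icc 1 n, ((-1 : A) ^ (k - 1) * Ring.inverse (k : A)) • (X - 1) ^ k

end

-- The core is a dimension count on the fibres of the space of pairs (Φ, N). Over a field k in which
-- q ≠ 0 and q^i ≠ 1 for 1 ≤ i ≤ n, N and qN have the same characteristic polynomial, so N is
-- nilpotent (`Matrix.charpoly_eq_X_pow_of_mul_eq_smul_mul`). Let K be the residue field at a point,
-- generated by the entries of N and Φ, and let F = k(N). The orbit of N gives trdeg F ≤ n² - dim
-- Z(N) (`trdeg_add_finrank_centralizer_le`), and Φ lies in a coset Z(N)Ψ, so it adds at most dim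
-- Z(N). Hence every fibre has dimension at most n², the number of variables minus the number of
-- equations. It is a complete intersection, and since affine space is Cohen–Macaulay, all its
-- associated primes have dimension n².
--
-- At a prime of dimension n² both bounds are sharp, so Φ is generic in Z(N)Ψ. The Jacobian has
-- independent rows there as soon as NY = qYN and YΦ = qΦY force Y = 0. This is an open condition on
-- Φ, and a diagonal Φ in a Jordan basis of N satisfies it (`exists_regular_of_isNilpotent`). A
-- fibre is therefore generically reduced without embedded components, hence reduced
-- (`isReduced_of_jacobian`).
--
-- Over ℤ_ℓ, the special fibre having the expected dimension makes ℓ a nonzerodivisor, so the space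
-- is flat. Flatness passes to O by base change, and the total space is reduced because it embeds in
-- its generic fibre.
--
-- On the space of pairs (Φ, Σ), let J be the ideal saying that U = Σ - 1 has characteristic
-- polynomial t^n. Banality forces n < ℓ, so truncated log and exp identify the quotient by J with
-- the space of pairs (Φ, N) (`MSpace.exists_algEquiv_charpolyIdeal`). Modulo J², Newton's
-- identities and tr U^k = q^k tr U^k show that the characteristic polynomial is still t^n
-- (`charpoly_eq_X_pow_of_mem_ideal`); so J = J² is generated by an idempotent. The geometric points
-- are dense in the quotient, so J is the ideal of the unipotent locus. Scaling N to 0 contracts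
-- this locus onto GL_n over a domain, so it is connected.

universe u v

noncomputable section

/-! ### Depth and regular sequences over Noetherian local rings -/

section

open RingTheory.Sequence IsLocalRing CategoryTheory Abelian in
/-- Depth drops by at most one modulo a regular element. -/
theorem exists_isRegular_quotSMulTop {R M : Type u} [CommRing R] [IsLocalRing R]
    [IsNoetherianRing R] [AddCommGroup M] [Module R M] [Module.Finite R M] [Nontrivial M]
    {x : R} (hx : x ∈ maximalIdeal R) (hreg : IsSMulRegular M x) {d : ℕ}
    (h : ∃ rs : List R, rs.length = d + 1 ∧ IsRegular M rs) :
    ∃ rs : List R, rs.length = d ∧ IsRegular (QuotSMulTop x M) rs := by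
  have lt_top (N : Type u) [AddCommGroup N] [Module R N] [Module.Finite R N] [Nontrivial N] :
      maximalIdeal R • (⊤ : Submodule R N) < ⊤ :=
    (Submodule.top_ne_ideal_smul_of_le_jacobson_annihilator
      (maximalIdeal_le_jacobson _)).symm.lt_top
  have mem_max (rs : List R) (hrs : IsRegular M rs) : ∀ r ∈ rs, r ∈ maximalIdeal R := by
    intro r hr
    refine le_maximalIdeal (J := Ideal.ofList rs) ?_ (Ideal.subset_span hr)
    intro htop
    exact hrs.top_ne_smul (by rw [htop]; simp)
  have : Nontrivial (QuotSMulTop x M) := nontrivial_quotSMulTop_of_mem_maximalIdeal M hx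
  obtain ⟨rs, hlen, hrs⟩ := h
  -- Depth is measured by the vanishing of Ext from the residue field in low degrees.
  let k := ModuleCat.of R (ULift.{u} (R ⧸ maximalIdeal R))
  have hsupp : Module.support R k = PrimeSpectrum.zeroLocus (maximalIdeal R) := by
    rw [(ULift.moduleEquiv : ULift.{u} (R ⧸ maximalIdeal R) ≃ₗ[R] _).support_eq,
      Module.support_eq_zeroLocus, Ideal.annihilator_quotient]
  have hfin : Module.Finite R k := inferInstanceAs (Module.Finite R (ULift.{u} (R ⧸ maximalIdeal R)))
  have ext1 := ModuleCat.subsingleton_ext_of_exists_isRegular (maximalIdeal R) k hsupp.subset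
    (ModuleCat.of R M) (lt_top M) rs (mem_max rs hrs) hrs
  -- In the long exact sequence of 0 → M → M → M/xM → 0 the group Ext^i(k, M/xM) sits between
  -- Ext^i(k, M) and Ext^(i+1)(k, M), both zero for i < d.
  have ext2 : ∀ i < d, Subsingleton (Ext k (ModuleCat.of R (QuotSMulTop x M)) i) := by
    intro i hi
    have zero1 := AddCommGrpCat.isZero_of_iff_subsingleton.mpr (ext1 i (by omega))
    have zero2 := AddCommGrpCat.isZero_of_iff_subsingleton.mpr (ext1 (i + 1) (by omega))
    exact AddCommGrpCat.subsingleton_of_isZero <| ShortComplex.Exact.isZero_of_both_zeros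
      ((Ext.covariant_sequence_exact₃' k (IsSMulRegular.smulShortComplex_shortExact
        (M := ModuleCat.of R M) hreg)) i (i + 1) rfl)
      (zero1.eq_zero_of_src _) (zero2.eq_zero_of_tgt _)
  obtain ⟨rs', h1, -, h3⟩ := ModuleCat.exists_isRegular_of_exists_subsingleton_ext
    (maximalIdeal R) d (ModuleCat.of R (QuotSMulTop x M)) (lt_top (QuotSMulTop x M)) k hsupp ext2
  exact ⟨rs', h1, h3⟩

open IsLocalRing Pointwise in
/-- An associated prime of `M` and a regular element `x` are contained in an associated prime of
`M / xM`. -/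
theorem exists_associatedPrime_quotSMulTop {R M : Type*} [CommRing R] [IsLocalRing R]
    [IsNoetherianRing R] [AddCommGroup M] [Module R M] [Module.Finite R M]
    {x : R} (hx : x ∈ maximalIdeal R) (hreg : IsSMulRegular M x) {p : Ideal R}
    (hp : p ∈ associatedPrimes R M) :
    ∃ q ∈ associatedPrimes R (QuotSMulTop x M), p ≤ q ∧ x ∈ q := by
  obtain ⟨hpp, m, hm⟩ := isAssociatedPrime_iff.mp hp
  have hmem (r : R) : r ∈ p ↔ r • m = 0 := by rw [hm]; simp [Submodule.mem_colon_singleton]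
  -- The submodule killed by p is nonzero. Were it contained in xM, regularity of x would give N =
  -- xN, and Nakayama would give N = 0. A y in N outside xM has a nonzero class in M/xM, killed by p
  -- and by x.
  let N : Submodule R M := Submodule.torsionBySet R M p
  have hmN : m ∈ N := by
    rw [Submodule.mem_torsionBySet_iff]; rintro ⟨r, hr⟩; exact (hmem r).1 hr
  have hm0 : m ≠ 0 := by
    rintro rfl; exact hpp.ne_top ((Ideal.eq_top_iff_one _).2 ((hmem 1).2 (by simp)))
  have : ∃ y ∈ N, y ∉ x • (⊤ : Submodule R M) := by
    by_contra! hall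
    have hle : N ≤ maximalIdeal R • N := by
      intro y hy
      obtain ⟨z, -, hz⟩ := (Submodule.mem_smul_pointwise_iff_exists _ _ _).1 (hall y hy)
      have hzN : z ∈ N := by
        rw [Submodule.mem_torsionBySet_iff] at hy ⊢
        rintro ⟨r, hr⟩
        apply hreg
        have := hy ⟨r, hr⟩
        simp only [← hz] at this
        simpa [smul_comm x r z] using this
      rw [← hz]; exact Submodule.smul_mem_smul hx hzN
    have := Submodule.eq_bot_of_le_smul_of_le_jacobson_bot (maximalIdeal R) N
      (IsNoetherian.noetherian N) hle (maximalIdeal_le_jacobson _)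
    rw [this] at hmN
    exact hm0 (by simpa using hmN)
  obtain ⟨y, hyN, hy⟩ := this
  obtain ⟨q, hq, hle⟩ := exists_le_isAssociatedPrime_of_isNoetherianRing R
    (Submodule.Quotient.mk y : QuotSMulTop x M)
    (by rwa [ne_eq, Submodule.Quotient.mk_eq_zero])
  refine ⟨q, hq, fun r hr => hle ?_, hle ?_⟩
  · rw [Submodule.mem_colon_singleton, ← Submodule.Quotient.mk_smul]
    rw [Submodule.mem_torsionBySet_iff] at hyN
    simp [hyN ⟨r, hr⟩]
  · rw [Submodule.mem_colon_singleton, ← Submodule.Quotient.mk_smul, Submodule.mem_bot,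
      Submodule.Quotient.mk_eq_zero]
    exact Submodule.smul_mem_pointwise_smul _ _ _ trivial

theorem ringKrullDim_quotient_succ_le_of_lt {R : Type*} [CommRing R] {p q : Ideal R} [p.IsPrime]
    (h : p < q) : ringKrullDim (R ⧸ q) + 1 ≤ ringKrullDim (R ⧸ p) := by
  obtain ⟨x, hxq, hxp⟩ := SetLike.exists_of_lt h
  refine ringKrullDim_succ_le_of_surjective (Ideal.Quotient.factor h.le)
    (Ideal.Quotient.factor_surjective h.le) (r := Ideal.Quotient.mk p x) ?_ ?_
  · rw [mem_nonZeroDivisors_iff_ne_zero, ne_eq, Ideal.Quotient.eq_zero_iff_mem]; exact hxp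
  · simpa using Ideal.Quotient.eq_zero_iff_mem.2 hxq

open RingTheory.Sequence IsLocalRing in
/-- The length of a regular sequence is at most the dimension of every associated prime. -/
theorem length_le_ringKrullDim_quotient_associatedPrime {R : Type*} [CommRing R] [IsLocalRing R]
    [IsNoetherianRing R] (rs : List R) {M : Type*} [AddCommGroup M] [Module R M]
    [Module.Finite R M] (hrs : IsRegular M rs) {p : Ideal R} (hp : p ∈ associatedPrimes R M) :
    (rs.length : WithBot ℕ∞) ≤ ringKrullDim (R ⧸ p) := by
  induction rs generalizing M p with
  | nil =>
    have := hp.isPrime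
    simpa using ringKrullDim_nonneg_of_nontrivial
  | cons x rs ih =>
    have hx : x ∈ maximalIdeal R := by
      refine le_maximalIdeal (J := Ideal.ofList (x :: rs)) ?_ (Ideal.subset_span (by simp))
      intro htop
      exact hrs.top_ne_smul (by rw [htop]; simp)
    rw [isRegular_cons_iff] at hrs
    obtain ⟨q, hq, hpq, hxq⟩ := exists_associatedPrime_quotSMulTop hx hrs.1 hp
    have hxp : x ∉ p := by
      obtain ⟨hpp, m, hm⟩ := isAssociatedPrime_iff.mp hp
      intro hxp
      rw [hm, Submodule.mem_colon_singleton, Submodule.mem_bot] at hxp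
      have : m = 0 := hrs.1 (by simpa using hxp)
      subst this
      exact hpp.ne_top (by rw [hm]; simp)
    have := hp.isPrime
    have hlt : p < q := lt_of_le_of_ne hpq (by rintro rfl; exact hxp hxq)
    refine le_trans ?_ (ringKrullDim_quotient_succ_le_of_lt hlt)
    simpa using add_le_add_left (ih hrs.2 hq) 1

open RingTheory.Sequence IsLocalRing in
/-- In a module of depth `c + d`, elements `f₁, …, f_c` cutting out dimension at most `d` form a
regular sequence, with quotient of depth at least `d`. -/
theorem isRegular_of_ringKrullDim_le {R : Type u} [CommRing R] [IsLocalRing R]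
    [IsNoetherianRing R] (fs : List R) {M : Type u} [AddCommGroup M] [Module R M]
    [Module.Finite R M] [Nontrivial M] {d : ℕ}
    (hM : ∃ rs : List R, rs.length = d + fs.length ∧ IsRegular M rs)
    (hfs : ∀ f ∈ fs, f ∈ maximalIdeal R)
    (hdim : ringKrullDim (R ⧸ (Module.annihilator R M ⊔ Ideal.ofList fs)) ≤ d) :
    IsRegular M fs ∧ ∃ rs : List R, rs.length = d ∧
      IsRegular (M ⧸ (Ideal.ofList fs • ⊤ : Submodule R M)) rs := by
  induction fs generalizing M with
  | nil =>
    refine ⟨IsRegular.nil R M, ?_⟩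
    obtain ⟨rs, h1, h2⟩ := hM
    refine ⟨rs, by simpa using h1, ?_⟩
    refine ((Submodule.quotEquivOfEqBot _ ?_).isRegular_congr rs).2 h2
    simp
  | cons f fs ih =>
    have hf : f ∈ maximalIdeal R := hfs f (by simp)
    have hreg : IsSMulRegular M f := by
      -- A zero divisor f lies in an associated prime p, and the depth hypothesis gives dim R/p ≥ d
      -- + 1 + `fs.length`. Cutting R/p by the remaining `fs` loses at most `fs.length`, so a
      -- quotient of dimension at least d + 1 would survive, against `hdim`.
      by_contra hnot
      have : f ∈ (⋃ p ∈ associatedPrimes R M, (p : Set R)) := by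
        rw [biUnion_associatedPrimes_eq_compl_regular R M]; exact hnot
      simp only [Set.mem_iUnion] at this
      obtain ⟨p, hp, hfp⟩ := this
      obtain ⟨rs, hlen, hrs⟩ := hM
      have h1 := length_le_ringKrullDim_quotient_associatedPrime rs hrs hp
      have hpp := hp.isPrime
      have hann : Module.annihilator R M ≤ p := by
        rw [← Submodule.annihilator_top]; exact hp.annihilator_le
      have hloc : IsLocalRing (R ⧸ p) :=
        IsLocalRing.of_surjective' (Ideal.Quotient.mk p) Ideal.Quotient.mk_surjective
      have h2 := ringKrullDim_le_ringKrullDim_quotient_add_encard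
        (R := R ⧸ p) ((Ideal.Quotient.mk p) '' {x | x ∈ fs}) (by
          rintro _ ⟨x, hx, rfl⟩
          rw [IsLocalRing.ringJacobson_eq_maximalIdeal]
          have : x ∈ maximalIdeal R := hfs x (List.mem_cons_of_mem _ hx)
          rw [mem_maximalIdeal, mem_nonunits_iff] at this
          rw [SetLike.mem_coe, mem_maximalIdeal, mem_nonunits_iff]
          intro hu
          have hloc' : IsLocalHom (Ideal.Quotient.mk p) :=
            IsLocalHom.of_surjective _ Ideal.Quotient.mk_surjective
          exact this (isUnit_of_map_unit (Ideal.Quotient.mk p) _ hu))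
      set J := Ideal.span ((Ideal.Quotient.mk p) '' {x | x ∈ fs}) with hJ
      have h3 : ringKrullDim ((R ⧸ p) ⧸ J) ≤ d := by
        refine le_trans (ringKrullDim_le_of_surjective
          (Ideal.Quotient.lift (Module.annihilator R M ⊔ Ideal.ofList (f :: fs))
            ((Ideal.Quotient.mk J).comp (Ideal.Quotient.mk p)) ?_) ?_) hdim
        · intro a ha
          rw [← RingHom.mem_ker]
          revert a
          change _ ≤ RingHom.ker _
          rw [sup_le_iff]
          constructor
          · intro a ha
            simp [RingHom.mem_ker, Ideal.Quotient.eq_zero_iff_mem.2 (hann ha)]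
          · refine Ideal.span_le.2 fun a ha => ?_
            rcases List.mem_cons.1 ha with rfl | ha
            · simp [RingHom.mem_ker, Ideal.Quotient.eq_zero_iff_mem.2 hfp]
            · simp only [SetLike.mem_coe, RingHom.mem_ker, RingHom.comp_apply]
              exact Ideal.Quotient.eq_zero_iff_mem.2 (Ideal.subset_span ⟨a, ha, rfl⟩)
        · apply Ideal.Quotient.lift_surjective_of_surjective
          exact Ideal.Quotient.mk_surjective.comp Ideal.Quotient.mk_surjective
      have h4 : ((((Ideal.Quotient.mk p) '' {x | x ∈ fs}).encard : ℕ∞) : WithBot ℕ∞)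
          ≤ (fs.length : WithBot ℕ∞) := by
        classical
        have : ((Ideal.Quotient.mk p) '' {x | x ∈ fs}).encard ≤ (fs.length : ℕ∞) := by
          refine (Set.encard_image_le _ _).trans ?_
          have : {x | x ∈ fs} = (fs.toFinset : Set R) := by ext; simp
          rw [this, Set.encard_coe_eq_coe_finsetCard]
          exact_mod_cast fs.toFinset_card_le
        exact_mod_cast this
      have h5 := h1.trans (h2.trans (add_le_add h3 h4))
      rw [hlen, List.length_cons] at h5
      have h6 : d + (fs.length + 1) ≤ d + fs.length := by exact_mod_cast h5
      omega
    have hnt : Nontrivial (QuotSMulTop f M) := nontrivial_quotSMulTop_of_mem_maximalIdeal M hf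
    have hM' := exists_isRegular_quotSMulTop hf hreg (d := d + fs.length)
      (by simpa [add_assoc] using hM)
    obtain ⟨h1, rs, h2, h3⟩ := ih hM' (fun g hg => hfs g (List.mem_cons_of_mem _ hg)) (by
      refine le_trans (ringKrullDim_le_of_surjective (Ideal.Quotient.factor ?_)
        (Ideal.Quotient.factor_surjective ?_)) hdim
      all_goals
        have hle : Module.annihilator R M ≤ Module.annihilator R (QuotSMulTop f M) :=
          LinearMap.annihilator_le_of_surjective _ (Submodule.mkQ_surjective _)
        have hf' : f ∈ Module.annihilator R (QuotSMulTop f M) := by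
          rw [Module.mem_annihilator]
          intro y
          obtain ⟨y, rfl⟩ := Submodule.Quotient.mk_surjective _ y
          rw [← Submodule.Quotient.mk_smul, Submodule.Quotient.mk_eq_zero]
          exact Submodule.smul_mem_pointwise_smul _ _ _ trivial
        rw [Ideal.ofList_cons, ← sup_assoc]
        refine sup_le_sup_right (sup_le hle ?_) _
        rwa [Ideal.span_singleton_le_iff_mem])
    refine ⟨(isRegular_cons_iff _ _ _).2 ⟨hreg, h1⟩, rs, h2, ?_⟩
    exact ((Submodule.quotOfListConsSMulTopEquivQuotSMulTopInner M f fs).isRegular_congr rs).2 h3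

end

/-! ### Regular sequences in polynomial rings -/

section

/-- A form of Zariski's lemma. -/
theorem isIntegral_of_finiteType_of_isMaximal_ker {S B : Type*} [CommRing S] [Field B] [Algebra S B]
    [Algebra.FiniteType S B] (h : (RingHom.ker (algebraMap S B)).IsMaximal) :
    Algebra.IsIntegral S B := by
  let κ := S ⧸ RingHom.ker (algebraMap S B)
  let _ : Field κ := Ideal.Quotient.field _
  let _ : Algebra κ B := (RingHom.kerLift (algebraMap S B)).toAlgebra
  have : IsScalarTower S κ B := IsScalarTower.of_algebraMap_eq fun _ => rfl
  have : Algebra.FiniteType κ B := Algebra.FiniteType.of_restrictScalars_finiteType S κ B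
  have : Module.Finite κ B := finite_of_finite_type_of_isJacobsonRing κ B
  have : Algebra.IsIntegral S κ :=
    Algebra.IsIntegral.of_surjective (Algebra.ofId S κ) Ideal.Quotient.mk_surjective
  exact Algebra.IsIntegral.trans κ

/-- If `m` is a maximal ideal of a finite type `S`-algebra lying over a maximal ideal of `S`, then
its contraction to every intermediate algebra is maximal. -/
theorem isMaximal_comap_of_finiteType {S P Q : Type*} [CommRing S] [CommRing P] [CommRing Q]
    [Algebra S P] [Algebra S Q] [Algebra.FiniteType S Q] (g : P →ₐ[S] Q) (m : Ideal Q)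
    [hm : m.IsMaximal] (h : (m.comap (algebraMap S Q)).IsMaximal) : (m.comap g).IsMaximal := by
  let _ : Field (Q ⧸ m) := Ideal.Quotient.field _
  have hint : Algebra.IsIntegral S (Q ⧸ m) := by
    apply isIntegral_of_finiteType_of_isMaximal_ker
    convert! h
    ext x
    simp only [RingHom.mem_ker, Ideal.mem_comap]
    rw [← Ideal.Quotient.eq_zero_iff_mem]; rfl
  let f : P →+* Q ⧸ m := (Ideal.Quotient.mk m).comp g.toRingHom
  have hf : f.IsIntegral := by
    intro x
    refine RingHom.IsIntegralElem.of_comp (f := algebraMap S P) (g := f) ?_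
    have hcomp : f.comp (algebraMap S P) = algebraMap S (Q ⧸ m) := by
      ext s
      change Ideal.Quotient.mk m (g (algebraMap S P s)) = _
      rw [g.commutes]; rfl
    rw [hcomp]
    exact hint.isIntegral x
  have hbot : (⊥ : Ideal (Q ⧸ m)).IsMaximal := Ideal.bot_isMaximal
  have := Ideal.isMaximal_comap_of_isIntegral_of_isMaximal' f hf ⊥
  convert! this
  ext x
  simp [f, Ideal.mem_comap, Ideal.Quotient.eq_zero_iff_mem]

open RingTheory.Sequence Polynomial in
/-- A weakly regular sequence in the contraction of a maximal ideal `m` of `R[X]` extends by one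
element to a weakly regular sequence in `m`. -/
theorem exists_isWeaklyRegular_polynomial {R : Type*} [CommRing R] (m : Ideal R[X])
    [hm : m.IsMaximal] (h : (m.comap C).IsMaximal) (rs : List R) (hrs : IsWeaklyRegular R rs)
    (hmem : ∀ r ∈ rs, r ∈ m.comap C) :
    ∃ rs' : List R[X], rs'.length = rs.length + 1 ∧ IsWeaklyRegular R[X] rs' ∧
      ∀ r ∈ rs', r ∈ m := by
  -- Over the field κ = R/(m ∩ R), the image of m in κ[X] is maximal, hence nonzero because κ[X] is
  -- not a field. A nonzero element made monic lifts to a monic polynomial, and m contains the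
  -- kernel of reduction.
  have hmon : ∃ f ∈ m, f.Monic := by
    let _ : Field (R ⧸ m.comap C) := Ideal.Quotient.field _
    let φ := mapRingHom (Ideal.Quotient.mk (m.comap C))
    have hφ : Function.Surjective φ := map_surjective _ Ideal.Quotient.mk_surjective
    have hker : RingHom.ker φ ≤ m := by
      intro f hf
      rw [as_sum_range_C_mul_X_pow f]
      refine Ideal.sum_mem _ fun i _ => Ideal.mul_mem_right _ _ ?_
      have : φ f = 0 := hf
      have := congrArg (fun p => p.coeff i) this
      simp only [φ, coe_mapRingHom, coeff_map, coeff_zero] at this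
      exact (Ideal.Quotient.eq_zero_iff_mem.1 this : f.coeff i ∈ m.comap C)
    have hmax : (m.map φ).IsMaximal := by
      rcases Ideal.map_eq_top_or_isMaximal_of_surjective φ hφ hm with h1 | h1
      · exfalso
        have := congrArg (Ideal.comap φ) h1
        rw [Ideal.comap_map_of_surjective φ hφ, Ideal.comap_top] at this
        rw [show Ideal.comap φ ⊥ = RingHom.ker φ from rfl, sup_eq_left.2 hker] at this
        exact hm.ne_top this
      · exact h1
    have hne : m.map φ ≠ ⊥ := fun hbot => by
      rw [hbot] at hmax
      exact Polynomial.not_isField (R ⧸ m.comap C) (Ring.isField_iff_maximal_bot.2 hmax)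
    obtain ⟨g, hg, hg0⟩ := Submodule.exists_mem_ne_zero_of_ne_bot hne
    have hg' : g * C g.leadingCoeff⁻¹ ∈ m.map φ := Ideal.mul_mem_right _ _ hg
    have hgm := monic_mul_leadingCoeff_inv hg0
    have hlift : (g * C g.leadingCoeff⁻¹) ∈ lifts (Ideal.Quotient.mk (m.comap C)) := by
      rw [lifts_iff_coeff_lifts]
      intro i; exact Ideal.Quotient.mk_surjective _
    obtain ⟨f, hf, -, hfm⟩ := lifts_and_degree_eq_and_monic hlift hgm
    refine ⟨f, ?_, hfm⟩
    obtain ⟨f', hf', hff'⟩ := (Ideal.mem_map_iff_of_surjective φ hφ).1 hg'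
    have : f - f' ∈ m := hker (by rw [RingHom.mem_ker, map_sub, hff']; simp [φ, hf])
    simpa using Ideal.add_mem _ this hf'
  obtain ⟨f, hfm, hf⟩ := hmon
  refine ⟨rs.map C ++ [f], by simp, ?_, ?_⟩
  -- The extended sequence stays regular by flatness of R[X], and a monic polynomial is a
  -- nonzerodivisor in (R/(rs))[X].
  · rw [isWeaklyRegular_append_iff, isWeaklyRegular_singleton_iff]
    refine ⟨hrs.of_flat (S := R[X]), ?_⟩
    rw [isSMulRegular_quotient_iff_mem_of_smul_mem]
    intro g hg
    have hI : (Ideal.ofList (rs.map C) • ⊤ : Submodule R[X] R[X]) =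
        (Ideal.ofList rs).map C := by
      rw [← Ideal.map_ofList]; simp
    rw [hI] at hg ⊢
    rw [Ideal.mem_map_C_iff] at hg ⊢
    have hker (p : R[X]) : p.map (Ideal.Quotient.mk (Ideal.ofList rs)) = 0 ↔
        ∀ i, p.coeff i ∈ Ideal.ofList rs := by
      simp [Polynomial.ext_iff, Ideal.Quotient.eq_zero_iff_mem]
    rw [← hker] at hg ⊢
    rw [smul_eq_mul, Polynomial.map_mul] at hg
    exact (hf.map _).mul_right_eq_zero_iff.1 hg
  · intro r hr
    rcases List.mem_append.1 hr with hr | hr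
    · obtain ⟨r, h', rfl⟩ := List.mem_map.1 hr
      exact hmem r h'
    · simp only [List.mem_singleton] at hr; rwa [hr]

open RingTheory.Sequence in
theorem RingEquiv.isWeaklyRegular_map {R S : Type*} [CommRing R] [CommRing S] (e : R ≃+* S)
    {rs : List R} (h : IsWeaklyRegular R rs) : IsWeaklyRegular S (rs.map e) := by
  refine (AddEquiv.isWeaklyRegular_congr (e := e.toAddEquiv) ?_).1 h
  rw [List.forall₂_map_right_iff, List.forall₂_same]
  intro x _ y
  simp

open RingTheory.Sequence in
/-- A weakly regular sequence of `S` in the contraction of a maximal ideal `m` of a polynomial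
ring in `N` variables extends to one in `m` by `N` elements, if the contraction is maximal. -/
theorem exists_isWeaklyRegular_mvPolynomial {S : Type*} [CommRing S] (rs : List S)
    (hrs : IsWeaklyRegular S rs) (N : ℕ) (m : Ideal (MvPolynomial (Fin N) S)) [hm : m.IsMaximal]
    (h : (m.comap MvPolynomial.C).IsMaximal) (hmem : ∀ r ∈ rs, MvPolynomial.C r ∈ m) :
    ∃ rs' : List (MvPolynomial (Fin N) S), rs'.length = rs.length + N ∧
      IsWeaklyRegular (MvPolynomial (Fin N) S) rs' ∧ ∀ r ∈ rs', r ∈ m := by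
  induction N with
  | zero =>
    let e := (MvPolynomial.isEmptyRingEquiv S (Fin 0)).symm
    refine ⟨rs.map e, by simp, e.isWeaklyRegular_map hrs, ?_⟩
    intro r hr
    obtain ⟨r, h', rfl⟩ := List.mem_map.1 hr
    exact hmem r h'
  | succ N ih =>
    let e := MvPolynomial.finSuccEquiv S N
    let m' : Ideal (Polynomial (MvPolynomial (Fin N) S)) := m.comap e.symm.toRingHom
    have hm' : m'.IsMaximal := Ideal.comap_isMaximal_of_surjective _ e.symm.surjective
    have heC (s : S) : e.symm (Polynomial.C (MvPolynomial.C s)) = MvPolynomial.C s := by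
      rw [AlgEquiv.symm_apply_eq]; exact ((MvPolynomial.finSuccEquiv S N).commutes s).symm
    have hS : (m'.comap (algebraMap S _)).IsMaximal := by
      convert! h
      ext s
      simp only [m', Ideal.mem_comap]
      rw [← heC]; rfl
    -- The one-variable step needs the contraction to the smaller polynomial ring to be maximal;
    -- this is where the Nullstellensatz enters.
    have hmax : (m'.comap Polynomial.C).IsMaximal :=
      isMaximal_comap_of_finiteType
        (IsScalarTower.toAlgHom S (MvPolynomial (Fin N) S) (Polynomial (MvPolynomial (Fin N) S)))
        m' hS
    obtain ⟨rs1, h1, h2, h3⟩ := ih (m'.comap Polynomial.C) hS (fun r hr => by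
      have := hmem r hr
      rw [← heC] at this; exact this)
    obtain ⟨rs2, h4, h5, h6⟩ := exists_isWeaklyRegular_polynomial m' hmax rs1 h2 h3
    refine ⟨rs2.map e.symm.toRingEquiv, by simp [h4, h1, add_assoc],
      e.symm.toRingEquiv.isWeaklyRegular_map h5, ?_⟩
    intro r hr
    obtain ⟨r, h', rfl⟩ := List.mem_map.1 hr
    exact h6 r h'

end

/-! ### Complete intersections in affine space: unmixedness and regular parameters -/

section

-- A prime of a localization is the extension of its contraction, so strict chains of primes
-- contract to strict chains.
open IsLocalRing in
theorem ringKrullDim_localization_quotient_le {P : Type*} [CommRing P] (m : Ideal P) [m.IsPrime]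
    (I : Ideal P) (J : Ideal (Localization.AtPrime m))
    (h : I.map (algebraMap P (Localization.AtPrime m)) ≤ J) :
    ringKrullDim (Localization.AtPrime m ⧸ J) ≤ ringKrullDim (P ⧸ I) := by
  let g : P ⧸ I →+* Localization.AtPrime m ⧸ J :=
    Ideal.quotientMap J (algebraMap P (Localization.AtPrime m)) (Ideal.map_le_iff_le_comap.1 h)
  refine Order.krullDim_le_of_strictMono (PrimeSpectrum.comap g) ?_
  intro p q hpq
  rw [lt_iff_le_not_ge] at hpq ⊢
  refine ⟨Ideal.comap_mono hpq.1, fun hle => hpq.2 ?_⟩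
  have h1 : Ideal.comap (Ideal.Quotient.mk J) q.asIdeal ≤
      Ideal.comap (Ideal.Quotient.mk J) p.asIdeal := by
    rw [← IsLocalization.map_under m.primeCompl (Localization.AtPrime m)
      (Ideal.comap (Ideal.Quotient.mk J) q.asIdeal)]
    refine Ideal.map_le_iff_le_comap.2 fun x hx => ?_
    exact hle (show Ideal.Quotient.mk I x ∈ Ideal.comap g q.asIdeal from hx)
  have h2 := Ideal.map_mono (f := Ideal.Quotient.mk J) h1
  rw [Ideal.map_comap_of_surjective _ Ideal.Quotient.mk_surjective,
    Ideal.map_comap_of_surjective _ Ideal.Quotient.mk_surjective] at h2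
  exact h2

open RingTheory.Sequence IsLocalRing in
/-- Equations cutting out the expected dimension form a regular sequence in the local rings of
affine space, and the quotient has the expected depth. -/
theorem isRegular_localization_mvPolynomial {S : Type u} [CommRing S] [IsNoetherianRing S]
    (rs : List S) (hrs : IsWeaklyRegular S rs) {c d : ℕ}
    (fs : List (MvPolynomial (Fin (c + d)) S)) (hc : fs.length = c)
    (m : Ideal (MvPolynomial (Fin (c + d)) S)) [m.IsMaximal]
    (hm : (m.comap MvPolynomial.C).IsMaximal) (hrm : ∀ r ∈ rs, MvPolynomial.C r ∈ m)
    (hfm : ∀ f ∈ fs, f ∈ m)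
    (hdim : ringKrullDim (MvPolynomial (Fin (c + d)) S ⧸
      Ideal.ofList (rs.map MvPolynomial.C ++ fs)) ≤ d) :
    letI gs := (rs.map MvPolynomial.C ++ fs).map (algebraMap _ (Localization.AtPrime m))
    IsRegular (Localization.AtPrime m) gs ∧
    ∃ ss : List (Localization.AtPrime m), ss.length = d ∧ IsRegular
      (Localization.AtPrime m ⧸ (Ideal.ofList gs • ⊤ : Submodule (Localization.AtPrime m)
        (Localization.AtPrime m))) ss := by
  obtain ⟨ts, h1, h2, h3⟩ := exists_isWeaklyRegular_mvPolynomial rs hrs (c + d) m hm hrm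
  have h4 := h2.isRegular_of_isLocalization_of_mem (Localization.AtPrime m) m h3
  -- Extending `rs` by one element per variable shows that the local ring has depth at least
  -- `rs.length + c + d`, which is d more than the number of equations.
  refine isRegular_of_ringKrullDim_le _ ⟨_, ?_, h4⟩ ?_ ?_
  · simp [h1, hc]; omega
  · intro f hf
    obtain ⟨f, hf', rfl⟩ := List.mem_map.1 hf
    rw [IsLocalization.AtPrime.to_map_mem_maximal_iff (Localization.AtPrime m) m]
    rcases List.mem_append.1 hf' with h | h
    · obtain ⟨r, hr', rfl⟩ := List.mem_map.1 h
      exact hrm _ hr'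
    · exact hfm _ h
  · refine le_trans (ringKrullDim_localization_quotient_le m _ _ ?_) hdim
    rw [Ideal.map_ofList]
    exact le_sup_right

theorem Ideal.isMaximal_comap_of_field {k P : Type*} [Field k] [CommRing P] (f : k →+* P)
    (m : Ideal P) [hm : m.IsPrime] : (m.comap f).IsMaximal := by
  have : m.comap f = ⊥ := by
    rcases Ideal.eq_bot_or_top (m.comap f) with h | h
    · exact h
    · exact absurd h (Ideal.IsPrime.comap f (hK := hm)).ne_top
  rw [this]; exact Ideal.bot_isMaximal

open RingTheory.Sequence IsLocalRing in
/-- The unmixedness theorem for complete intersections over a field. -/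
theorem le_ringKrullDim_quotient_of_mem_associatedPrimes {k : Type u} [Field k] {c d : ℕ}
    (fs : List (MvPolynomial (Fin (c + d)) k)) (hc : fs.length = c)
    (hdim : ringKrullDim (MvPolynomial (Fin (c + d)) k ⧸ Ideal.ofList fs) ≤ d)
    {p : Ideal (MvPolynomial (Fin (c + d)) k)}
    (hp : p ∈ associatedPrimes (MvPolynomial (Fin (c + d)) k)
      (MvPolynomial (Fin (c + d)) k ⧸ Ideal.ofList fs)) :
    d ≤ ringKrullDim (MvPolynomial (Fin (c + d)) k ⧸ p) := by
  obtain ⟨hpp, x, hx⟩ := isAssociatedPrime_iff.1 hp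
  obtain ⟨a, rfl⟩ := Ideal.Quotient.mk_surjective x
  have hmem (r) : r ∈ p ↔ r * a ∈ Ideal.ofList fs := by
    rw [hx, Submodule.mem_colon_singleton, Submodule.mem_bot, ← Ideal.Quotient.eq_zero_iff_mem]
    rfl
  obtain ⟨m, hm, hpm⟩ := p.exists_le_maximal hpp.ne_top
  have hfp : Ideal.ofList fs ≤ p := fun r hr => (hmem r).2 (Ideal.mul_mem_right _ _ hr)
  have hfm : ∀ f ∈ fs, f ∈ m := fun f hf => hpm (hfp (Ideal.subset_span hf))
  obtain ⟨-, ss, hss, hreg⟩ := isRegular_localization_mvPolynomial [] (IsWeaklyRegular.nil k k)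
    fs hc m (Ideal.isMaximal_comap_of_field _ _) (by simp) hfm hdim
  let L := Localization.AtPrime m
  have hdisj : Disjoint (m.primeCompl : Set (MvPolynomial (Fin (c + d)) k)) p := by
    rw [Set.disjoint_left]; intro r hr hr'; exact hr (hpm hr')
  have hq : (p.map (algebraMap _ L)).IsPrime := IsLocalization.isPrime_of_isPrime_disjoint
    m.primeCompl L p hpp hdisj
  -- If p is the annihilator of the class of a, its extension is the annihilator of the image of a,
  -- hence is associated to the localized quotient. That quotient has depth at least d, which bounds
  -- its dimension from below.
  have hass : p.map (algebraMap _ L) ∈ associatedPrimes L (L ⧸ (Ideal.ofList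
      (List.map (algebraMap _ L) (List.map MvPolynomial.C [] ++ fs)) • ⊤ : Submodule L L)) := by
    rw [AssociatedPrimes.mem_iff, isAssociatedPrime_iff]
    refine ⟨hq, Submodule.Quotient.mk (algebraMap _ L a), ?_⟩
    ext r
    rw [Submodule.mem_colon_singleton, Submodule.mem_bot, ← Submodule.Quotient.mk_smul,
      Submodule.Quotient.mk_eq_zero]
    obtain ⟨r, s, rfl⟩ := IsLocalization.exists_mk'_eq m.primeCompl r
    simp only [List.map_nil, List.nil_append, smul_eq_mul, Ideal.mul_top]
    rw [← Ideal.map_ofList, IsLocalization.mk'_eq_mul_mk'_one, mul_right_comm, ← map_mul]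
    have hunit : IsUnit (IsLocalization.mk' L (1 : MvPolynomial (Fin (c + d)) k) s) :=
      IsUnit.of_mul_eq_one (algebraMap (MvPolynomial (Fin (c + d)) k) L s) (by
        rw [IsLocalization.mk'_spec, map_one])
    rw [Ideal.mul_unit_mem_iff_mem _ hunit, Ideal.mul_unit_mem_iff_mem _ hunit,
      IsLocalization.algebraMap_mem_map_algebraMap_iff m.primeCompl,
      IsLocalization.algebraMap_mem_map_algebraMap_iff m.primeCompl]
    constructor
    · rintro ⟨t, ht, h⟩
      exact ⟨t, ht, by rw [← mul_assoc]; exact (hmem _).1 h⟩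
    · rintro ⟨t, ht, h⟩
      exact ⟨t, ht, (hmem _).2 (by rwa [mul_assoc])⟩
  have := length_le_ringKrullDim_quotient_associatedPrime ss hreg hass
  rw [hss] at this
  exact this.trans (ringKrullDim_localization_quotient_le m _ _ le_rfl)

open RingTheory.Sequence IsLocalRing in
/-- If a special fibre of a relative complete intersection over a local ring has the expected
dimension, then the uniformizer is a regular element. -/
theorem isSMulRegular_quotient_of_ringKrullDim_le {S : Type u} [CommRing S] [IsNoetherianRing S]
    (r : S) (hr : IsSMulRegular S r) (hmax : (Ideal.span {r}).IsMaximal) {c d : ℕ}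
    (fs : List (MvPolynomial (Fin (c + d)) S)) (hc : fs.length = c)
    (hdim : ringKrullDim (MvPolynomial (Fin (c + d)) S ⧸
      Ideal.ofList (MvPolynomial.C r :: fs)) ≤ d) :
    IsSMulRegular (MvPolynomial (Fin (c + d)) S ⧸ Ideal.ofList fs)
      (MvPolynomial.C r : MvPolynomial (Fin (c + d)) S) := by
  rw [isSMulRegular_quotient_iff_mem_of_smul_mem]
  intro a ha
  rw [smul_eq_mul] at ha
  by_contra hna
  -- If ra is in the ideal (f) but a is not, this colon ideal is proper. A maximal ideal containing
  -- it also contains r and the equations, so the failure of regularity is visible in one local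
  -- ring.
  let I := (Ideal.ofList fs).colon {a}
  have hI (x) : x ∈ I ↔ x * a ∈ Ideal.ofList fs := by
    simp only [I, Submodule.mem_colon_singleton, smul_eq_mul]
  have hne : I ≠ ⊤ := by
    rw [Ideal.ne_top_iff_one, hI, one_mul]; exact hna
  obtain ⟨m, hm, hIm⟩ := I.exists_le_maximal hne
  have hrm : MvPolynomial.C r ∈ m := hIm ((hI _).2 ha)
  have hfm : ∀ f ∈ fs, f ∈ m := fun f hf =>
    hIm ((hI _).2 (Ideal.mul_mem_right _ _ (Ideal.subset_span hf)))
  have hm' : (m.comap MvPolynomial.C).IsMaximal := by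
    have : Ideal.span {r} = m.comap MvPolynomial.C :=
      hmax.eq_of_le (Ideal.IsPrime.comap (hK := hm.isPrime) _).ne_top
        ((Ideal.span_singleton_le_iff_mem _).2 hrm)
    rwa [← this]
  have := (isRegular_localization_mvPolynomial [r] ((isWeaklyRegular_singleton_iff S r).2 hr)
    fs hc m hm' (by simpa using hrm) hfm hdim).1
  -- In a Noetherian local ring a regular sequence may be permuted; with r last, r is regular modulo
  -- the equations.
  have hreg := (IsLocalRing.isRegular_of_perm this
    (List.Perm.map _ (List.perm_append_comm))).1
  rw [List.map_append, isWeaklyRegular_append_iff] at hreg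
  have h2 := hreg.2
  simp only [List.map_cons, List.map_nil, isWeaklyRegular_singleton_iff] at h2
  rw [isSMulRegular_quotient_iff_mem_of_smul_mem] at h2
  specialize h2 (algebraMap _ _ a)
  simp only [smul_eq_mul, Ideal.mul_top] at h2
  rw [← Ideal.map_ofList, ← map_mul,
    IsLocalization.algebraMap_mem_map_algebraMap_iff m.primeCompl,
    IsLocalization.algebraMap_mem_map_algebraMap_iff m.primeCompl] at h2
  obtain ⟨t, ht, hta⟩ := h2 ⟨1, m.primeCompl.one_mem, by rwa [one_mul]⟩
  exact ht (hIm ((hI _).2 hta))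

/-- The dimension of a domain of finite type over a field is at most its transcendence degree. -/
theorem ringKrullDim_le_of_trdeg_le {k : Type*} {B : Type*} [Field k] [CommRing B] [IsDomain B]
    [Algebra k B] [Algebra.FiniteType k B] {d : ℕ} (h : Algebra.trdeg k B ≤ d) :
    ringKrullDim B ≤ d := by
  -- Noether normalization: B is integral over a polynomial ring in s variables, so dim B ≤ s, and
  -- these variables are algebraically independent in B.
  obtain ⟨s, g, hg, hint⟩ := exists_integral_inj_algHom_of_fg k B
  let _ := g.toRingHom.toAlgebra
  have : Algebra.IsIntegral (MvPolynomial (Fin s) k) B := ⟨hint⟩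
  have h1 : ringKrullDim B ≤ ringKrullDim (MvPolynomial (Fin s) k) := by
    refine Order.krullDim_le_of_strictMono (PrimeSpectrum.comap (algebraMap _ B)) ?_
    intro p q hpq
    exact Ideal.IsIntegral.comap_lt_comap hpq
  refine h1.trans ?_
  rw [MvPolynomial.ringKrullDim_of_isNoetherianRing, ringKrullDim_eq_zero_of_field, zero_add]
  have hind : AlgebraicIndependent k (fun i => g (MvPolynomial.X i)) := by
    rw [algebraicIndependent_iff_injective_aeval]
    convert! hg
    ext i; simp
  have h2 := hind.lift_cardinalMk_le_trdeg
  simp only [Cardinal.mk_fin, Cardinal.lift_natCast] at h2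
  have h3 : (s : Cardinal) ≤ Cardinal.lift.{0} (Algebra.trdeg k B) := by simpa using h2
  have h4 : s ≤ d := by
    have := h3.trans (Cardinal.lift_le.2 h)
    simpa using this
  simpa using h4

end

/-! ### The Jacobian criterion for reducedness -/

section

open IsLocalRing in
/-- In a regular local ring of dimension at most `c`, any `c` elements of the maximal ideal which
are independent modulo its square generate it. -/
theorem IsRegularLocalRing.span_range_eq_maximalIdeal {R : Type*} [CommRing R]
    [IsRegularLocalRing R] {c : ℕ} (f : Fin c → R) (hf : ∀ i, f i ∈ maximalIdeal R)
    (hdim : ringKrullDim R ≤ c)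
    (hind : ∀ g : Fin c → R, ∑ i, g i * f i ∈ maximalIdeal R ^ 2 → ∀ i, g i ∈ maximalIdeal R) :
    Ideal.span (Set.range f) = maximalIdeal R := by
  let v : Fin c → maximalIdeal R := fun i => ⟨f i, hf i⟩
  have hli : LinearIndependent (ResidueField R) fun i => (maximalIdeal R).toCotangent (v i) := by
    rw [Fintype.linearIndependent_iff]
    intro g hg i
    choose g' hg' using fun i => residue_surjective (g i)
    have h1 : (maximalIdeal R).toCotangent (∑ i, g' i • v i) = 0 := by
      rw [map_sum, ← hg]
      refine Finset.sum_congr rfl fun i _ => ?_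
      rw [← hg' i, map_smul]
      exact (algebraMap_smul (ResidueField R) (g' i) _).symm
    rw [Ideal.toCotangent_eq_zero] at h1
    have h2 := hind g' (by simpa [v] using h1) i
    rw [← hg' i]
    exact (residue_eq_zero_iff _).2 h2
  have hfin : Module.finrank (ResidueField R) (CotangentSpace R) ≤ c := by
    have := (IsRegularLocalRing.iff_finrank_cotangentSpace R).1 inferInstance
    rw [← this] at hdim
    exact_mod_cast hdim
  have hcard := hli.fintype_card_le_finrank
  rw [Fintype.card_fin] at hcard
  have hspan := hli.span_eq_top_of_card_eq_finrank' (by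
    rw [Fintype.card_fin]; exact le_antisymm hcard hfin)
  rw [show (fun i => (maximalIdeal R).toCotangent (v i)) = (maximalIdeal R).toCotangent ∘ v from rfl,
    Set.range_comp, CotangentSpace.span_image_eq_top_iff] at hspan
  have := congrArg (Submodule.map (maximalIdeal R).subtype) hspan
  rw [Submodule.map_span, Submodule.map_top, Submodule.range_subtype, ← Set.range_comp] at this
  exact this

/-- By the Leibniz rule. This turns a linear dependence of the equations modulo p² into a dependence
of the Jacobian rows modulo p. -/
theorem Ideal.pderiv_mem_of_mem_sq {σ k : Type*} [CommRing k] {p : Ideal (MvPolynomial σ k)}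
    {f : MvPolynomial σ k} (hf : f ∈ p ^ 2) (v : σ) : MvPolynomial.pderiv v f ∈ p := by
  rw [pow_two] at hf
  induction hf using Submodule.mul_induction_on' with
  | mem_mul_mem a ha b hb =>
    rw [Derivation.leibniz]
    exact p.add_mem (p.mul_mem_right _ ha) (p.mul_mem_right _ hb)
  | add a _ b _ ha hb => rw [map_add]; exact p.add_mem ha hb

theorem Ideal.ofList_ofFn {R : Type*} [CommRing R] {c : ℕ} (f : Fin c → R) :
    Ideal.ofList (List.ofFn f) = Ideal.span (Set.range f) := by
  rw [Ideal.ofList]; congr 1; ext x; simp [List.mem_ofFn]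

open IsLocalRing in
/-- The Jacobian criterion: a complete intersection over a field is reduced if the Jacobian matrix
has independent rows at all primes of maximal dimension. -/
theorem isReduced_of_jacobian {k : Type u} [Field k] {c d : ℕ}
    (f : Fin c → MvPolynomial (Fin (c + d)) k)
    {I : Ideal (MvPolynomial (Fin (c + d)) k)} (hI : Ideal.span (Set.range f) = I)
    (hdim : ringKrullDim (MvPolynomial (Fin (c + d)) k ⧸ I) ≤ d)
    (hjac : ∀ p : Ideal (MvPolynomial (Fin (c + d)) k), p.IsPrime → (∀ i, f i ∈ p) →
      d ≤ ringKrullDim (MvPolynomial (Fin (c + d)) k ⧸ p) →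
      ∀ a : Fin c → MvPolynomial (Fin (c + d)) k,
        (∀ v, ∑ i, a i * MvPolynomial.pderiv v (f i) ∈ p) → ∀ i, a i ∈ p) :
    IsReduced (MvPolynomial (Fin (c + d)) k ⧸ I) := by
  refine ⟨fun x hx => by_contra fun hx0 => ?_⟩
  obtain ⟨p, hp, hle⟩ := exists_le_isAssociatedPrime_of_isNoetherianRing (MvPolynomial (Fin (c + d)) k) x hx0
  have hpp := hp.isPrime
  have hIp : I ≤ p := by
    intro r hr
    refine hle ?_
    rw [Submodule.mem_colon_singleton, Submodule.mem_bot]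
    obtain ⟨y, rfl⟩ := Ideal.Quotient.mk_surjective x
    exact Ideal.Quotient.eq_zero_iff_mem.2 (I.mul_mem_right _ hr)
  have hfp (i) : f i ∈ p := hIp (hI ▸ Ideal.subset_span ⟨i, rfl⟩)
  have hdp : ∀ q ∈ associatedPrimes (MvPolynomial (Fin (c + d)) k) ((MvPolynomial (Fin (c + d)) k) ⧸ I), (d : WithBot ℕ∞) ≤ ringKrullDim ((MvPolynomial (Fin (c + d)) k) ⧸ q) := by
    intro q hq
    refine le_ringKrullDim_quotient_of_mem_associatedPrimes (List.ofFn f) (by simp) ?_ ?_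
    · rwa [Ideal.ofList_ofFn, hI]
    · rwa [Ideal.ofList_ofFn, hI]
  -- A minimal prime strictly below p would also be associated, hence of dimension at least d + 1,
  -- exceeding the dimension of the quotient.
  have hmin : p ∈ I.minimalPrimes := by
    obtain ⟨q, hq, hqp⟩ := Ideal.exists_minimalPrimes_le hIp
    have hqq := hq.1.1
    have hqass : q ∈ associatedPrimes (MvPolynomial (Fin (c + d)) k) ((MvPolynomial (Fin (c + d)) k) ⧸ I) := by
      have := Module.associatedPrimes.minimalPrimes_annihilator_subset_associatedPrimes (MvPolynomial (Fin (c + d)) k) ((MvPolynomial (Fin (c + d)) k) ⧸ I)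
      rw [Ideal.annihilator_quotient] at this
      exact this hq
    rcases hqp.eq_or_lt with rfl | hlt
    · exact hq
    · exfalso
      have h1 := (add_le_add_left (hdp p hp) 1).trans (ringKrullDim_quotient_succ_le_of_lt hlt)
      have h2 := h1.trans ((ringKrullDim_le_of_surjective (Ideal.Quotient.factor hq.1.2)
        (Ideal.Quotient.factor_surjective hq.1.2)).trans hdim)
      have h3 : d + 1 ≤ d := by exact_mod_cast h2
      omega
  have hht : ringKrullDim (Localization.AtPrime p) ≤ c := by
    rw [IsLocalization.AtPrime.ringKrullDim_eq_height p (Localization.AtPrime p)]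
    have := Ideal.height_le_card_of_mem_minimalPrimes_span (Set.finite_range f) (hI ▸ hmin)
    have h2 : (Set.range f).ncard ≤ c := by
      rw [← Set.image_univ]
      exact (Set.ncard_image_le Set.finite_univ).trans (by simp [Set.ncard_univ])
    exact_mod_cast this.trans (by exact_mod_cast h2)
  have hmap : p.map (algebraMap (MvPolynomial (Fin (c + d)) k) (Localization.AtPrime p)) = maximalIdeal (Localization.AtPrime p) := Localization.AtPrime.map_eq_maximalIdeal
  have hcomap (a : (MvPolynomial (Fin (c + d)) k)) : algebraMap (MvPolynomial (Fin (c + d)) k) (Localization.AtPrime p) a ∈ maximalIdeal (Localization.AtPrime p) ↔ a ∈ p :=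
    IsLocalization.AtPrime.to_map_mem_maximal_iff (Localization.AtPrime p) p a
  -- By Krull the local ring at p, which is regular, has dimension at most c, and the c equations
  -- are independent in its cotangent space. They thus generate the maximal ideal, so the quotient
  -- localized at p is a field and the nilpotent x vanishes there. That contradicts the inclusion of
  -- its annihilator in p.
  have hspan : Ideal.span (Set.range fun i => algebraMap (MvPolynomial (Fin (c + d)) k) (Localization.AtPrime p) (f i)) = maximalIdeal (Localization.AtPrime p) := by
    refine IsRegularLocalRing.span_range_eq_maximalIdeal _ (fun i => (hcomap _).2 (hfp i)) hht ?_
    intro g hg i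
    obtain ⟨s, hs⟩ := IsLocalization.exist_integer_multiples_of_finite p.primeCompl g
    choose a ha using hs
    -- Clearing denominators turns the relation in the local ring into a polynomial one, which can
    -- be differentiated.
    have hsum : algebraMap (MvPolynomial (Fin (c + d)) k) (Localization.AtPrime p) (∑ i, a i * f i) ∈ (p ^ 2).map (algebraMap (MvPolynomial (Fin (c + d)) k) (Localization.AtPrime p)) := by
      rw [Ideal.map_pow, hmap, map_sum]
      convert! Ideal.mul_mem_left _ (algebraMap (MvPolynomial (Fin (c + d)) k) (Localization.AtPrime p) s) hg using 1
      rw [Finset.mul_sum]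
      refine Finset.sum_congr rfl fun i _ => ?_
      rw [map_mul, ha i, Algebra.smul_def, mul_assoc]
    rw [IsLocalization.algebraMap_mem_map_algebraMap_iff p.primeCompl] at hsum
    obtain ⟨t, ht, hts⟩ := hsum
    have hai : a i ∈ p := by
      refine hjac p hpp hfp (hdp p hp) a (fun v => ?_) i
      have h1 := Ideal.pderiv_mem_of_mem_sq hts v
      rw [Derivation.leibniz] at h1
      have hfs : ∑ i, a i * f i ∈ p := Ideal.sum_mem _ fun i _ => p.mul_mem_left _ (hfp i)
      have h2 := (Ideal.add_mem_iff_left p (p.mul_mem_right _ hfs)).1 h1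
      have h3 := (hpp.mem_or_mem h2).resolve_left ht
      rw [map_sum] at h3
      simp only [Derivation.leibniz, smul_eq_mul, Finset.sum_add_distrib] at h3
      exact (Ideal.add_mem_iff_left p (Ideal.sum_mem _ fun i _ => p.mul_mem_right _ (hfp i))).1 h3
    have h4 : algebraMap (MvPolynomial (Fin (c + d)) k) (Localization.AtPrime p) s * g i ∈ maximalIdeal (Localization.AtPrime p) := by
      rw [← Algebra.smul_def]
      rw [← hcomap, ha i] at hai
      exact hai
    exact ((Ideal.IsPrime.mem_or_mem inferInstance) h4).resolve_left
      (fun h => s.2 ((hcomap _).1 h))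
  obtain ⟨x, rfl⟩ := Ideal.Quotient.mk_surjective x
  obtain ⟨N, hN⟩ := hx
  rw [← map_pow, Ideal.Quotient.eq_zero_iff_mem] at hN
  have hxp : x ∈ p := hpp.mem_of_pow_mem _ (hIp hN)
  have hxI : algebraMap (MvPolynomial (Fin (c + d)) k) (Localization.AtPrime p) x ∈ I.map (algebraMap (MvPolynomial (Fin (c + d)) k) (Localization.AtPrime p)) := by
    rw [← hI, Ideal.map_span, ← Set.range_comp]
    exact hspan ▸ (hcomap x).2 hxp
  rw [IsLocalization.algebraMap_mem_map_algebraMap_iff p.primeCompl] at hxI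
  obtain ⟨t, ht, htx⟩ := hxI
  refine ht (hle ?_)
  rw [Submodule.mem_colon_singleton, Submodule.mem_bot]
  exact Ideal.Quotient.eq_zero_iff_mem.2 htx

end

/-! ### Jordan normal form of a nilpotent endomorphism -/

section

theorem DFinsupp.basis_apply {ι R : Type*} [DecidableEq ι] [Semiring R] {M η : ι → Type*}
    [∀ i, AddCommMonoid (M i)] [∀ i, Module R (M i)] (b : ∀ i, Module.Basis (η i) R (M i))
    (i : ι) (j : η i) : DFinsupp.basis b ⟨i, j⟩ = DFinsupp.single i (b i j) := by
  classical
  rw [Module.Basis.apply_eq_iff]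
  ext ⟨i', j'⟩
  change (DFinsupp.mapRange.linearEquiv (fun i => (b i).repr) (DFinsupp.single i (b i j)) i') j' = _
  rw [DFinsupp.mapRange.linearEquiv_apply]
  by_cases h : i = i'
  · subst h
    simp [Finsupp.single_apply]
  · have h' : i' ≠ i := fun h' => h h'.symm
    simp [h, h']

open Polynomial DirectSum in
/-- The Jordan normal form of a nilpotent endomorphism. -/
theorem exists_jordanBasis_of_isNilpotent {F V : Type*} [Field F] [AddCommGroup V] [Module F V]
    [FiniteDimensional F V] {φ : Module.End F V} (hφ : IsNilpotent φ) :
    ∃ (d : ℕ) (k : Fin d → ℕ) (b : Module.Basis (Σ i, Fin (k i)) F V),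
      (∀ i (j : ℕ) (h : j + 1 < k i), φ (b ⟨i, ⟨j, by omega⟩⟩) = b ⟨i, ⟨j + 1, h⟩⟩) ∧
      ∀ i (j : ℕ) (h : j + 1 = k i), φ (b ⟨i, ⟨j, by omega⟩⟩) = 0 := by
  obtain ⟨N, hN⟩ := hφ
  -- With X acting as φ, V is X-power torsion over F[X], hence a sum of modules F[X]/(X^k). In each,
  -- multiplication by X shifts the basis 1, X, …, X^(k-1).
  have htors : Module.IsTorsion' (Module.AEval' φ) (Submonoid.powers (X : F[X])) := by
    intro x
    refine ⟨⟨X ^ N, N, rfl⟩, ?_⟩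
    obtain ⟨x, rfl⟩ := (Module.AEval'.of φ).surjective x
    change (X ^ N : F[X]) • Module.AEval'.of φ x = 0
    rw [Module.AEval'.X_pow_smul_of, hN]
    simp
  obtain ⟨d, k, ⟨e⟩⟩ := Module.torsion_by_prime_power_decomposition (irreducible_X) htors
  let B (i : Fin d) : Module.Basis (Fin (k i)) F (F[X] ⧸ F[X] ∙ ((X : F[X]) ^ k i)) :=
    (AdjoinRoot.powerBasis' (monic_X_pow (R := F) (k i))).basis.reindex
      (finCongr (by simp))
  have hB (i) (j : Fin (k i)) : B i j = Submodule.Quotient.mk (X ^ (j : ℕ)) := by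
    have h1 := (AdjoinRoot.powerBasis' (monic_X_pow (R := F) (k i))).basis_eq_pow
      ((finCongr (by simp)).symm j)
    exact (Module.Basis.reindex_apply
      (AdjoinRoot.powerBasis' (monic_X_pow (R := F) (k i))).basis (finCongr (by simp)) j).trans h1
  let D : Module.Basis (Σ i, Fin (k i)) F (⨁ i, (F[X] ⧸ F[X] ∙ ((X : F[X]) ^ k i))) :=
    DFinsupp.basis B
  have hD (i) (j : Fin (k i)) : D ⟨i, j⟩ = DirectSum.lof F _
      (fun i => F[X] ⧸ F[X] ∙ ((X : F[X]) ^ k i)) i (Submodule.Quotient.mk (X ^ (j : ℕ))) := by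
    rw [← hB]
    exact DFinsupp.basis_apply B i j
  let e' : (⨁ i, (F[X] ⧸ F[X] ∙ ((X : F[X]) ^ k i))) ≃ₗ[F] V :=
    (e.restrictScalars F).symm ≪≫ₗ (Module.AEval'.of φ).symm
  have key (i) (j : ℕ) (hj : j < k i) : φ (e' (D ⟨i, ⟨j, hj⟩⟩)) =
      e' (DirectSum.lof F _ (fun i => F[X] ⧸ F[X] ∙ ((X : F[X]) ^ k i)) i
        (Submodule.Quotient.mk (X ^ (j + 1)))) := by
    have h1 : D ⟨i, ⟨j, hj⟩⟩ = DirectSum.lof F[X] _ (fun i => F[X] ⧸ F[X] ∙ ((X : F[X]) ^ k i)) i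
        (Submodule.Quotient.mk (X ^ j)) := by
      rw [hD]; rfl
    have h2 (y : Module.AEval' φ) : φ ((Module.AEval'.of φ).symm y) =
        (Module.AEval'.of φ).symm ((X : F[X]) • y) := by
      rw [Module.AEval'.of_symm_X_smul]
    simp only [e', LinearEquiv.trans_apply]
    rw [h2]
    congr 1
    change X • e.symm (D _) = e.symm _
    rw [← map_smul, h1, ← map_smul, ← Submodule.Quotient.mk_smul, smul_eq_mul, ← pow_succ']
    rfl
  refine ⟨d, k, D.map e', ?_, ?_⟩
  · intro i j h
    rw [Module.Basis.map_apply, Module.Basis.map_apply, key]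
    congr 1
    rw [hD]
  · intro i j h
    rw [Module.Basis.map_apply, key]
    have : (Submodule.Quotient.mk (X ^ (j + 1)) : F[X] ⧸ F[X] ∙ ((X : F[X]) ^ k i)) = 0 := by
      rw [Submodule.Quotient.mk_eq_zero, h]
      exact Submodule.mem_span_singleton_self _
    rw [this]; simp

end

/-! ### Solutions Φ of ΦN = qNΦ for a nilpotent N -/

section
open Matrix

/-- The direct sum of nilpotent Jordan blocks of sizes `k i`. -/
def nilpotentJordan {d : ℕ} (k : Fin d → ℕ) (R : Type*) [CommRing R] :
    Matrix (Σ i, Fin (k i)) (Σ i, Fin (k i)) R :=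
  Matrix.of fun a b => if a.1 = b.1 ∧ (a.2 : ℕ) = b.2 + 1 then 1 else 0

theorem nilpotentJordan_map {d : ℕ} (k : Fin d → ℕ) {R S : Type*} [CommRing R] [CommRing S]
    (f : R →+* S) : (nilpotentJordan k R).map f = nilpotentJordan k S := by
  ext a b
  simp [nilpotentJordan, apply_ite f]

theorem Matrix.exists_jordan_of_isNilpotent {F : Type*} [Field F] {n : ℕ}
    {N : Matrix (Fin n) (Fin n) F} (hN : IsNilpotent N) :
    ∃ (d : ℕ) (k : Fin d → ℕ) (g : Matrix (Fin n) (Σ i, Fin (k i)) F)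
      (h : Matrix (Σ i, Fin (k i)) (Fin n) F), ∑ i, k i = n ∧
      g * h = 1 ∧ h * g = 1 ∧ N * g = g * nilpotentJordan k F := by
  have hφ : IsNilpotent (Matrix.toLin' N) := by
    exact hN.map (Matrix.toLinAlgEquiv' : _ ≃ₐ[F] _)
  obtain ⟨d, k, b, hb1, hb2⟩ := exists_jordanBasis_of_isNilpotent hφ
  let e := Pi.basisFun F (Fin n)
  refine ⟨d, k, e.toMatrix b, b.toMatrix e, ?_, e.toMatrix_mul_toMatrix_flip b,
    b.toMatrix_mul_toMatrix_flip e, ?_⟩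
  · have := Module.finrank_eq_card_basis b
    simpa using this.symm
  · ext r ⟨i, j⟩
    have h1 : (N * e.toMatrix b) r ⟨i, j⟩ = (Matrix.toLin' N (b ⟨i, j⟩)) r := by
      simp [Matrix.mul_apply, Matrix.mulVec, dotProduct, e, Module.Basis.toMatrix_apply]
    rw [h1, Matrix.mul_apply, Fintype.sum_sigma, Finset.sum_eq_single i]
    · simp only [Module.Basis.toMatrix_apply, nilpotentJordan, Matrix.of_apply, true_and]
      by_cases hj : (j : ℕ) + 1 < k i
      · rw [hb1 i j hj, Finset.sum_eq_single ⟨j + 1, hj⟩]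
        · simp [e]
        · intro x _ hx
          rw [if_neg, mul_zero]
          intro h; exact hx (Fin.ext h)
        · simp
      · rw [hb2 i j (by omega)]
        symm
        apply Finset.sum_eq_zero
        intro x _
        rw [if_neg (by omega), mul_zero]
    · intro x _ hx
      apply Finset.sum_eq_zero
      intro y _
      simp [nilpotentJordan, hx]
    · simp

section
variable {F : Type*} [Field F] {n d : ℕ} {k : Fin d → ℕ} {N : Matrix (Fin n) (Fin n) F}
  {g : Matrix (Fin n) (Σ i, Fin (k i)) F} {h : Matrix (Σ i, Fin (k i)) (Fin n) F}

/-- N sends each vector of a chain to the next, so weights multiplied by q along every chain solve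
the equation. The starting weight of each chain is free. -/
theorem diagonal_mul_nilpotentJordan (a : Fin d → F) (q : F) :
    Matrix.diagonal (fun x : Σ i, Fin (k i) => a x.1 * q ^ (x.2 : ℕ)) * nilpotentJordan k F =
      q • (nilpotentJordan k F * Matrix.diagonal fun x => a x.1 * q ^ (x.2 : ℕ)) := by
  ext ⟨i, j⟩ ⟨i', j'⟩
  rw [Matrix.smul_apply, Matrix.diagonal_mul, Matrix.mul_diagonal]
  simp only [nilpotentJordan, Matrix.of_apply]
  split_ifs with hx
  · obtain ⟨rfl, hx⟩ := hx
    rw [hx, smul_eq_mul]; ring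
  · simp

/-- The second equation kills every entry (x, y) except where the weight of y is q times that of x.
By `ha`, y must then follow x in its chain. On the diagonal the first equation says that these
entries u_j satisfy 0 = q u_0 and u_j = q u_(j+1) along each chain, so all of them vanish. -/
theorem eq_zero_of_nilpotentJordan_of_diagonal (a : Fin d → F) (q : F) (hq : q ≠ 0)
    (ha : ∀ x y : Σ i, Fin (k i), a y.1 * q ^ (y.2 : ℕ) = a x.1 * q ^ (x.2 + 1 : ℕ) →
      x.1 = y.1 ∧ (y.2 : ℕ) = x.2 + 1)
    (Y : Matrix (Σ i, Fin (k i)) (Σ i, Fin (k i)) F)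
    (h1 : nilpotentJordan k F * Y = q • (Y * nilpotentJordan k F))
    (h2 : Y * Matrix.diagonal (fun x => a x.1 * q ^ (x.2 : ℕ)) =
      q • (Matrix.diagonal (fun x => a x.1 * q ^ (x.2 : ℕ)) * Y)) : Y = 0 := by
  have hz (x y) (hxy : ¬ (x.1 = y.1 ∧ (y.2 : ℕ) = x.2 + 1)) : Y x y = 0 := by
    by_contra hne
    have := congrFun (congrFun h2 x) y
    rw [Matrix.smul_apply, Matrix.diagonal_mul, Matrix.mul_diagonal, smul_eq_mul] at this
    refine hxy (ha x y (mul_left_cancel₀ hne ?_))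
    rw [this]; ring
  have hJ (i) (j : ℕ) (hj : j + 1 < k i) (y) :
      (nilpotentJordan k F * Y) ⟨i, ⟨j + 1, hj⟩⟩ y = Y ⟨i, ⟨j, by omega⟩⟩ y := by
    rw [Matrix.mul_apply, Finset.sum_eq_single ⟨i, ⟨j, by omega⟩⟩]
    · simp [nilpotentJordan]
    · rintro ⟨i', j'⟩ _ hx
      simp only [nilpotentJordan, Matrix.of_apply]
      rw [if_neg, zero_mul]
      rintro ⟨hi, hj2⟩
      subst hi
      have hj3 : j' = ⟨j, by omega⟩ := Fin.ext (Nat.succ_injective hj2).symm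
      exact hx (by rw [hj3])
    · simp
  have hJ' (i) (j : ℕ) (hj : j + 1 < k i) (y) :
      (Y * nilpotentJordan k F) y ⟨i, ⟨j, by omega⟩⟩ = Y y ⟨i, ⟨j + 1, hj⟩⟩ := by
    rw [Matrix.mul_apply, Finset.sum_eq_single ⟨i, ⟨j + 1, hj⟩⟩]
    · simp [nilpotentJordan]
    · rintro ⟨i', j'⟩ _ hx
      simp only [nilpotentJordan, Matrix.of_apply]
      rw [if_neg, mul_zero]
      rintro ⟨hi, hj2⟩
      subst hi
      have hj3 : j' = ⟨j + 1, hj⟩ := Fin.ext hj2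
      exact hx (by rw [hj3])
    · simp
  have hu (i) (j : ℕ) : ∀ hj : j + 1 < k i, Y ⟨i, ⟨j, by omega⟩⟩ ⟨i, ⟨j + 1, hj⟩⟩ = 0 := by
    induction j with
    | zero =>
      intro hj
      have := congrFun (congrFun h1 ⟨i, ⟨0, by omega⟩⟩) ⟨i, ⟨0, by omega⟩⟩
      rw [Matrix.smul_apply, hJ' i 0 hj, Matrix.mul_apply, Finset.sum_eq_zero] at this
      · exact (smul_eq_zero.1 this.symm).resolve_left hq
      · rintro ⟨i', j'⟩ _
        simp [nilpotentJordan]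
    | succ j ih =>
      intro hj
      have := congrFun (congrFun h1 ⟨i, ⟨j + 1, by omega⟩⟩) ⟨i, ⟨j + 1, by omega⟩⟩
      rw [Matrix.smul_apply, hJ' i (j + 1) hj, hJ i j (by omega), ih] at this
      exact (smul_eq_zero.1 this.symm).resolve_left hq
  ext ⟨i, j⟩ ⟨i', j'⟩
  by_cases hxy : i = i' ∧ (j' : ℕ) = j + 1
  · obtain ⟨rfl, hj⟩ := hxy
    have : j' = ⟨j + 1, by omega⟩ := Fin.ext hj
    rw [this]
    exact hu i j (by omega)
  · exact hz _ _ hxy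

end

/-- Each equality is a nontrivial polynomial condition on t, and there are finitely many. With
starting weights t^i, weights in different Jordan blocks then never differ by a small power of q. -/
theorem exists_separating {F : Type*} [Field F] [Infinite F] (q : F) (hq : q ≠ 0) (d m : ℕ) :
    ∃ t : F, t ≠ 0 ∧ ∀ e ∈ Finset.Icc 1 d, ∀ r ≤ m, ∀ s ≤ m, t ^ e * q ^ r ≠ q ^ s := by
  open Polynomial in
  let p : F[X] := X * ∏ e ∈ Finset.Icc 1 d, ∏ r ∈ Finset.range (m + 1),
    ∏ s ∈ Finset.range (m + 1), (X ^ e * C (q ^ r) - C (q ^ s))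
  have hp : p ≠ 0 := by
    refine mul_ne_zero X_ne_zero (Finset.prod_ne_zero_iff.2 fun e he => Finset.prod_ne_zero_iff.2
      fun r _ => Finset.prod_ne_zero_iff.2 fun s _ h0 => ?_)
    have := congrArg (eval 0) h0
    have he : e ≠ 0 := by have := (Finset.mem_Icc.1 he).1; omega
    simp [he, hq] at this
  obtain ⟨t, ht⟩ : ∃ t, p.eval t ≠ 0 := by
    by_contra! hall
    exact hp (Polynomial.funext (by simpa using hall))
  simp only [p, eval_mul, eval_X, eval_prod, eval_sub, eval_pow, eval_C, mul_ne_zero_iff,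
    Finset.prod_ne_zero_iff, Finset.mem_range] at ht
  refine ⟨t, ht.1, fun e he r hr s hs h => ht.2 e he r (by omega) s (by omega) ?_⟩
  rw [h, sub_self]

/-- Over an infinite field, a nilpotent matrix `N` has an invertible `Φ` with `ΦN = qNΦ` at which
the dual equations have only the trivial solution. -/
theorem exists_regular_of_isNilpotent {F : Type*} [Field F] [Infinite F] {n : ℕ} {q : F}
    (hq : q ≠ 0) (hqi : ∀ i ∈ Finset.Icc 1 n, q ^ i ≠ 1) {N : Matrix (Fin n) (Fin n) F}
    (hN : IsNilpotent N) :
    ∃ Φ : Matrix (Fin n) (Fin n) F, Φ * N = q • (N * Φ) ∧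
      ∀ Y : Matrix (Fin n) (Fin n) F, N * Y = q • (Y * N) → Y * Φ = q • (Φ * Y) → Y = 0 := by
  obtain ⟨d, k, g, h, hk, hgh, hhg, hJ⟩ := Matrix.exists_jordan_of_isNilpotent hN
  -- Block indices differ by less than d, and the powers of q to be compared have exponents at most
  -- n.
  obtain ⟨t, ht0, ht⟩ := exists_separating q hq d (n + 1)
  let a : Fin d → F := fun i => t ^ (i : ℕ)
  have hJ' : h * N = nilpotentJordan k F * h := by
    calc h * N = h * (N * g) * h := by rw [Matrix.mul_assoc, Matrix.mul_assoc, hgh, Matrix.mul_one]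
      _ = _ := by rw [hJ, ← Matrix.mul_assoc h, hhg, Matrix.one_mul]
  have hkn (x : Σ i, Fin (k i)) : (x.2 : ℕ) + 1 ≤ n := by
    have h1 : k x.1 ≤ ∑ i, k i := Finset.single_le_sum (fun _ _ => Nat.zero_le _) (Finset.mem_univ _)
    have := x.2.2
    omega
  obtain ⟨D, hD⟩ : ∃ D, D = Matrix.diagonal (fun x : Σ i, Fin (k i) => a x.1 * q ^ (x.2 : ℕ)) :=
    ⟨_, rfl⟩
  have hDJ : D * nilpotentJordan k F = q • (nilpotentJordan k F * D) := by
    rw [hD]; exact diagonal_mul_nilpotentJordan a q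
  refine ⟨g * D * h, ?_, fun Y h1 h2 => ?_⟩
  · calc g * D * h * N = g * (D * nilpotentJordan k F) * h := by
          rw [Matrix.mul_assoc, hJ']; simp only [Matrix.mul_assoc]
      _ = q • (g * nilpotentJordan k F * D * h) := by
          rw [hDJ]; simp [Matrix.mul_assoc]
      _ = _ := by rw [← hJ]; simp only [Matrix.mul_assoc]
  · have hY : h * Y * g = 0 := by
      refine eq_zero_of_nilpotentJordan_of_diagonal a q hq ?_ _ ?_ ?_
      · intro x y hxy
        have hx := hkn x
        have hy := hkn y
        rcases lt_trichotomy (x.1 : ℕ) y.1 with hlt | heq | hlt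
        · exfalso
          refine ht (y.1 - x.1) ?_ y.2 (by omega) (x.2 + 1) (by omega) ?_
          · rw [Finset.mem_Icc]; have := y.1.2; omega
          · apply mul_left_cancel₀ (pow_ne_zero (x.1 : ℕ) ht0)
            rw [← mul_assoc, ← pow_add, Nat.add_sub_cancel' hlt.le]
            exact hxy
        -- Inside one block the two exponents of q differ by at most n, so equal weights with
        -- distinct exponents would contradict banality.
        · refine ⟨Fin.ext heq, ?_⟩
          simp only [a, heq] at hxy
          have hxy := mul_left_cancel₀ (pow_ne_zero _ ht0) hxy
          by_contra hne
          rcases Nat.lt_or_gt_of_ne hne with hlt | hlt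
          · refine hqi (x.2 + 1 - y.2) (by rw [Finset.mem_Icc]; omega) ?_
            apply mul_left_cancel₀ (pow_ne_zero (y.2 : ℕ) hq)
            rw [← pow_add, Nat.add_sub_cancel' hlt.le, mul_one, hxy]
          · refine hqi (y.2 - (x.2 + 1)) (by rw [Finset.mem_Icc]; omega) ?_
            apply mul_left_cancel₀ (pow_ne_zero (x.2 + 1 : ℕ) hq)
            rw [← pow_add, Nat.add_sub_cancel' hlt.le, mul_one, hxy]
        · exfalso
          refine ht (x.1 - y.1) ?_ (x.2 + 1) (by omega) y.2 (by omega) ?_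
          · rw [Finset.mem_Icc]; have := x.1.2; omega
          · apply mul_left_cancel₀ (pow_ne_zero (y.1 : ℕ) ht0)
            rw [← mul_assoc, ← pow_add, Nat.add_sub_cancel' hlt.le]
            exact hxy.symm
      · calc nilpotentJordan k F * (h * Y * g) = h * (N * Y) * g := by
              simp only [← Matrix.mul_assoc, hJ']
          _ = q • (h * Y * (N * g)) := by rw [h1]; simp [Matrix.mul_assoc]
          _ = _ := by rw [hJ]; simp only [Matrix.mul_assoc]
      · rw [← hD]
        calc h * Y * g * D = h * (Y * (g * D * h)) * g := by
              simp only [Matrix.mul_assoc, hhg, Matrix.mul_one]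
          _ = q • (h * g * D * h * Y * g) := by rw [h2]; simp [Matrix.mul_assoc]
          _ = _ := by rw [hhg, Matrix.one_mul]; simp only [Matrix.mul_assoc]
    calc Y = g * (h * Y * g) * h := by
          rw [Matrix.mul_assoc h, ← Matrix.mul_assoc g, hgh, Matrix.one_mul, Matrix.mul_assoc, hgh,
            Matrix.mul_one]
      _ = 0 := by rw [hY]; simp

/-- With all starting weights equal to 1 the diagonal entries are powers of q, hence invertible.
This solution is the base point of the coset of all solutions. -/
theorem exists_isUnit_of_isNilpotent {F : Type*} [Field F] {n : ℕ} {q : F}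
    (hq : q ≠ 0) {N : Matrix (Fin n) (Fin n) F} (hN : IsNilpotent N) :
    ∃ Φ Ψ : Matrix (Fin n) (Fin n) F, Φ * N = q • (N * Φ) ∧ Φ * Ψ = 1 ∧ Ψ * Φ = 1 := by
  obtain ⟨d, k, g, h, hk, hgh, hhg, hJ⟩ := Matrix.exists_jordan_of_isNilpotent hN
  have hJ' : h * N = nilpotentJordan k F * h := by
    calc h * N = h * (N * g) * h := by rw [Matrix.mul_assoc, Matrix.mul_assoc, hgh, Matrix.mul_one]
      _ = _ := by rw [hJ, ← Matrix.mul_assoc h, hhg, Matrix.one_mul]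
  let a : Fin d → F := fun _ => 1
  obtain ⟨D, hD⟩ : ∃ D, D = Matrix.diagonal (fun x : Σ i, Fin (k i) => a x.1 * q ^ (x.2 : ℕ)) :=
    ⟨_, rfl⟩
  have hDJ : D * nilpotentJordan k F = q • (nilpotentJordan k F * D) := by
    rw [hD]; exact diagonal_mul_nilpotentJordan a q
  set D' := Matrix.diagonal (fun x : Σ i, Fin (k i) => (a x.1 * q ^ (x.2 : ℕ))⁻¹) with hD'
  have hDD' : D * D' = 1 := by
    rw [hD, hD', Matrix.diagonal_mul_diagonal, ← Matrix.diagonal_one]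
    congr 1; ext x
    exact mul_inv_cancel₀ (by simp [a, hq])
  have hinv : g * D * h * (g * D' * h) = 1 := by
    calc _ = g * (D * (h * g) * D') * h := by simp only [Matrix.mul_assoc]
      _ = 1 := by rw [hhg, Matrix.mul_one, hDD', Matrix.mul_one, hgh]
  refine ⟨g * D * h, g * D' * h, ?_, hinv, mul_eq_one_comm.1 hinv⟩
  calc g * D * h * N = g * (D * nilpotentJordan k F) * h := by
        rw [Matrix.mul_assoc, hJ']; simp only [Matrix.mul_assoc]
    _ = q • (g * nilpotentJordan k F * D * h) := by
        rw [hDJ]; simp [Matrix.mul_assoc]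
    _ = _ := by rw [← hJ]; simp only [Matrix.mul_assoc]

end

/-! ### Dimension of nilpotent orbits and centralizers -/

section
open Matrix

theorem IntermediateField.isAlgebraic_adjoin_of_adjoin_eq_top {k L : Type*} [Field k] [Field L]
    [Algebra k L] {s : Set L} (hs : IntermediateField.adjoin k s = ⊤) :
    Algebra.IsAlgebraic (Algebra.adjoin k s) L := by
  refine ⟨fun x => ?_⟩
  have hx : x ∈ IntermediateField.adjoin k s := hs ▸ IntermediateField.mem_top
  obtain ⟨r, hr, t, ht, rfl⟩ := IntermediateField.mem_adjoin_iff_div.1 hx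
  rw [div_eq_mul_inv]
  exact (isAlgebraic_algebraMap (A := L) (⟨r, hr⟩ : Algebra.adjoin k s)).mul
    (isAlgebraic_algebraMap (A := L) (⟨t, ht⟩ : Algebra.adjoin k s)).inv

/-- The matrices commuting with `N`, as a subspace. -/
def Matrix.centralizerSubmodule {F : Type*} [Field F] {n : ℕ} (N : Matrix (Fin n) (Fin n) F) :
    Submodule F (Matrix (Fin n) (Fin n) F) :=
  Subalgebra.toSubmodule (Subalgebra.centralizer F {N})

theorem Matrix.mem_centralizerSubmodule {F : Type*} [Field F] {n : ℕ}
    {N X : Matrix (Fin n) (Fin n) F} : X ∈ centralizerSubmodule N ↔ X * N = N * X := by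
  simp [centralizerSubmodule, Subalgebra.mem_centralizer_iff, eq_comm]

/-- The Jordan form has entries 0 and 1. Integrality of J is what matters: N = gJg⁻¹ then has its
entries in the field generated by those of g alone. -/
theorem Matrix.exists_int_conj_of_isNilpotent {F : Type*} [Field F] {n : ℕ}
    {N : Matrix (Fin n) (Fin n) F} (hN : IsNilpotent N) :
    ∃ (J : Matrix (Fin n) (Fin n) ℤ) (g h : Matrix (Fin n) (Fin n) F), g * h = 1 ∧ h * g = 1 ∧
      N * g = g * J.map (Int.castRingHom F) := by
  obtain ⟨d, k, g, h, hk, hgh, hhg, hJ⟩ := Matrix.exists_jordan_of_isNilpotent hN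
  have hcard : Fintype.card (Σ i, Fin (k i)) = n := by simpa using hk
  let e : (Σ i, Fin (k i)) ≃ Fin n := Fintype.equivFinOfCardEq hcard
  refine ⟨(nilpotentJordan k ℤ).submatrix e.symm e.symm, g.submatrix id e.symm,
    h.submatrix e.symm id, ?_, ?_, ?_⟩
  · rw [Matrix.submatrix_mul_equiv, hgh, Matrix.submatrix_id_id]
  · rw [← Matrix.submatrix_mul _ _ _ _ _ Function.bijective_id, hhg, Matrix.submatrix_one_equiv]
  · rw [← Matrix.submatrix_map, nilpotentJordan_map, Matrix.submatrix_mul_equiv, ← hJ,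
      Matrix.submatrix_mul _ _ _ _ _ Function.bijective_id, Matrix.submatrix_id_id]

/-- A matrix over an extension field commuting with `N` is a combination of a basis of the
centralizer of `N`. -/
theorem Matrix.exists_sum_smul_of_commute {F K ι : Type*} [Field F] [Field K] [Algebra F K]
    [Fintype ι] {n : ℕ} (N : Matrix (Fin n) (Fin n) F)
    (C : Module.Basis ι F (centralizerSubmodule N)) (X : Matrix (Fin n) (Fin n) K)
    (hX : X * N.map (algebraMap F K) = N.map (algebraMap F K) * X) :
    ∃ t : ι → K, X = ∑ i, t i • (C i : Matrix (Fin n) (Fin n) F).map (algebraMap F K) := by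
  classical
  let b := Module.Basis.ofVectorSpace F K
  -- Expand X in an F-basis of K: since N has entries in F, every coordinate matrix commutes with N.
  have hXj (j) : X.map (b.coord j) ∈ centralizerSubmodule N := by
    rw [mem_centralizerSubmodule]
    ext r s
    have := congrArg (b.coord j) (congrFun (congrFun hX r) s)
    simp only [Matrix.mul_apply, Matrix.map_apply, map_sum] at this ⊢
    convert this using 1 with
    · refine Finset.sum_congr rfl fun x _ => ?_
      rw [mul_comm (X r x), ← Algebra.smul_def, map_smul, smul_eq_mul, mul_comm]
    · refine Finset.sum_congr rfl fun x _ => ?_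
      rw [← Algebra.smul_def, map_smul, smul_eq_mul]
  let S := Finset.univ.biUnion fun r => Finset.univ.biUnion fun s => (b.repr (X r s)).support
  refine ⟨fun i => ∑ j ∈ S, C.repr ⟨_, hXj j⟩ i • b j, ?_⟩
  ext r s
  have h1 : X r s = ∑ j ∈ S, b.repr (X r s) j • b j := by
    conv_lhs => rw [← b.linearCombination_repr (X r s), Finsupp.linearCombination_apply]
    refine Finset.sum_subset ?_ ?_
    · intro x hx
      simp only [S, Finset.mem_biUnion, Finset.mem_univ, true_and]
      exact ⟨r, s, hx⟩
    · intro x _ hx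
      rw [Finsupp.notMem_support_iff.1 hx]
      exact zero_smul _ _
  have h2 (j) : b.repr (X r s) j = ∑ i, C.repr ⟨_, hXj j⟩ i * (C i).1 r s := by
    have := congrArg (fun Z : centralizerSubmodule N => Z.1 r s) (C.sum_repr ⟨_, hXj j⟩)
    simp only [AddSubmonoidClass.coe_finsetSum, Matrix.sum_apply] at this
    exact this.symm
  rw [h1, Matrix.sum_apply]
  simp only [Matrix.smul_apply, Matrix.map_apply, smul_eq_mul, Finset.sum_mul]
  rw [Finset.sum_comm]
  refine Finset.sum_congr rfl fun j _ => ?_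
  rw [h2, Finset.sum_smul]
  refine Finset.sum_congr rfl fun i _ => ?_
  rw [Algebra.smul_def, Algebra.smul_def, map_mul]; ring

/-- The determinant is a polynomial in t taking the value 1 at t = 0, so it does not vanish at
independent t. -/
theorem det_one_add_sum_smul_ne_zero {F L : Type u} [Field F] [Field L] [Algebra F L] {n z : ℕ}
    (C : Fin z → Matrix (Fin n) (Fin n) F) {t : Fin z → L} (ht : AlgebraicIndependent F t) :
    (1 + ∑ i, t i • (C i).map (algebraMap F L)).det ≠ 0 := by
  let P := MvPolynomial (Fin z) F
  let CP : Matrix (Fin n) (Fin n) P :=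
    1 + ∑ i : Fin z, (MvPolynomial.X i : P) • (C i).map (algebraMap F P)
  have hCP {A : Type u} [CommRing A] [Algebra F A] (t : Fin z → A) :
      (MvPolynomial.aeval t).mapMatrix CP = 1 + ∑ i, t i • (C i).map (algebraMap F A) := by
    rw [map_add, map_one, map_sum]
    congr 1
    refine Finset.sum_congr rfl fun i _ => ?_
    ext r s
    simp [P]
  have h1 : CP.det ≠ 0 := by
    intro h0
    have h2 := congrArg (MvPolynomial.aeval (fun _ : Fin z => (0 : F))) h0
    rw [map_zero, AlgHom.map_det, hCP] at h2
    simp at h2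
  intro h0
  rw [← hCP, ← AlgHom.map_det] at h0
  exact h1 ((map_eq_zero_iff _ ht).1 h0)

/-- The invertible matrix C = 1 + ∑ t_i C_i commutes with N, so G = Cg also satisfies NG = GJ. The
field generated by the n² entries of G contains N = GJG⁻¹, hence F, hence C = Gg⁻¹, hence the t_i.
It is therefore all of L. -/
theorem trdeg_le_sq_of_adjoin_eq_top {k F L : Type u} [Field k] [Field F] [Field L] [Algebra k F]
    [Algebra k L] [Algebra F L] [IsScalarTower k F L] {n z : ℕ}
    {N : Matrix (Fin n) (Fin n) F} (hN : IsNilpotent N)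
    (hF : IntermediateField.adjoin k (Set.range fun x : Fin n × Fin n => N x.1 x.2) = ⊤)
    (C : Module.Basis (Fin z) F (centralizerSubmodule N)) {t : Fin z → L}
    (ht : AlgebraicIndependent F t) (htop : IntermediateField.adjoin F (Set.range t) = ⊤) :
    Algebra.trdeg k L ≤ ((n ^ 2 : ℕ) : Cardinal) := by
  obtain ⟨J, g, h, hgh, hhg, hJ⟩ := exists_int_conj_of_isNilpotent hN
  obtain ⟨CL, hCL⟩ : ∃ CL, CL = 1 + ∑ i, t i • (C i).1.map (algebraMap F L) := ⟨_, rfl⟩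
  have hdet : CL.det ≠ 0 := by
    rw [hCL]; exact det_one_add_sum_smul_ne_zero (fun i => (C i).1) ht
  let NL := N.map (algebraMap F L)
  let gL := g.map (algebraMap F L)
  let hL := h.map (algebraMap F L)
  have hghL : gL * hL = 1 := by
    rw [← Matrix.map_mul, hgh]; simp
  have hJL : NL * gL = gL * J.map (Int.castRingHom L) := by
    rw [← Matrix.map_mul, hJ, Matrix.map_mul]
    congr 1
    ext r s; simp
  have hcomm : NL * CL = CL * NL := by
    rw [hCL, mul_add, add_mul, Matrix.mul_one, Matrix.one_mul, Finset.mul_sum, Finset.sum_mul]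
    congr 1
    refine Finset.sum_congr rfl fun i _ => ?_
    rw [Matrix.mul_smul, Matrix.smul_mul, ← Matrix.map_mul, ← Matrix.map_mul,
      mem_centralizerSubmodule.1 (C i).2]
  obtain ⟨G, hG⟩ : ∃ G, G = CL * gL := ⟨_, rfl⟩
  have hGJ : NL * G = G * J.map (Int.castRingHom L) := by
    rw [hG, ← Matrix.mul_assoc, hcomm, Matrix.mul_assoc, hJL, ← Matrix.mul_assoc]
  have hGh : G * hL = CL := by rw [hG, Matrix.mul_assoc, hghL, Matrix.mul_one]
  have hGdet : G.det ≠ 0 := by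
    rw [hG, Matrix.det_mul]
    refine mul_ne_zero hdet fun h0 => ?_
    have := congrArg Matrix.det hghL
    rw [Matrix.det_mul, h0, zero_mul, Matrix.det_one] at this
    exact zero_ne_one this
  obtain ⟨M, hMdef⟩ : ∃ M, M = IntermediateField.adjoin k
    (Set.range fun x : Fin n × Fin n => G x.1 x.2) := ⟨_, rfl⟩
  have hGM (r s) : G r s ∈ M := hMdef ▸ IntermediateField.subset_adjoin _ _ ⟨(r, s), rfl⟩
  let G0 : Matrix (Fin n) (Fin n) M := Matrix.of fun r s => ⟨G r s, hGM r s⟩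
  have hG0 : G0.map (algebraMap M L) = G := rfl
  have hG0det : IsUnit G0.det := by
    rw [isUnit_iff_ne_zero]
    intro h0
    apply hGdet
    rw [← hG0, ← RingHom.mapMatrix_apply, ← RingHom.map_det, h0, map_zero]
  have hNM : NL = (G0 * J.map (Int.castRingHom M) * G0⁻¹).map (algebraMap M L) := by
    have h1 : (G0 * J.map (Int.castRingHom M)).map (algebraMap M L) = NL * G := by
      rw [hGJ, Matrix.map_mul, hG0]
      congr 1
    rw [Matrix.map_mul, h1, Matrix.mul_assoc, ← hG0, ← Matrix.map_mul,
      Matrix.mul_nonsing_inv _ hG0det, Matrix.map_one _ (map_zero _) (map_one _), Matrix.mul_one]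
  have hFM (x : F) : algebraMap F L x ∈ M := by
    let φ : F →ₐ[k] L := IsScalarTower.toAlgHom k F L
    have : (⊤ : IntermediateField k F) ≤ M.comap φ := by
      rw [← hF, IntermediateField.adjoin_le_iff]
      rintro _ ⟨x, rfl⟩
      have := congrFun (congrFun hNM x.1) x.2
      change algebraMap F L (N x.1 x.2) ∈ M
      change algebraMap F L (N x.1 x.2) = _ at this
      rw [this]
      exact SetLike.coe_mem _
    exact this (IntermediateField.mem_top (x := x))
  have hCM (r s) : CL r s ∈ M := by
    rw [← hGh, Matrix.mul_apply]
    exact sum_mem fun j _ => mul_mem (hGM _ _) (hFM _)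
  -- A coordinate functional on the centralizer, extended to all matrices over F, recovers t_i from
  -- C - 1 as an F-linear combination of entries.
  have htM (i) : t i ∈ M := by
    obtain ⟨f, hf⟩ := LinearMap.exists_extend (C.coord i)
    replace hf (j) : f (C j).1 = if j = i then 1 else 0 := by
      have := LinearMap.congr_fun hf (C j)
      simpa [Finsupp.single_apply] using this
    have hf' (X : Matrix (Fin n) (Fin n) F) : f X = ∑ r, ∑ s, X r s * f (Matrix.single r s 1) := by
      conv_lhs => rw [Matrix.matrix_eq_sum_single X]
      simp only [map_sum]
      refine Finset.sum_congr rfl fun r _ => Finset.sum_congr rfl fun s _ => ?_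
      rw [← smul_eq_mul, ← map_smul, Matrix.smul_single, smul_eq_mul, mul_one]
    have key : t i = ∑ r, ∑ s, (CL - 1) r s * algebraMap F L (f (Matrix.single r s 1)) := by
      rw [hCL, add_sub_cancel_left]
      calc t i = ∑ j, t j * algebraMap F L (f (C j).1) := by simp [hf]
        _ = ∑ j, ∑ r, ∑ s, t j * algebraMap F L ((C j).1 r s) *
              algebraMap F L (f (Matrix.single r s 1)) := by
            refine Finset.sum_congr rfl fun j _ => ?_
            rw [hf', map_sum, Finset.mul_sum]
            refine Finset.sum_congr rfl fun r _ => ?_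
            rw [map_sum, Finset.mul_sum]
            refine Finset.sum_congr rfl fun s _ => ?_
            rw [map_mul, mul_assoc]
        _ = _ := by
            rw [Finset.sum_comm]
            refine Finset.sum_congr rfl fun r _ => ?_
            rw [Finset.sum_comm]
            refine Finset.sum_congr rfl fun s _ => ?_
            rw [Matrix.sum_apply, Finset.sum_mul]
            rfl
    rw [key]
    refine sum_mem fun r _ => sum_mem fun s _ => mul_mem ?_ (hFM _)
    rw [Matrix.sub_apply]
    refine sub_mem (hCM r s) ?_
    rw [Matrix.one_apply]
    split_ifs
    · exact one_mem _
    · exact zero_mem _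
  have hM : IntermediateField.adjoin k (Set.range fun x : Fin n × Fin n => G x.1 x.2) = ⊤ := by
    rw [eq_top_iff, ← hMdef]
    intro x _
    have hx : x ∈ IntermediateField.adjoin F (Set.range t) := htop ▸ IntermediateField.mem_top
    induction hx using IntermediateField.adjoin_induction with
    | mem x hx => obtain ⟨i, rfl⟩ := hx; exact htM i
    | algebraMap x => exact hFM x
    | add x y _ _ hx hy => exact add_mem (hx trivial) (hy trivial)
    | inv x _ hx => exact inv_mem (hx trivial)
    | mul x y _ _ hx hy => exact mul_mem (hx trivial) (hy trivial)
  have halg := IntermediateField.isAlgebraic_adjoin_of_adjoin_eq_top hM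
  refine (Algebra.IsAlgebraic.trdeg_le_cardinalMk k
    (Set.range fun x : Fin n × Fin n => G x.1 x.2)).trans ?_
  have := Cardinal.mk_range_le_lift (f := fun x : Fin n × Fin n => G x.1 x.2)
  simpa [sq] using this

/-- If the field `F` is generated over `k` by the entries of a nilpotent matrix `N`, then
`trdeg F + dim Z(N) ≤ n²`. -/
theorem trdeg_add_finrank_centralizer_le {k F : Type u} [Field k] [Field F] [Algebra k F] {n : ℕ}
    {N : Matrix (Fin n) (Fin n) F} (hN : IsNilpotent N)
    (hF : IntermediateField.adjoin k (Set.range fun x : Fin n × Fin n => N x.1 x.2) = ⊤) :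
    Algebra.trdeg k F + (Module.finrank F (centralizerSubmodule N) : Cardinal) ≤
      ((n ^ 2 : ℕ) : Cardinal) := by
  let z := Module.finrank F (centralizerSubmodule N)
  -- Adjoin one independent variable for each basis vector of the centralizer; the resulting field
  -- still has transcendence degree at most n².
  let C := Module.finBasis F (centralizerSubmodule N)
  let P := MvPolynomial (Fin z) F
  let L := FractionRing P
  have hinj : Function.Injective (algebraMap P L) := IsFractionRing.injective P L
  have ht : AlgebraicIndependent F fun i : Fin z => algebraMap P L (MvPolynomial.X i) :=
    (MvPolynomial.algebraicIndependent_X (Fin z) F).map' (f := IsScalarTower.toAlgHom F P L) hinj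
  have h1 : Algebra.trdeg k L ≤ ((n ^ 2 : ℕ) : Cardinal) := by
    refine trdeg_le_sq_of_adjoin_eq_top hN hF C ht ?_
    rw [eq_top_iff]
    intro x _
    obtain ⟨a, b, _, rfl⟩ := IsFractionRing.div_surjective (A := P) x
    have hP (a : P) : algebraMap P L a ∈ IntermediateField.adjoin F
        (Set.range fun i : Fin z => algebraMap P L (MvPolynomial.X i)) := by
      induction a using MvPolynomial.induction_on with
      | C a => exact IntermediateField.algebraMap_mem _ a
      | add p q hp hq => rw [map_add]; exact add_mem hp hq
      | mul_X p i hp =>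
        rw [map_mul]
        exact mul_mem hp (IntermediateField.subset_adjoin _ _ ⟨i, rfl⟩)
    exact div_mem (hP a) (hP b)
  have h2 : (z : Cardinal) ≤ Algebra.trdeg F L := by
    simpa using ht.lift_cardinalMk_le_trdeg
  rw [← trdeg_add_eq k F (A := L)] at h1
  exact (add_le_add le_rfl h2).trans h1

end

/-! ### Generic solutions and the dual equations over a field -/

section
open Matrix Kronecker

section
variable {k F K : Type u} [Field k] [Field F] [Field K] [Algebra k F] [Algebra k K] [Algebra F K]
  [IsScalarTower k F K] {n q : ℕ} {N : Matrix (Fin n) (Fin n) F}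

/-- ΦΨ⁻¹ commutes with N, so the solutions over any extension form the coset Z(N)Ψ. -/
theorem exists_sum_smul_of_mul_eq_smul_mul {F K ι : Type*} [Field F] [Field K] [Algebra F K]
    [Fintype ι] {n q : ℕ} {N : Matrix (Fin n) (Fin n) F} (hq : (q : F) ≠ 0)
    (C : Module.Basis ι F (centralizerSubmodule N)) {Ψ Ψ' : Matrix (Fin n) (Fin n) F}
    (hΨ : Ψ * N = (q : F) • (N * Ψ)) (h1 : Ψ * Ψ' = 1) (h2 : Ψ' * Ψ = 1)
    {Φ : Matrix (Fin n) (Fin n) K}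
    (hΦ : Φ * N.map (algebraMap F K) = (q : K) • (N.map (algebraMap F K) * Φ)) :
    ∃ t : ι → K, Φ = ∑ i, t i • ((C i).1 * Ψ).map (algebraMap F K) := by
  have hΨ' : N * Ψ' = (q : F) • (Ψ' * N) := by
    calc N * Ψ' = Ψ' * (Ψ * N) * Ψ' := by
          rw [← Matrix.mul_assoc, h2, Matrix.one_mul]
      _ = (q : F) • (Ψ' * N * (Ψ * Ψ')) := by rw [hΨ]; simp [Matrix.mul_assoc]
      _ = _ := by rw [h1, Matrix.mul_one]
  have hΨL : N.map (algebraMap F K) * Ψ'.map (algebraMap F K) =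
      (q : K) • (Ψ'.map (algebraMap F K) * N.map (algebraMap F K)) := by
    rw [← Matrix.map_mul, hΨ', ← Matrix.map_mul]
    ext r s
    rw [Matrix.map_apply, Matrix.smul_apply, Matrix.smul_apply, smul_eq_mul, map_mul, map_natCast]
    rfl
  have hqK : (q : K) ≠ 0 := by
    rw [← map_natCast (algebraMap F K)]
    exact fun h => hq ((map_eq_zero _).1 h)
  obtain ⟨t, ht⟩ := exists_sum_smul_of_commute N C (Φ * Ψ'.map (algebraMap F K)) (by
    apply smul_right_injective _ hqK
    change (q : K) • _ = (q : K) • _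
    rw [Matrix.mul_assoc, ← Matrix.mul_smul, ← hΨL, ← Matrix.mul_assoc, hΦ, Matrix.smul_mul,
      Matrix.mul_assoc])
  refine ⟨t, ?_⟩
  have h3 : Φ = Φ * Ψ'.map (algebraMap F K) * Ψ.map (algebraMap F K) := by
    rw [Matrix.mul_assoc, ← Matrix.map_mul, h2, Matrix.map_one _ (map_zero _) (map_one _),
      Matrix.mul_one]
  rw [h3, ht, Finset.sum_mul]
  refine Finset.sum_congr rfl fun i _ => ?_
  rw [Matrix.smul_mul, Matrix.map_mul]

theorem adjoin_range_coeff_eq_top {ι : Type*} [Fintype ι] {Φ : Matrix (Fin n) (Fin n) K}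
    (hK : IntermediateField.adjoin F (Set.range fun x : Fin n × Fin n => Φ x.1 x.2) = ⊤)
    (X : ι → Matrix (Fin n) (Fin n) F) {t : ι → K}
    (ht : Φ = ∑ i, t i • (X i).map (algebraMap F K)) :
    IntermediateField.adjoin F (Set.range t) = ⊤ := by
  rw [eq_top_iff, ← hK, IntermediateField.adjoin_le_iff]
  rintro _ ⟨x, rfl⟩
  rw [ht]
  simp only [Matrix.sum_apply, Matrix.smul_apply, Matrix.map_apply, smul_eq_mul, SetLike.mem_coe]
  exact sum_mem fun i _ => mul_mem (IntermediateField.subset_adjoin _ _ ⟨i, rfl⟩)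
    (IntermediateField.algebraMap_mem _ _)

/-- The matrix of the linear map `Y ↦ (NY - qYN, YΦ - qΦY)`. -/
def Matrix.dualSystem {R : Type*} [CommRing R] {n : ℕ} (q : ℕ) (Φ N : Matrix (Fin n) (Fin n) R) :
    Matrix ((Fin n × Fin n) ⊕ (Fin n × Fin n)) (Fin n × Fin n) R :=
  Matrix.fromRows ((1 : Matrix (Fin n) (Fin n) R) ⊗ₖ N - (q : R) • (Nᵀ ⊗ₖ 1))
    (Φᵀ ⊗ₖ 1 - (q : R) • ((1 : Matrix (Fin n) (Fin n) R) ⊗ₖ Φ))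

theorem Matrix.dualSystem_mulVec_vec {R : Type*} [CommRing R] {n q : ℕ}
    (Φ N Y : Matrix (Fin n) (Fin n) R) :
    dualSystem q Φ N *ᵥ vec Y =
      Sum.elim (vec (N * Y - (q : R) • (Y * N))) (vec (Y * Φ - (q : R) • (Φ * Y))) := by
  rw [dualSystem, Matrix.fromRows_mulVec, Matrix.sub_mulVec, Matrix.sub_mulVec, Matrix.smul_mulVec,
    Matrix.smul_mulVec]
  have h1 := kronecker_mulVec_vec N Y (1 : Matrix (Fin n) (Fin n) R)
  have h2 := kronecker_mulVec_vec (1 : Matrix (Fin n) (Fin n) R) Y Nᵀ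
  have h3 := kronecker_mulVec_vec (1 : Matrix (Fin n) (Fin n) R) Y Φᵀ
  have h4 := kronecker_mulVec_vec Φ Y (1 : Matrix (Fin n) (Fin n) R)
  rw [h1, h2, h3, h4]
  simp

theorem Matrix.dualSystem_map {R S : Type*} [CommRing R] [CommRing S] {n q : ℕ} (f : R →+* S)
    (Φ N : Matrix (Fin n) (Fin n) R) :
    (dualSystem q Φ N).map f = dualSystem q (Φ.map f) (N.map f) := by
  ext (⟨a, b⟩ | ⟨a, b⟩) ⟨c, d⟩ <;>
  simp [dualSystem, Matrix.fromRows_apply_inl, Matrix.fromRows_apply_inr,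
    Matrix.kroneckerMap_apply, Matrix.one_apply, apply_ite f]

/-- The dual equations at a generic solution `Φ` of `ΦN = qNΦ` have only the trivial solution. -/
theorem eq_zero_of_algebraicIndependent [Infinite F] (hq : (q : F) ≠ 0)
    (hqi : ∀ i ∈ Finset.Icc 1 n, (q : F) ^ i ≠ 1) (hN : IsNilpotent N) {z : ℕ}
    (C : Module.Basis (Fin z) F (centralizerSubmodule N)) {Ψ Ψ' : Matrix (Fin n) (Fin n) F}
    (hΨ : Ψ * N = (q : F) • (N * Ψ)) (h1 : Ψ * Ψ' = 1) (h2 : Ψ' * Ψ = 1)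
    {t : Fin z → K} (ht : AlgebraicIndependent F t) {Φ : Matrix (Fin n) (Fin n) K}
    (hΦ : Φ = ∑ i, t i • ((C i).1 * Ψ).map (algebraMap F K))
    {Y : Matrix (Fin n) (Fin n) K}
    (hY1 : N.map (algebraMap F K) * Y = (q : K) • (Y * N.map (algebraMap F K)))
    (hY2 : Y * Φ = (q : K) • (Φ * Y)) : Y = 0 := by
  -- Nondegeneracy at one solution Φ₀, with parameters c, spreads to the generic solution through a
  -- nonvanishing determinant.
  obtain ⟨Φ₀, hΦ₀, hreg⟩ := exists_regular_of_isNilpotent hq hqi hN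
  obtain ⟨c, hc⟩ := exists_sum_smul_of_mul_eq_smul_mul (K := F) hq C hΨ h1 h2 (Φ := Φ₀)
    (by simpa using hΦ₀)
  have hinj : LinearMap.ker (dualSystem q Φ₀ N).mulVecLin = ⊥ := by
    rw [LinearMap.ker_eq_bot']
    intro v hv
    obtain ⟨Y, rfl⟩ := vec_bijective.2 v
    rw [Matrix.mulVecLin_apply, dualSystem_mulVec_vec] at hv
    have hv1 := congrArg (fun f => f ∘ Sum.inl) hv
    have hv2 := congrArg (fun f => f ∘ Sum.inr) hv
    simp only [Sum.elim_comp_inl, Sum.elim_comp_inr] at hv1 hv2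
    rw [hreg Y (sub_eq_zero.1 (vec_eq_zero_iff.1 hv1)) (sub_eq_zero.1 (vec_eq_zero_iff.1 hv2))]
    rfl
  obtain ⟨g, hg⟩ := LinearMap.exists_leftInverse_of_injective _ hinj
  have hB : LinearMap.toMatrix' g * dualSystem q Φ₀ N = 1 := by
    have := congrArg LinearMap.toMatrix' hg
    rw [LinearMap.toMatrix'_comp, ← Matrix.toLin'_apply', LinearMap.toMatrix'_toLin', LinearMap.toMatrix'_id] at this
    exact this
  obtain ⟨B, hB⟩ : ∃ B : Matrix (Fin n × Fin n) _ F, B * dualSystem q Φ₀ N = 1 := ⟨_, hB⟩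
  let P := MvPolynomial (Fin z) F
  let ΦP : Matrix (Fin n) (Fin n) P :=
    ∑ i : Fin z, (MvPolynomial.X i : P) • ((C i).1 * Ψ).map (algebraMap F P)
  have hΦP {A : Type u} [CommRing A] [Algebra F A] (t : Fin z → A) :
      (MvPolynomial.aeval t).mapMatrix ΦP = ∑ i, t i • ((C i).1 * Ψ).map (algebraMap F A) := by
    rw [map_sum]
    refine Finset.sum_congr rfl fun i _ => ?_
    ext r s
    rw [AlgHom.mapMatrix_apply, Matrix.map_apply, Matrix.smul_apply, smul_eq_mul, map_mul,
      MvPolynomial.aeval_X, Matrix.map_apply, AlgHom.commutes]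
    rfl
  -- B is a left inverse of the dual system at Φ₀. Hence D is square, its determinant is a
  -- polynomial in the parameters with value 1 at c, and it cannot vanish at independent t.
  let D := B.map (algebraMap F P) * dualSystem q ΦP (N.map (algebraMap F P))
  have hD {A : Type u} [CommRing A] [Algebra F A] (t : Fin z → A) :
      (MvPolynomial.aeval t).mapMatrix D = B.map (algebraMap F A) *
        dualSystem q (∑ i, t i • ((C i).1 * Ψ).map (algebraMap F A)) (N.map (algebraMap F A)) := by
    rw [← hΦP]
    let φ : P →+* A := (MvPolynomial.aeval t).toRingHom
    have hφ {m₁ m₂ : Type} (X : Matrix m₁ m₂ F) :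
        (X.map (algebraMap F P)).map φ = X.map (algebraMap F A) := by
      ext r s
      exact (MvPolynomial.aeval t).commutes _
    change (B.map (algebraMap F P) * dualSystem q ΦP (N.map (algebraMap F P))).map φ = _
    rw [Matrix.map_mul, dualSystem_map, hφ, hφ]
    rfl
  have hD0 : D.det ≠ 0 := by
    intro h0
    have h2 := congrArg (MvPolynomial.aeval c) h0
    rw [map_zero, AlgHom.map_det, hD, ← hc] at h2
    simp [hB] at h2
  have hdet : (B.map (algebraMap F K) * dualSystem q Φ (N.map (algebraMap F K))).det ≠ 0 := by
    rw [hΦ, ← hD, ← AlgHom.map_det]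
    exact fun h0 => hD0 ((map_eq_zero_iff _ ht).1 h0)
  have hv : vec Y = 0 := by
    apply Matrix.eq_zero_of_mulVec_eq_zero hdet
    rw [← Matrix.mulVec_mulVec, dualSystem_mulVec_vec, hY1, hY2, sub_self, sub_self]
    simp
  exact vec_eq_zero_iff.1 hv

/-- The coefficients t of Φ in the coset Z(N)Ψ generate K over F, so trdeg K ≤ trdeg F + dim Z(N) ≤
n². If the total reaches n², the t form a transcendence basis, and Φ is generic in its coset. -/
theorem trdeg_le_sq_and_eq_zero_aux (hq : (q : F) ≠ 0) (hN : IsNilpotent N)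
    (hF : IntermediateField.adjoin k (Set.range fun x : Fin n × Fin n => N x.1 x.2) = ⊤)
    {Φ : Matrix (Fin n) (Fin n) K}
    (hK : IntermediateField.adjoin F (Set.range fun x : Fin n × Fin n => Φ x.1 x.2) = ⊤)
    (hΦ : Φ * N.map (algebraMap F K) = (q : K) • (N.map (algebraMap F K) * Φ)) :
    Algebra.trdeg k K ≤ ((n ^ 2 : ℕ) : Cardinal) ∧
      (Infinite F → (∀ i ∈ Finset.Icc 1 n, (q : F) ^ i ≠ 1) →
        ((n ^ 2 : ℕ) : Cardinal) ≤ Algebra.trdeg k K → ∀ Y : Matrix (Fin n) (Fin n) K,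
          N.map (algebraMap F K) * Y = (q : K) • (Y * N.map (algebraMap F K)) →
          Y * Φ = (q : K) • (Φ * Y) → Y = 0) := by
  obtain ⟨Ψ, Ψ', hΨ, h1, h2⟩ := exists_isUnit_of_isNilpotent hq hN
  let C := Module.finBasis F (centralizerSubmodule N)
  obtain ⟨t, ht⟩ := exists_sum_smul_of_mul_eq_smul_mul hq C hΨ h1 h2 hΦ
  have htop := adjoin_range_coeff_eq_top hK _ ht
  have halg := IntermediateField.isAlgebraic_adjoin_of_adjoin_eq_top htop
  have hz := trdeg_add_finrank_centralizer_le hN hF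
  have ht1 : Algebra.trdeg F K ≤ (Module.finrank F (centralizerSubmodule N) : Cardinal) := by
    refine (Algebra.IsAlgebraic.trdeg_le_cardinalMk F (Set.range t)).trans ?_
    simpa using Cardinal.mk_range_le_lift (f := t)
  rw [← trdeg_add_eq k F (A := K)]
  refine ⟨(add_le_add le_rfl ht1).trans hz, fun hinf hqi hle Y hY1 hY2 => ?_⟩
  have hlt : Algebra.trdeg k F < Cardinal.aleph0 :=
    (le_self_add.trans hz).trans_lt (Cardinal.natCast_lt_aleph0)
  -- The transcendence degree of F is finite, so it cancels.
  have hle' : (Module.finrank F (centralizerSubmodule N) : Cardinal) ≤ Algebra.trdeg F K :=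
    (Cardinal.add_le_add_iff_of_lt_aleph0 hlt).1 (by
      rw [add_comm, add_comm (Algebra.trdeg F K)]; exact hz.trans hle)
  have hbasis := Algebra.IsAlgebraic.isTranscendenceBasis_of_lift_le_trdeg_of_finite F t
    (by simpa using hle')
  exact eq_zero_of_algebraicIndependent hq hqi hN C hΨ h1 h2 hbasis.1 ht hY1 hY2

end

section
variable {k K : Type u} [Field k] [Field K] [Algebra k K] {n q : ℕ}
  {Φ N : Matrix (Fin n) (Fin n) K}

theorem trdeg_le_sq_and_eq_zero (hq : (q : k) ≠ 0) (hN : IsNilpotent N)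
    (hK : IntermediateField.adjoin k ((Set.range fun x : Fin n × Fin n => N x.1 x.2) ∪
      Set.range fun x : Fin n × Fin n => Φ x.1 x.2) = ⊤)
    (hΦ : Φ * N = (q : K) • (N * Φ)) :
    Algebra.trdeg k K ≤ ((n ^ 2 : ℕ) : Cardinal) ∧
      (Infinite k → (∀ i ∈ Finset.Icc 1 n, (q : k) ^ i ≠ 1) →
        ((n ^ 2 : ℕ) : Cardinal) ≤ Algebra.trdeg k K → ∀ Y : Matrix (Fin n) (Fin n) K,
          N * Y = (q : K) • (Y * N) → Y * Φ = (q : K) • (Φ * Y) → Y = 0) := by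
  obtain ⟨F, hF⟩ : ∃ F, F = IntermediateField.adjoin k
    (Set.range fun x : Fin n × Fin n => N x.1 x.2) := ⟨_, rfl⟩
  have hNF (r s) : N r s ∈ F := hF ▸ IntermediateField.subset_adjoin _ _ ⟨(r, s), rfl⟩
  let N0 : Matrix (Fin n) (Fin n) F := Matrix.of fun r s => ⟨N r s, hNF r s⟩
  have hN0 : N0.map (algebraMap F K) = N := rfl
  have hinj : Function.Injective (algebraMap F K).mapMatrix :=
    Matrix.map_injective (m := Fin n) (n := Fin n) (algebraMap F K).injective
  have hnil : IsNilpotent N0 := by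
    rw [← IsNilpotent.map_iff hinj]; exact hN
  have hF' : IntermediateField.adjoin k (Set.range fun x : Fin n × Fin n => N0 x.1 x.2) = ⊤ := by
    rw [eq_top_iff]
    rintro ⟨x, hx⟩ _
    have h1 : (IntermediateField.adjoin k (Set.range fun x : Fin n × Fin n => N0 x.1 x.2)).map F.val
        = F := by
      rw [IntermediateField.adjoin_map, ← Set.range_comp]; exact hF.symm
    have h2 : x ∈ (IntermediateField.adjoin k
      (Set.range fun x : Fin n × Fin n => N0 x.1 x.2)).map F.val := by rw [h1]; exact hx
    obtain ⟨y, hy, rfl⟩ := h2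
    exact hy
  have hK' : IntermediateField.adjoin F (Set.range fun x : Fin n × Fin n => Φ x.1 x.2) = ⊤ := by
    apply IntermediateField.restrictScalars_injective k
    rw [IntermediateField.restrictScalars_top, ← hK]
    subst hF
    exact IntermediateField.adjoin_adjoin_left _ _ _
  have hcast (i : ℕ) : (q : F) ^ i = algebraMap k F ((q : k) ^ i) := by simp
  have h := trdeg_le_sq_and_eq_zero_aux (k := k) (q := q) (N := N0) (Φ := Φ)
    (by rw [← pow_one (q : F), hcast, pow_one]; exact fun h0 => hq ((map_eq_zero _).1 h0)) hnil hF' hK' hΦ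
  refine ⟨h.1, fun hinf hqi hle => h.2 (Infinite.of_injective _ (algebraMap k F).injective) ?_ hle⟩
  intro i hi
  rw [hcast, Ne, map_eq_one_iff _ (algebraMap k F).injective]
  exact hqi i hi

end

end

/-! ### The space of pairs (Φ, N): universal property, base change, nilpotency -/

section
open Matrix

theorem Matrix.map_smul_mul_of_algHom {R A B : Type*} [CommRing R] [CommRing A] [CommRing B]
    [Algebra R A] [Algebra R B] (f : A →ₐ[R] B) {n : ℕ} (M N : Matrix (Fin n) (Fin n) A) (q : ℕ) :
    ((q : A) • (M * N)).map f = (q : B) • (M.map f * N.map f) := by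
  ext r s
  simp [Matrix.mul_apply]

namespace NTilde

section
variable {n q : ℕ} {R : Type*} [CommRing R]

theorem Phi_mul_N : Phi n q R * N n q R = (q : CoordRing n q R) • (N n q R * Phi n q R) := by
  ext i j
  have h : (polyPhi n R * polyN n R - (q : MvPolynomial (Var n) R) • (polyN n R * polyPhi n R)) i j
      ∈ relations n q R := Ideal.subset_span (Or.inr ⟨(i, j), rfl⟩)
  have h2 : mk n q R ((polyPhi n R * polyN n R -
      (q : MvPolynomial (Var n) R) • (polyN n R * polyPhi n R)) i j) = 0 :=
    Ideal.Quotient.eq_zero_iff_mem.2 h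
  rw [Matrix.sub_apply, map_sub, sub_eq_zero] at h2
  have h3 := Matrix.map_smul_mul_of_algHom (mk n q R) (polyN n R) (polyPhi n R) q
  have h4 := Matrix.map_mul (f := (mk n q R : _ →+* CoordRing n q R)) (L := polyPhi n R)
    (M := polyN n R)
  calc _ = ((polyPhi n R * polyN n R).map (mk n q R)) i j := by
          exact (congrFun (congrFun h4 i) j).symm
    _ = _ := h2
    _ = _ := congrFun (congrFun h3 i) j

theorem mk_polyDetInv_mul : mk n q R (polyDetInv n R) * (Phi n q R).det = 1 := by
  have h : polyDetInv n R * (polyPhi n R).det - 1 ∈ relations n q R :=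
    Ideal.subset_span (Or.inl rfl)
  have h2 : mk n q R (polyDetInv n R * (polyPhi n R).det - 1) = 0 :=
    Ideal.Quotient.eq_zero_iff_mem.2 h
  rw [map_sub, map_mul, map_one, sub_eq_zero, AlgHom.map_det] at h2
  exact h2

theorem isUnit_det_Phi : IsUnit (Phi n q R).det :=
  IsUnit.of_mul_eq_one _ ((mul_comm _ _).trans mk_polyDetInv_mul)

theorem mk_surjective : Function.Surjective (mk n q R) := Ideal.Quotient.mk_surjective

theorem algHom_ext {S : Type*} [CommRing S] [Algebra R S] {f g : CoordRing n q R →ₐ[R] S}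
    (h1 : (Phi n q R).map f = (Phi n q R).map g) (h2 : (N n q R).map f = (N n q R).map g) :
    f = g := by
  have h : f.comp (mk n q R) = g.comp (mk n q R) := by
    apply MvPolynomial.algHom_ext
    rintro (⟨i, j⟩ | ⟨i, j⟩ | ⟨⟩)
    · exact congrFun (congrFun h1 i) j
    · exact congrFun (congrFun h2 i) j
    · have h3 : f (mk n q R (polyDetInv n R)) * ((Phi n q R).map f).det = 1 := by
        rw [← AlgHom.mapMatrix_apply, ← AlgHom.map_det, ← map_mul, mk_polyDetInv_mul, map_one]
      have h4 : g (mk n q R (polyDetInv n R)) * ((Phi n q R).map f).det = 1 := by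
        rw [h1, ← AlgHom.mapMatrix_apply, ← AlgHom.map_det, ← map_mul, mk_polyDetInv_mul, map_one]
      exact (IsUnit.of_mul_eq_one _ ((mul_comm _ _).trans h3)).mul_right_cancel (h3.trans h4.symm)
  ext x
  obtain ⟨y, rfl⟩ := mk_surjective x
  exact DFunLike.congr_fun h y

variable {S : Type*} [CommRing S] [Algebra R S]

/-- The homomorphism from the coordinate ring given by a pair `(Φ, N)`. -/
def lift (Φ N : Matrix (Fin n) (Fin n) S) (hΦ : IsUnit Φ.det) (h : Φ * N = (q : S) • (N * Φ)) :
    CoordRing n q R →ₐ[R] S :=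
  Ideal.Quotient.liftₐ (relations n q R)
    (MvPolynomial.aeval (Sum.elim (fun x : Fin n × Fin n => Φ x.1 x.2)
      (Sum.elim (fun x : Fin n × Fin n => N x.1 x.2) fun _ => Ring.inverse Φ.det))) <| by
    obtain ⟨φ, hφ⟩ : ∃ φ : MvPolynomial (Var n) R →ₐ[R] S, φ = MvPolynomial.aeval
      (Sum.elim (fun x : Fin n × Fin n => Φ x.1 x.2)
      (Sum.elim (fun x : Fin n × Fin n => N x.1 x.2) fun _ => Ring.inverse Φ.det)) := ⟨_, rfl⟩
    rw [← hφ]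
    have h1 : (polyPhi n R).map φ = Φ := by ext i j; simp [polyPhi, hφ]
    have h2 : (polyN n R).map φ = N := by ext i j; simp [polyN, hφ]
    have h3 : φ (polyDetInv n R) = Ring.inverse Φ.det := by simp [polyDetInv, hφ]
    suffices relations n q R ≤ RingHom.ker φ from fun _ ha => this ha
    refine Ideal.span_le.2 ?_
    rintro _ (rfl | ⟨⟨i, j⟩, rfl⟩)
    · change φ _ = 0
      rw [map_sub, map_mul, AlgHom.map_det, AlgHom.mapMatrix_apply, h1, h3, map_one,
        Ring.inverse_mul_cancel _ hΦ, sub_self]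
    · change φ ((polyPhi n R * polyN n R - (q : MvPolynomial (Var n) R) •
        (polyN n R * polyPhi n R)) i j) = 0
      rw [Matrix.sub_apply, map_sub, sub_eq_zero]
      have h4 := Matrix.map_smul_mul_of_algHom φ (polyN n R) (polyPhi n R) q
      have h5 := Matrix.map_mul (f := (φ : _ →+* S)) (L := polyPhi n R) (M := polyN n R)
      calc _ = (Φ * N) i j := by rw [← h1, ← h2]; exact congrFun (congrFun h5 i) j
        _ = _ := by rw [h, ← h1, ← h2]; exact (congrFun (congrFun h4 i) j).symm

variable (Φ N' : Matrix (Fin n) (Fin n) S) (hΦ : IsUnit Φ.det) (h : Φ * N' = (q : S) • (N' * Φ))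

theorem Phi_map_lift : (Phi n q R).map (lift (R := R) Φ N' hΦ h) = Φ := by
  ext i j
  change MvPolynomial.aeval _ (polyPhi n R i j) = _
  simp [polyPhi]

theorem N_map_lift : (N n q R).map (lift (R := R) Φ N' hΦ h) = N' := by
  ext i j
  change MvPolynomial.aeval _ (polyN n R i j) = _
  simp [polyN]

end

variable (n q : ℕ) (R S : Type*) [CommRing R] [CommRing S] [Algebra R S]

/-- The formation of the coordinate ring commutes with base change. -/
def baseChangeEquiv : S ⊗[R] CoordRing n q R ≃ₐ[S] CoordRing n q S := by
  letI : Algebra R (CoordRing n q S) := ((algebraMap S _).comp (algebraMap R S)).toAlgebra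
  haveI : IsScalarTower R S (CoordRing n q S) := IsScalarTower.of_algebraMap_eq fun _ => rfl
  let f₀ : CoordRing n q R →ₐ[R] CoordRing n q S :=
    lift (Phi n q S) (N n q S) isUnit_det_Phi Phi_mul_N
  let f : S ⊗[R] CoordRing n q R →ₐ[S] CoordRing n q S :=
    Algebra.TensorProduct.lift (Algebra.ofId S _) f₀ fun _ _ => Commute.all _ _
  let ι : CoordRing n q R →ₐ[R] S ⊗[R] CoordRing n q R := Algebra.TensorProduct.includeRight
  have h1 : IsUnit ((Phi n q R).map ι).det := by
    rw [← AlgHom.mapMatrix_apply, ← AlgHom.map_det]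
    exact isUnit_det_Phi.map ι
  have h2 : (Phi n q R).map ι * (N n q R).map ι =
      (q : S ⊗[R] CoordRing n q R) • ((N n q R).map ι * (Phi n q R).map ι) := by
    rw [← Matrix.map_smul_mul_of_algHom, ← Phi_mul_N]
    exact (Matrix.map_mul (f := (ι : CoordRing n q R →+* S ⊗[R] CoordRing n q R))).symm
  let g : CoordRing n q S →ₐ[S] S ⊗[R] CoordRing n q R := lift _ _ h1 h2
  have hf (x) : f (ι x) = f₀ x := by simp [f, ι]
  have hf1 (i j) : f₀ (Phi n q R i j) = Phi n q S i j :=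
    congrFun (congrFun (Phi_map_lift (R := R) (Phi n q S) (N n q S) isUnit_det_Phi Phi_mul_N) i) j
  have hf2 (i j) : f₀ (N n q R i j) = N n q S i j :=
    congrFun (congrFun (N_map_lift (R := R) (Phi n q S) (N n q S) isUnit_det_Phi Phi_mul_N) i) j
  have hg1 (i j) : g (Phi n q S i j) = ι (Phi n q R i j) :=
    congrFun (congrFun (Phi_map_lift (R := S) _ _ h1 h2) i) j
  have hg2 (i j) : g (N n q S i j) = ι (N n q R i j) :=
    congrFun (congrFun (N_map_lift (R := S) _ _ h1 h2) i) j
  refine AlgEquiv.ofAlgHom f g ?_ ?_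
  · refine algHom_ext ?_ ?_
    · ext i j
      exact (congrArg f (hg1 i j)).trans ((hf _).trans (hf1 i j))
    · ext i j
      exact (congrArg f (hg2 i j)).trans ((hf _).trans (hf2 i j))
  · refine Algebra.TensorProduct.ext (by ext) ?_
    refine algHom_ext ?_ ?_
    · ext i j
      exact (congrArg g ((hf _).trans (hf1 i j))).trans (hg1 i j)
    · ext i j
      exact (congrArg g ((hf _).trans (hf2 i j))).trans (hg2 i j)

end NTilde

/-- Substitute qt for t in det(t - qN). The factor q^j stays on the left, so q need not be
invertible. -/
theorem Matrix.charpoly_smul_coeff {A : Type*} [CommRing A] {n : ℕ} (N : Matrix (Fin n) (Fin n) A)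
    (q : A) (j : ℕ) :
    (q • N).charpoly.coeff j * q ^ j = q ^ n * N.charpoly.coeff j := by
  have h : (q • N).charpoly.comp (Polynomial.C q * Polynomial.X) = Polynomial.C (q ^ n) * N.charpoly := by
    rw [Matrix.charpoly, ← Polynomial.coe_compRingHom_apply, RingHom.map_det, Matrix.charpoly]
    have : (Polynomial.compRingHom (Polynomial.C q * Polynomial.X)).mapMatrix (q • N).charmatrix =
        Polynomial.C q • N.charmatrix := by
      ext1 r s
      rcases eq_or_ne r s with rfl | hrs
      · simp [Matrix.charmatrix_apply_eq, mul_sub]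
      · simp [Matrix.charmatrix_apply_ne _ _ _ hrs]
    rw [this, Matrix.det_smul, map_pow, Fintype.card_fin]
  have := congrArg (fun p => Polynomial.coeff p j) h
  rwa [Polynomial.comp_C_mul_X_coeff, Polynomial.coeff_C_mul] at this

/-- N and qN are conjugate, so the coefficient of t^j is killed by q^j (q^(n-j) - 1), a unit for j <
n. This holds over any ring, so nilpotency of N does not depend on reducedness. -/
theorem Matrix.charpoly_eq_X_pow_of_mul_eq_smul_mul {A : Type*} [CommRing A] {n q : ℕ}
    {Φ N : Matrix (Fin n) (Fin n) A} (hΦ : IsUnit Φ.det) (h : Φ * N = (q : A) • (N * Φ))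
    (hq : IsUnit (q : A)) (hqi : ∀ i ∈ Finset.Icc 1 n, IsUnit ((q : A) ^ i - 1)) :
    N.charpoly = Polynomial.X ^ n := by
  nontriviality A
  have hc : ((q : A) • N).charpoly = N.charpoly := by
    obtain ⟨u, hu⟩ := (Matrix.isUnit_iff_isUnit_det Φ).2 hΦ
    have h1 : (q : A) • N = u * N * u⁻¹ := by
      rw [hu, h, ← hu, Matrix.smul_mul, Matrix.mul_assoc, ← Units.val_mul, mul_inv_cancel]; simp
    rw [h1, Matrix.coe_units_inv, Matrix.charpoly_units_conj]
  have hdeg : N.charpoly.natDegree = n := by simp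
  ext j
  rw [Polynomial.coeff_X_pow]
  split_ifs with hj
  · have := N.charpoly_monic
    rw [Polynomial.Monic, Polynomial.leadingCoeff, hdeg] at this
    rwa [hj]
  · rcases lt_or_gt_of_ne hj with hlt | hlt
    · have h2 := Matrix.charpoly_smul_coeff N (q : A) j
      rw [hc] at h2
      have hj' : (q : A) ^ n = q ^ j * q ^ (n - j) := by rw [← pow_add]; congr 1; omega
      have h3 : ((q : A) ^ j * (q ^ (n - j) - 1)) * N.charpoly.coeff j = 0 := by
        rw [hj'] at h2; linear_combination -h2
      exact (((hq.pow j).mul (hqi _ (Finset.mem_Icc.2 ⟨by omega, by omega⟩))).mul_right_eq_zero).1 h3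
    · exact Polynomial.coeff_eq_zero_of_natDegree_lt (hdeg.trans_lt hlt)

theorem Matrix.pow_eq_zero_of_charpoly_eq_X_pow {A : Type*} [CommRing A] {n : ℕ}
    {N : Matrix (Fin n) (Fin n) A} (h : N.charpoly = Polynomial.X ^ n) : N ^ n = 0 := by
  have := N.aeval_self_charpoly
  rwa [h, map_pow, Polynomial.aeval_X] at this

end

/-! ### Transport of the complete intersection results to abstract presentations -/

section

theorem mem_of_mem_minimalPrimes_ringEquiv {A B : Type*} [CommRing A] [CommRing B] (e : A ≃+* B)
    {m : Ideal A} (hm : m ∈ minimalPrimes A) : m.comap (e.symm : B →+* A) ∈ minimalPrimes B := by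
  have hmp : m.IsPrime := hm.1.1
  refine ⟨⟨Ideal.IsPrime.comap _, bot_le⟩, fun p ⟨hp, _⟩ hle => ?_⟩
  have h1 : p.comap (e : A →+* B) ≤ m := fun x hx => by
    have := hle hx
    simpa using this
  have h2 := hm.2 ⟨Ideal.IsPrime.comap (e : A →+* B), bot_le⟩ h1
  intro x hx
  have : e (e.symm x) ∈ p := h2 hx
  rwa [e.apply_symm_apply] at this

/-- A complete intersection over a field is equidimensional. -/
theorem le_ringKrullDim_quotient_of_mem_minimalPrimes {k A : Type u} [Field k] [CommRing A]
    {c d : ℕ} (f : Fin c → MvPolynomial (Fin (c + d)) k)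
    (e : A ≃+* MvPolynomial (Fin (c + d)) k ⧸ Ideal.span (Set.range f))
    (hdim : ringKrullDim A ≤ d) {m : Ideal A} (hm : m ∈ minimalPrimes A) :
    d ≤ ringKrullDim (A ⧸ m) := by
  have hmp : m.IsPrime := hm.1.1
  let π := Ideal.Quotient.mk (Ideal.span (Set.range f))
  let m' := m.comap (e.symm : MvPolynomial (Fin (c + d)) k ⧸ Ideal.span (Set.range f) →+* A)
  have hm' : m' ∈ minimalPrimes _ := mem_of_mem_minimalPrimes_ringEquiv e hm
  have hm'p : m'.IsPrime := hm'.1.1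
  let p := m'.comap π
  have hpp : p.IsPrime := Ideal.IsPrime.comap _
  have hsurj : Function.Surjective ((Ideal.Quotient.mk m).comp ((e.symm : MvPolynomial (Fin (c + d)) k ⧸ Ideal.span (Set.range f) →+* A).comp π)) :=
    (Ideal.Quotient.mk_surjective).comp (e.symm.surjective.comp Ideal.Quotient.mk_surjective)
  have hker : RingHom.ker ((Ideal.Quotient.mk m).comp ((e.symm : MvPolynomial (Fin (c + d)) k ⧸ Ideal.span (Set.range f) →+* A).comp π)) = p := by
    ext x
    simp [RingHom.mem_ker, Ideal.Quotient.eq_zero_iff_mem, p, m']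
  have hiso := RingHom.quotientKerEquivOfSurjective hsurj
  rw [← ringKrullDim_eq_of_ringEquiv hiso, hker]
  have hlist := Ideal.ofList_ofFn f
  refine le_ringKrullDim_quotient_of_mem_associatedPrimes (List.ofFn f) (by simp) ?_ ?_
  · rw [hlist, ← ringKrullDim_eq_of_ringEquiv e]; exact hdim
  · apply Module.associatedPrimes.minimalPrimes_annihilator_subset_associatedPrimes
    rw [Ideal.annihilator_quotient, hlist]
    refine ⟨⟨hpp, fun x hx => ?_⟩, fun p' ⟨hp', hIp'⟩ hle => ?_⟩
    · have : π x = 0 := Ideal.Quotient.eq_zero_iff_mem.2 hx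
      change π x ∈ m'
      rw [this]; exact m'.zero_mem
    · have h1 : RingHom.ker π ≤ p' := by rwa [Ideal.mk_ker]
      have h2 : (p'.map π).IsPrime := Ideal.map_isPrime_of_surjective Ideal.Quotient.mk_surjective h1
      have h3 : p'.map π ≤ m' := Ideal.map_le_iff_le_comap.2 hle
      have h4 := hm'.2 ⟨h2, bot_le⟩ h3
      intro x hx
      have h5 : π x ∈ p'.map π := h4 hx
      have := (Ideal.comap_map_of_surjective π Ideal.Quotient.mk_surjective p').le h5
      rw [← RingHom.ker_eq_comap_bot, sup_eq_left.2 h1] at this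
      exact this

theorem isSMulRegular_of_ringKrullDim_quotient_le {S : Type u} {A : Type v} [CommRing S]
    [IsNoetherianRing S] [CommRing A] [Algebra S A]
    (r : S) (hr : IsSMulRegular S r) (hmax : (Ideal.span {r}).IsMaximal) {c d : ℕ}
    (f : Fin c → MvPolynomial (Fin (c + d)) S)
    (e : A ≃ₐ[S] MvPolynomial (Fin (c + d)) S ⧸ Ideal.span (Set.range f))
    (hdim : ringKrullDim (A ⧸ Ideal.span {algebraMap S A r}) ≤ d) : IsSMulRegular A r := by
  have hlist := Ideal.ofList_ofFn f
  have h1 : Ideal.span (Set.range f) ≤ Ideal.ofList (MvPolynomial.C r :: List.ofFn f) := by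
    rw [Ideal.ofList_cons, hlist]; exact le_sup_right
  have h2 : MvPolynomial.C r ∈ Ideal.ofList (MvPolynomial.C r :: List.ofFn f) := by
    rw [Ideal.ofList_cons]; exact Ideal.mem_sup_left (Ideal.mem_span_singleton_self _)
  let φ : A →+* MvPolynomial (Fin (c + d)) S ⧸ Ideal.ofList (MvPolynomial.C r :: List.ofFn f) :=
    (Ideal.Quotient.factor h1).comp e.toRingEquiv.toRingHom
  have hφ : Function.Surjective φ :=
    (Ideal.Quotient.factor_surjective h1).comp e.surjective
  have hφr : φ (algebraMap S A r) = 0 := by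
    change Ideal.Quotient.factor h1 (e (algebraMap S A r)) = 0
    rw [e.commutes]
    exact Ideal.Quotient.eq_zero_iff_mem.2 h2
  have hle := (ringKrullDim_le_of_surjective (Ideal.Quotient.lift (Ideal.span {algebraMap S A r}) φ
    (fun a ha => by
      obtain ⟨b, rfl⟩ := Ideal.mem_span_singleton'.1 ha
      rw [map_mul, hφr, mul_zero])) (Ideal.Quotient.lift_surjective_of_surjective _ _ hφ)).trans hdim
  have := isSMulRegular_quotient_of_ringKrullDim_le r hr hmax (List.ofFn f) (by simp) hle
  rw [hlist] at this
  intro x y hxy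
  apply e.injective
  apply this
  have h3 := congrArg e hxy
  simp only [map_smul] at h3
  change MvPolynomial.C r • e x = MvPolynomial.C r • e y
  rw [← MvPolynomial.algebraMap_eq, algebraMap_smul, algebraMap_smul]
  exact h3

section
variable {ι σ : Type} {R : Type u} [CommRing R] (g : ι → MvPolynomial σ R) {d : ℕ}

theorem span_range_rename {c : ℕ} (e₁ : ι ≃ Fin c) {τ : Type} (e₂ : σ ≃ τ) :
    Ideal.span (Set.range fun i => MvPolynomial.rename e₂ (g (e₁.symm i))) =
      (Ideal.span (Set.range g)).map (MvPolynomial.renameEquiv R e₂ : _ →+* MvPolynomial τ R) := by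
  rw [Ideal.map_span, ← Set.range_comp]
  congr 1
  exact e₁.symm.surjective.range_comp (fun i => MvPolynomial.rename e₂ (g i))

variable [Fintype ι] [Fintype σ]

theorem exists_presentation (hcard : Fintype.card σ = Fintype.card ι + d) :
    ∃ (c : ℕ) (f : Fin c → MvPolynomial (Fin (c + d)) R),
      Nonempty ((MvPolynomial σ R ⧸ Ideal.span (Set.range g)) ≃ₐ[R]
        (MvPolynomial (Fin (c + d)) R ⧸ Ideal.span (Set.range f))) := by
  refine ⟨Fintype.card ι, fun i => MvPolynomial.rename (Fintype.equivFinOfCardEq hcard)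
    (g ((Fintype.equivFin ι).symm i)), ⟨?_⟩⟩
  exact Ideal.quotientEquivAlg _ _ (MvPolynomial.renameEquiv R (Fintype.equivFinOfCardEq hcard))
    (span_range_rename g _ _)

theorem isReduced_of_jacobian' {k : Type u} [Field k] (g : ι → MvPolynomial σ k)
    (hcard : Fintype.card σ = Fintype.card ι + d)
    (hdim : ringKrullDim (MvPolynomial σ k ⧸ Ideal.span (Set.range g)) ≤ d)
    (hjac : ∀ p : Ideal (MvPolynomial σ k), p.IsPrime → (∀ i, g i ∈ p) →
      d ≤ ringKrullDim (MvPolynomial σ k ⧸ p) →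
      ∀ a : ι → MvPolynomial σ k,
        (∀ v, ∑ i, a i * MvPolynomial.pderiv v (g i) ∈ p) → ∀ i, a i ∈ p) :
    IsReduced (MvPolynomial σ k ⧸ Ideal.span (Set.range g)) := by
  let e₁ := Fintype.equivFin ι
  let e₂ := Fintype.equivFinOfCardEq hcard
  let e := MvPolynomial.renameEquiv k e₂
  let E := Ideal.quotientEquivAlg _ _ e (span_range_rename g e₁ e₂)
  have := isReduced_of_jacobian (fun i => MvPolynomial.rename e₂ (g (e₁.symm i))) rfl
    (by rw [← ringKrullDim_eq_of_ringEquiv E.toRingEquiv]; exact hdim) ?_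
  · exact isReduced_of_injective E.toRingEquiv E.injective
  intro p hp hfp hd a ha i
  let p' := p.comap (e : MvPolynomial σ k →+* MvPolynomial (Fin (Fintype.card ι + d)) k)
  have hp' : p'.IsPrime := Ideal.IsPrime.comap _
  have hpe : p = p'.map (e : MvPolynomial σ k →+* MvPolynomial (Fin (Fintype.card ι + d)) k) :=
    (Ideal.map_comap_of_surjective _ e.surjective p).symm
  have hdim' : ringKrullDim (MvPolynomial σ k ⧸ p') = ringKrullDim (_ ⧸ p) :=
    ringKrullDim_eq_of_ringEquiv (Ideal.quotientEquivAlg p' p e hpe).toRingEquiv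
  have key := hjac p' hp' (fun i => by have := hfp (e₁ i); simpa [p', e] using this)
    (hdim' ▸ hd) (fun i => e.symm (a (e₁ i))) (fun v => ?_) (e₁.symm i)
  · have h1 : e (e.symm (a (e₁ (e₁.symm i)))) ∈ p := key
    simpa using h1
  · change e _ ∈ p
    have h2 := ha (e₂ v)
    rw [map_sum]
    rw [← e₁.sum_comp] at h2
    convert h2 using 2 with i
    rw [map_mul, AlgEquiv.apply_symm_apply, MvPolynomial.pderiv_rename e₂.injective,
      Equiv.symm_apply_apply]
    rfl

end

end

/-! ### Dimension of the fibres of the space of pairs (Φ, N) -/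

section
open Matrix

/-- A chain of primes beginning at P lives in the zero locus of P, so it is a chain in Spec (A/P).
-/
theorem ringKrullDim_le_of_forall_quotient {A : Type*} [CommRing A] {d : WithBot ℕ∞}
    (h : ∀ P : Ideal A, P.IsPrime → ringKrullDim (A ⧸ P) ≤ d) : ringKrullDim A ≤ d := by
  refine iSup_le fun s => ?_
  have h1 := h s.head.asIdeal s.head.2
  rw [ringKrullDim_quotient] at h1
  refine le_trans ?_ h1
  let t : LTSeries (PrimeSpectrum.zeroLocus (s.head.asIdeal : Set A)) :=
    { length := s.length
      toFun := fun i => ⟨s i, fun x hx => by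
        have : s.head ≤ s i := LTSeries.head_le s i
        exact this hx⟩
      step := fun i => s.step i }
  exact le_iSup (fun p : LTSeries _ => (p.length : WithBot ℕ∞)) t

namespace NTilde

/-- The defining equations as a family. -/
def equation (n q : ℕ) (R : Type*) [CommRing R] :
    Option (Fin n × Fin n) → MvPolynomial (Var n) R
  | none => polyDetInv n R * (polyPhi n R).det - 1
  | some ij => (polyPhi n R * polyN n R - (q : MvPolynomial (Var n) R) •
      (polyN n R * polyPhi n R)) ij.1 ij.2

section
variable {n q : ℕ} {R : Type*} [CommRing R]

theorem relations_eq_span_range : relations n q R = Ideal.span (Set.range (equation n q R)) := by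
  rw [relations]
  congr 1
  ext x
  constructor
  · rintro (rfl | ⟨ij, rfl⟩)
    · exact ⟨none, rfl⟩
    · exact ⟨some ij, rfl⟩
  · rintro ⟨_ | ij, rfl⟩
    · exact Or.inl rfl
    · exact Or.inr ⟨ij, rfl⟩

/-- There are 2n² + 1 variables and n² + 1 equations, so the expected dimension is n². -/
theorem card_var : Fintype.card (Var n) = Fintype.card (Option (Fin n × Fin n)) + n ^ 2 := by
  simp; ring

/-- The coordinate ring as a quotient by the family of equations. -/
def equivQuotient (n q : ℕ) (R : Type*) [CommRing R] :
    CoordRing n q R ≃ₐ[R] MvPolynomial (Var n) R ⧸ Ideal.span (Set.range (equation n q R)) :=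
  Ideal.quotientEquivAlgOfEq R relations_eq_span_range

theorem exists_algEquiv_quotient (n q : ℕ) (R : Type u) [CommRing R] :
    ∃ (c : ℕ) (f : Fin c → MvPolynomial (Fin (c + n ^ 2)) R),
      Nonempty (CoordRing n q R ≃ₐ[R]
        (MvPolynomial (Fin (c + n ^ 2)) R ⧸ Ideal.span (Set.range f))) := by
  obtain ⟨c, f, ⟨e⟩⟩ := exists_presentation (equation n q R) card_var
  exact ⟨c, f, ⟨(equivQuotient n q R).trans e⟩⟩

instance [Nontrivial R] : Nontrivial (CoordRing n q R) :=
  (lift (n := n) (q := q) (R := R) (1 : Matrix (Fin n) (Fin n) R) 0 (by simp)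
    (by simp)).toRingHom.domain_nontrivial

end

section
variable {n q : ℕ} {k : Type u} [Field k]

theorem adjoin_eq_top {B K : Type u} [CommRing B] [IsDomain B] [Algebra k B] [Field K] [Algebra B K]
    [IsFractionRing B K] [Algebra k K] [IsScalarTower k B K] {φ : CoordRing n q k →ₐ[k] B}
    (hφ : Function.Surjective φ) {ψ : CoordRing n q k →ₐ[k] K}
    (hψ : ψ = (IsScalarTower.toAlgHom k B K).comp φ) :
    IntermediateField.adjoin k
      ((Set.range fun x : Fin n × Fin n => (N n q k).map ψ x.1 x.2) ∪
        Set.range fun x : Fin n × Fin n => (Phi n q k).map ψ x.1 x.2) = ⊤ := by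
  obtain ⟨M, hM⟩ : ∃ M, M = IntermediateField.adjoin k
      ((Set.range fun x : Fin n × Fin n => (N n q k).map ψ x.1 x.2) ∪
        Set.range fun x : Fin n × Fin n => (Phi n q k).map ψ x.1 x.2) := ⟨_, rfl⟩
  rw [← hM, eq_top_iff]
  have h1 (i j) : ψ (Phi n q k i j) ∈ M :=
    hM ▸ IntermediateField.subset_adjoin _ _ (Or.inr ⟨(i, j), rfl⟩)
  have h2 (i j) : ψ (N n q k i j) ∈ M :=
    hM ▸ IntermediateField.subset_adjoin _ _ (Or.inl ⟨(i, j), rfl⟩)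
  -- The inverse determinant adds no generator of the field: it is the inverse of a polynomial in
  -- the entries of Φ.
  have h3 : ψ (mk n q k (polyDetInv n k)) ∈ M := by
    have h4 : ψ (mk n q k (polyDetInv n k)) * ψ (Phi n q k).det = 1 := by
      rw [← map_mul, mk_polyDetInv_mul, map_one]
    rw [eq_inv_of_mul_eq_one_left h4, Matrix.det_apply, map_sum]
    refine inv_mem (sum_mem fun σ _ => ?_)
    rw [Units.smul_def, map_zsmul, map_prod]
    exact zsmul_mem (prod_mem fun i _ => h1 _ _) _
  have h5 (a) : ψ a ∈ M := by
    obtain ⟨a, rfl⟩ := mk_surjective a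
    induction a using MvPolynomial.induction_on with
    | C a =>
      have : ψ (mk n q k (MvPolynomial.C a)) = algebraMap k K a :=
        (ψ.comp (mk n q k)).commutes a
      rw [this]; exact M.algebraMap_mem a
    | add a b ha hb => rw [map_add, map_add]; exact add_mem ha hb
    | mul_X a v ha =>
      rw [map_mul, map_mul]
      refine mul_mem ha ?_
      rcases v with ⟨i, j⟩ | ⟨i, j⟩ | ⟨⟩
      · exact h1 i j
      · exact h2 i j
      · exact h3
  have h6 (b : B) : algebraMap B K b ∈ M := by
    obtain ⟨a, rfl⟩ := hφ b
    have := h5 a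
    rwa [hψ] at this
  intro x _
  obtain ⟨a, b, _, rfl⟩ := IsFractionRing.div_surjective (A := B) x
  exact div_mem (h6 a) (h6 b)

variable (hq : (q : k) ≠ 0) (hqi : ∀ i ∈ Finset.Icc 1 n, (q : k) ^ i ≠ 1)
include hq hqi

theorem isNilpotent_map_N {K : Type*} [Field K] [Algebra k K] (ψ : CoordRing n q k →ₐ[k] K) :
    IsNilpotent ((N n q k).map ψ) := by
  refine ⟨n, Matrix.pow_eq_zero_of_charpoly_eq_X_pow
    (Matrix.charpoly_eq_X_pow_of_mul_eq_smul_mul (q := q) (Φ := (Phi n q k).map ψ) ?_ ?_ ?_ ?_)⟩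
  · rw [← AlgHom.mapMatrix_apply, ← AlgHom.map_det]; exact isUnit_det_Phi.map ψ
  · rw [← Matrix.map_smul_mul_of_algHom, ← Phi_mul_N]
    exact (Matrix.map_mul (f := (ψ : CoordRing n q k →+* K))).symm
  · rw [isUnit_iff_ne_zero, ← map_natCast (algebraMap k K)]
    exact fun h => hq ((map_eq_zero _).1 h)
  · intro i hi
    rw [isUnit_iff_ne_zero, ← map_natCast (algebraMap k K), ← map_pow, sub_ne_zero, Ne,
      map_eq_one_iff _ (algebraMap k K).injective]
    exact hqi i hi

/-- The fraction field of an integral closed subscheme is generated by the entries of N and Φ, so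
the field-theoretic bound applies to it. The dimension is at most the transcendence degree, so
dimension n² puts Φ in generic position. -/
theorem trdeg_le_and_eq_zero {B : Type u} [CommRing B] [IsDomain B] [Algebra k B]
    {φ : CoordRing n q k →ₐ[k] B} (hφ : Function.Surjective φ) :
    ringKrullDim B ≤ ((n ^ 2 : ℕ) : WithBot ℕ∞) ∧
      (Infinite k → ((n ^ 2 : ℕ) : WithBot ℕ∞) ≤ ringKrullDim B → ∀ Y : Matrix (Fin n) (Fin n) B,
        (N n q k).map φ * Y = (q : B) • (Y * (N n q k).map φ) →
        Y * (Phi n q k).map φ = (q : B) • ((Phi n q k).map φ * Y) → Y = 0) := by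
  let K := FractionRing B
  have hinj : Function.Injective (IsScalarTower.toAlgHom k B K) := IsFractionRing.injective B K
  let ψ := (IsScalarTower.toAlgHom k B K).comp φ
  have hfin : Algebra.FiniteType k B := by
    have h1 : Algebra.FiniteType k (MvPolynomial (Var n) k) := inferInstance
    exact Algebra.FiniteType.of_surjective (φ.comp (mk n q k)) (hφ.comp mk_surjective)
  have hrel : (Phi n q k).map ψ * (N n q k).map ψ = (q : K) • ((N n q k).map ψ * (Phi n q k).map ψ) := by
    rw [← Matrix.map_smul_mul_of_algHom, ← Phi_mul_N]
    exact (Matrix.map_mul (f := (ψ : CoordRing n q k →+* K))).symm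
  obtain ⟨h1, h2⟩ := trdeg_le_sq_and_eq_zero hq (isNilpotent_map_N hq hqi ψ)
    (adjoin_eq_top hφ (K := K) rfl) hrel
  have hBK : Algebra.trdeg k B ≤ Algebra.trdeg k K := trdeg_le_of_injective _ hinj
  refine ⟨ringKrullDim_le_of_trdeg_le (hBK.trans h1), fun hinf hd Y hY1 hY2 => ?_⟩
  have hle : ((n ^ 2 : ℕ) : Cardinal) ≤ Algebra.trdeg k K := by
    by_contra! hlt
    obtain ⟨m, hm⟩ := Cardinal.lt_aleph0.1 (hlt.trans Cardinal.natCast_lt_aleph0)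
    rw [hm] at hlt hBK
    have h3 := hd.trans (ringKrullDim_le_of_trdeg_le hBK)
    have h4 : n ^ 2 ≤ m := by exact_mod_cast h3
    exact absurd (by exact_mod_cast hlt) (not_lt.2 h4)
  have h3 := h2 hinf hqi hle (Y.map (algebraMap B K))
    (by
      have := congrArg (fun Z => Z.map (IsScalarTower.toAlgHom k B K)) hY1
      simp only [Matrix.map_smul_mul_of_algHom] at this
      rw [← AlgHom.mapMatrix_apply, map_mul] at this
      exact this)
    (by
      have := congrArg (fun Z => Z.map (IsScalarTower.toAlgHom k B K)) hY2
      simp only [Matrix.map_smul_mul_of_algHom] at this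
      rw [← AlgHom.mapMatrix_apply, map_mul] at this
      exact this)
  apply Matrix.map_injective (IsFractionRing.injective B K)
  exact h3.trans (by simp)

theorem ringKrullDim_le : ringKrullDim (CoordRing n q k) ≤ ((n ^ 2 : ℕ) : WithBot ℕ∞) :=
  ringKrullDim_le_of_forall_quotient fun P _ =>
    (trdeg_le_and_eq_zero hq hqi (φ := Ideal.Quotient.mkₐ k P) Ideal.Quotient.mk_surjective).1

/-- The upper bound is the dimension count, the lower bound the unmixedness of complete
intersections. -/
theorem ringKrullDim_quotient_eq {m : Ideal (CoordRing n q k)}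
    (hm : m ∈ minimalPrimes (CoordRing n q k)) :
    ringKrullDim (CoordRing n q k ⧸ m) = ((n ^ 2 : ℕ) : WithBot ℕ∞) := by
  have hdim := ringKrullDim_le hq hqi
  refine le_antisymm ((ringKrullDim_quotient_le m).trans hdim) ?_
  obtain ⟨c, f, ⟨e⟩⟩ := exists_algEquiv_quotient n q k
  exact le_ringKrullDim_quotient_of_mem_minimalPrimes f e.toRingEquiv hdim hm

theorem ringKrullDim_eq : ringKrullDim (CoordRing n q k) = ((n ^ 2 : ℕ) : WithBot ℕ∞) := by
  refine le_antisymm (ringKrullDim_le hq hqi) ?_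
  obtain ⟨m, hm⟩ := Ideal.nonempty_minimalPrimes (I := (⊥ : Ideal (CoordRing n q k))) bot_ne_top
  rw [← ringKrullDim_quotient_eq hq hqi hm]
  exact ringKrullDim_quotient_le m

end

end NTilde

end

/-! ### Reducedness of the fibres -/

section
open Matrix

theorem Matrix.map_mul_of_algHom {R A B : Type*} [CommRing R] [CommRing A] [CommRing B]
    [Algebra R A] [Algebra R B] (f : A →ₐ[R] B) {n : ℕ} (M N : Matrix (Fin n) (Fin n) A) :
    (M * N).map f = M.map f * N.map f := by
  rw [← AlgHom.mapMatrix_apply, map_mul]; rfl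

namespace NTilde

section
variable {n q : ℕ} {R : Type*} [CommRing R]

theorem pderiv_detInv_none : MvPolynomial.pderiv (Sum.inr (Sum.inr ())) (equation n q R none) =
    (polyPhi n R).det := by
  have h : MvPolynomial.pderiv (Sum.inr (Sum.inr ()) : Var n) (polyPhi n R).det = 0 := by
    have h1 (s : Equiv.Perm (Fin n)) : MvPolynomial.pderiv (Sum.inr (Sum.inr ()) : Var n)
        (∏ i, polyPhi n R (s i) i) = 0 := by
      refine Finset.prod_induction _ (fun p => MvPolynomial.pderiv _ p = 0) ?_ ?_ ?_
      · intro a b ha hb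
        rw [Derivation.leibniz, ha, hb]; simp
      · simp
      · intro i _
        exact MvPolynomial.pderiv_X_of_ne (by simp)
    rw [Matrix.det_apply, map_sum]
    refine Finset.sum_eq_zero fun s _ => ?_
    rw [Units.smul_def, map_zsmul, h1, smul_zero]
  rw [equation, map_sub, Derivation.leibniz, h, polyDetInv, MvPolynomial.pderiv_X_self]
  simp

theorem pderiv_some (v : Var n) (x : Fin n × Fin n) :
    MvPolynomial.pderiv v (equation n q R (some x)) =
      ((polyPhi n R).map (MvPolynomial.pderiv v) * polyN n R +
        polyPhi n R * (polyN n R).map (MvPolynomial.pderiv v) - (q : MvPolynomial (Var n) R) •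
        ((polyN n R).map (MvPolynomial.pderiv v) * polyPhi n R +
          polyN n R * (polyPhi n R).map (MvPolynomial.pderiv v))) x.1 x.2 := by
  have hmul (X Y : Matrix (Fin n) (Fin n) (MvPolynomial (Var n) R)) (i j : Fin n) :
      MvPolynomial.pderiv v ((X * Y) i j) =
        (X.map (MvPolynomial.pderiv v) * Y + X * Y.map (MvPolynomial.pderiv v)) i j := by
    simp only [Matrix.add_apply, Matrix.mul_apply, map_sum, Derivation.leibniz, smul_eq_mul,
      Matrix.map_apply, Finset.sum_add_distrib]
    rw [add_comm]
    congr 1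
    exact Finset.sum_congr rfl fun _ _ => mul_comm _ _
  rw [equation, Matrix.sub_apply, map_sub, Matrix.smul_apply, smul_eq_mul, Derivation.leibniz, hmul,
    hmul, Derivation.map_natCast, smul_zero, add_zero]
  rfl

theorem map_pderiv_polyPhi_inl (a b : Fin n) :
    (polyPhi n R).map (MvPolynomial.pderiv (Sum.inl (a, b))) = Matrix.single a b 1 := by
  ext1 i j
  simp [polyPhi, MvPolynomial.pderiv_X, Pi.single_apply, Matrix.single_apply, eq_comm]

theorem map_pderiv_polyN_inl (x : Fin n × Fin n) :
    (polyN n R).map (MvPolynomial.pderiv (Sum.inl x)) = 0 := by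
  ext1 i j
  simp [polyN, MvPolynomial.pderiv_X]

theorem map_pderiv_polyN_inr (a b : Fin n) :
    (polyN n R).map (MvPolynomial.pderiv (Sum.inr (Sum.inl (a, b)))) = Matrix.single a b 1 := by
  ext1 i j
  simp [polyN, MvPolynomial.pderiv_X, Pi.single_apply, Matrix.single_apply, eq_comm]

theorem map_pderiv_polyPhi_inr (x : (Fin n × Fin n) ⊕ Unit) :
    (polyPhi n R).map (MvPolynomial.pderiv (Sum.inr x)) = 0 := by
  ext1 i j
  simp [polyPhi, MvPolynomial.pderiv_X]

end

/-- This is the trace pairing with an elementary matrix. Together with `sum_mul_mul_single` it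
rewrites relations between Jacobian rows as matrix equations for the transposed coefficients. -/
theorem sum_mul_single_mul {A : Type*} [CommRing A] {n : ℕ} (y M : Matrix (Fin n) (Fin n) A)
    (a b : Fin n) : ∑ x : Fin n × Fin n, y x.1 x.2 * (Matrix.single a b (1 : A) * M : Matrix _ _ A) x.1 x.2 =
      (M * yᵀ) b a := by
  rw [Fintype.sum_prod_type, Finset.sum_eq_single a]
  · rw [Matrix.mul_apply]
    refine Finset.sum_congr rfl fun j _ => ?_
    simp [Matrix.mul_apply, Matrix.single_apply, mul_comm]
  · intro i _ hi
    refine Finset.sum_eq_zero fun j _ => ?_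
    simp [Matrix.mul_apply, hi.symm]
  · simp

theorem sum_mul_mul_single {A : Type*} [CommRing A] {n : ℕ} (y M : Matrix (Fin n) (Fin n) A)
    (a b : Fin n) : ∑ x : Fin n × Fin n, y x.1 x.2 * (M * Matrix.single a b (1 : A) : Matrix _ _ A) x.1 x.2 =
      (yᵀ * M) b a := by
  rw [Fintype.sum_prod_type_right, Finset.sum_eq_single b]
  · rw [Matrix.mul_apply]
    refine Finset.sum_congr rfl fun j _ => ?_
    simp [Matrix.mul_apply, Matrix.single_apply]
  · intro i _ hi
    refine Finset.sum_eq_zero fun j _ => ?_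
    simp [Matrix.mul_apply, hi.symm]
  · simp

section
variable {n q : ℕ} {k : Type u} [Field k]

/-- The coefficients of a relation between the Jacobian rows at a prime of dimension n², transposed,
form a solution Y of the dual equations. Φ is generic there, so Y = 0. -/
theorem isReduced_of_infinite [Infinite k] (hq : (q : k) ≠ 0)
    (hqi : ∀ i ∈ Finset.Icc 1 n, (q : k) ^ i ≠ 1) : IsReduced (CoordRing n q k) := by
  suffices IsReduced (MvPolynomial (Var n) k ⧸ Ideal.span (Set.range (equation n q k))) from
    isReduced_of_injective (equivQuotient n q k).toRingEquiv (equivQuotient n q k).injective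
  refine isReduced_of_jacobian' (d := n ^ 2) _ card_var ?_ ?_
  · rw [← ringKrullDim_eq_of_ringEquiv (equivQuotient n q k).toRingEquiv]
    exact ringKrullDim_le hq hqi
  intro p hp hfp hd a ha
  have hle : relations n q k ≤ p := by
    rw [relations_eq_span_range, Ideal.span_le]
    rintro _ ⟨i, rfl⟩
    exact hfp i
  let B := MvPolynomial (Var n) k ⧸ p
  let φ : CoordRing n q k →ₐ[k] B := Ideal.Quotient.factorₐ k hle
  have hφ : Function.Surjective φ := Ideal.Quotient.factor_surjective hle
  let π : MvPolynomial (Var n) k →ₐ[k] B := Ideal.Quotient.mkₐ k p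
  have hπ : π = φ.comp (mk n q k) := rfl
  have hΦ : (polyPhi n k).map π = (Phi n q k).map φ := rfl
  have hN : (polyN n k).map π = (N n q k).map φ := rfl
  have ha' (v) : ∑ i, π (a i) * π (MvPolynomial.pderiv v (equation n q k i)) = 0 := by
    simp only [← map_mul]
    rw [← map_sum]
    exact Ideal.Quotient.eq_zero_iff_mem.2 (ha v)
  simp only [Fintype.sum_option] at ha'
  -- Only the determinant equation involves the inverse determinant, with derivative det Φ, a unit.
  have h0 : π (a none) = 0 := by
    have h := ha' (Sum.inr (Sum.inr ()))
    rw [pderiv_detInv_none, Finset.sum_eq_zero, add_zero] at h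
    · have hu : IsUnit (π (polyPhi n k).det) := by
        rw [AlgHom.map_det]
        change IsUnit ((Phi n q k).map φ).det
        rw [← AlgHom.mapMatrix_apply, ← AlgHom.map_det]; exact isUnit_det_Phi.map φ
      exact hu.mul_left_eq_zero.1 h
    · rintro x _
      rw [pderiv_some, map_pderiv_polyPhi_inr]
      have : (polyN n k).map (MvPolynomial.pderiv (Sum.inr (Sum.inr ()))) = 0 := by
        ext1 i j
        simp [polyN, MvPolynomial.pderiv_X]
      rw [this]
      simp
  simp only [h0, zero_mul, zero_add] at ha'
  let y : Matrix (Fin n) (Fin n) B := Matrix.of fun i j => π (a (some (i, j)))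
  have hsingle (a b : Fin n) : (Matrix.single a b (1 : MvPolynomial (Var n) k)).map π =
      Matrix.single a b 1 := by
    ext i j; simp [Matrix.single_apply, apply_ite π]
  have hmul (X Z : Matrix (Fin n) (Fin n) (MvPolynomial (Var n) k)) (i j) :
      π ((X * Z) i j) = (X.map π * Z.map π) i j :=
    congrFun (congrFun (Matrix.map_mul_of_algHom π X Z) i) j
  -- Differentiation with respect to the entries of Φ gives the equation involving N, and
  -- differentiation with respect to those of N gives `hY2`.
  have hY1 : (N n q k).map φ * yᵀ = (q : B) • (yᵀ * (N n q k).map φ) := by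
    ext1 i j
    have h := ha' (Sum.inl (j, i))
    simp only [pderiv_some, map_pderiv_polyPhi_inl, map_pderiv_polyN_inl, Matrix.mul_zero,
      Matrix.zero_mul, add_zero, zero_add, Matrix.sub_apply, Matrix.smul_apply, map_sub,
      smul_eq_mul, map_mul, map_natCast, hmul, hsingle, mul_sub, Finset.sum_sub_distrib,
      mul_left_comm _ (q : B), ← Finset.mul_sum, hN] at h
    have e1 := sum_mul_single_mul y ((N n q k).map φ) j i
    have e2 := sum_mul_mul_single y ((N n q k).map φ) j i
    rw [Matrix.smul_apply, smul_eq_mul, ← e1, ← e2]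
    exact sub_eq_zero.1 h
  have hY2 : yᵀ * (Phi n q k).map φ = (q : B) • ((Phi n q k).map φ * yᵀ) := by
    ext1 i j
    have h := ha' (Sum.inr (Sum.inl (j, i)))
    simp only [pderiv_some, map_pderiv_polyPhi_inr, map_pderiv_polyN_inr, Matrix.mul_zero,
      Matrix.zero_mul, add_zero, zero_add, Matrix.sub_apply, Matrix.smul_apply, map_sub,
      smul_eq_mul, map_mul, map_natCast, hmul, hsingle, mul_sub, Finset.sum_sub_distrib,
      mul_left_comm _ (q : B), ← Finset.mul_sum, hΦ] at h
    have e1 := sum_mul_single_mul y ((Phi n q k).map φ) j i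
    have e2 := sum_mul_mul_single y ((Phi n q k).map φ) j i
    rw [Matrix.smul_apply, smul_eq_mul, ← e1, ← e2]
    exact sub_eq_zero.1 h
  have hy := (trdeg_le_and_eq_zero hq hqi hφ).2 ‹_› hd yᵀ hY1 hY2
  rintro (_ | ⟨i, j⟩)
  · exact Ideal.Quotient.eq_zero_iff_mem.1 h0
  · exact Ideal.Quotient.eq_zero_iff_mem.1 (congrFun (congrFun hy j) i)

/-- The algebraic closure is infinite, and the coordinate ring embeds in its base change to it. -/
theorem isReduced (hq : (q : k) ≠ 0) (hqi : ∀ i ∈ Finset.Icc 1 n, (q : k) ^ i ≠ 1) :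
    IsReduced (CoordRing n q k) := by
  let K := AlgebraicClosure k
  have hinf : Infinite K := IsAlgClosed.instInfinite
  have h1 : IsReduced (CoordRing n q K) := by
    refine isReduced_of_infinite ?_ ?_
    · rw [← map_natCast (algebraMap k K)]
      exact fun h => hq ((map_eq_zero _).1 h)
    · intro i hi
      rw [← map_natCast (algebraMap k K), ← map_pow, Ne,
        map_eq_one_iff _ (algebraMap k K).injective]
      exact hqi i hi
  have h2 : IsReduced (K ⊗[k] CoordRing n q k) :=
    isReduced_of_injective (baseChangeEquiv n q k K).toRingEquiv (baseChangeEquiv n q k K).injective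
  exact isReduced_of_injective
    (Algebra.TensorProduct.includeRight : CoordRing n q k →ₐ[k] K ⊗[k] CoordRing n q k)
    (Algebra.TensorProduct.includeRight_injective (algebraMap k K).injective)

end

end NTilde

end

/-! ### Flatness over ℤ_ℓ and reducedness of the total space -/

section
open Matrix

section
variable {ℓ : ℕ} [Fact ℓ.Prime]

theorem PadicInt.isUnit_intCast {m : ℤ} (h : ¬ (ℓ : ℤ) ∣ m) : IsUnit (m : ℤ_[ℓ]) := by
  by_contra h1
  exact h ((PadicInt.norm_int_lt_one_iff_dvd m).1 (PadicInt.not_isUnit_iff.1 h1))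

theorem PadicInt.isUnit_natCast_of_isBanal {n q : ℕ} (h : IsBanal ℓ n q) : IsUnit (q : ℤ_[ℓ]) := by
  have := PadicInt.isUnit_intCast (ℓ := ℓ) (m := q) fun hd =>
    h.1 ((Nat.modEq_zero_iff_dvd).2 (by exact_mod_cast hd))
  exact_mod_cast this

theorem PadicInt.isUnit_pow_sub_one_of_isBanal {n q : ℕ} (h : IsBanal ℓ n q) :
    ∀ i ∈ Finset.Icc 1 n, IsUnit ((q : ℤ_[ℓ]) ^ i - 1) := by
  intro i hi
  have := PadicInt.isUnit_intCast (ℓ := ℓ) (m := (q : ℤ) ^ i - 1) fun hd => by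
    refine h.2 i hi (Nat.ModEq.symm ((Nat.modEq_iff_dvd).2 ?_))
    push_cast
    exact hd
  exact_mod_cast this

/-- Every nonzero ℓ-adic integer is a unit times a power of ℓ, and torsion-free modules over a
Dedekind domain are flat. -/
theorem Module.flat_padicInt_of_isSMulRegular {M : Type*} [AddCommGroup M] [Module ℤ_[ℓ] M]
    (h : IsSMulRegular M (ℓ : ℤ_[ℓ])) : Module.Flat ℤ_[ℓ] M := by
  have : Module.IsTorsionFree ℤ_[ℓ] M := by
    refine ⟨fun r hr => ?_⟩
    have hr0 : r ≠ 0 := hr.ne_zero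
    rw [PadicInt.unitCoeff_spec hr0]
    exact ((Units.isUnit _).isSMulRegular M).mul (h.pow _)
  infer_instance

end

theorem IsUnit.natCast_ne_zero_of_algebra {R k : Type*} [CommRing R] [CommRing k] [Nontrivial k]
    [Algebra R k] {q : ℕ} (h : IsUnit (q : R)) : (q : k) ≠ 0 := by
  rw [← map_natCast (algebraMap R k)]; exact (h.map _).ne_zero

theorem IsUnit.natCast_pow_ne_one_of_algebra {R k : Type*} [CommRing R] [CommRing k] [Nontrivial k]
    [Algebra R k] {q i : ℕ} (h : IsUnit ((q : R) ^ i - 1)) : (q : k) ^ i ≠ 1 := by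
  have := (h.map (algebraMap R k)).ne_zero
  rwa [map_sub, map_pow, map_natCast, map_one, sub_ne_zero] at this

namespace NTilde

section
variable {n q : ℕ} {R : Type*} [CommRing R]
  (hq : IsUnit (q : R)) (hqi : ∀ i ∈ Finset.Icc 1 n, IsUnit ((q : R) ^ i - 1))
include hq hqi

section
variable (k : Type u) [Field k] [Algebra R k]

theorem isReduced_baseChange : IsReduced (k ⊗[R] CoordRing n q R) := by
  have : IsReduced (CoordRing n q k) := isReduced hq.natCast_ne_zero_of_algebra
    fun i hi => (hqi i hi).natCast_pow_ne_one_of_algebra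
  exact isReduced_of_injective (baseChangeEquiv n q R k).toRingEquiv
    (baseChangeEquiv n q R k).injective

theorem ringKrullDim_baseChange : ringKrullDim (k ⊗[R] CoordRing n q R) = ((n ^ 2 : ℕ) :) := by
  rw [ringKrullDim_eq_of_ringEquiv (baseChangeEquiv n q R k).toRingEquiv]
  exact ringKrullDim_eq hq.natCast_ne_zero_of_algebra
    fun i hi => (hqi i hi).natCast_pow_ne_one_of_algebra

theorem ringKrullDim_baseChange_quotient {m : Ideal (k ⊗[R] CoordRing n q R)}
    (hm : m ∈ minimalPrimes (k ⊗[R] CoordRing n q R)) :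
    ringKrullDim (k ⊗[R] CoordRing n q R ⧸ m) = ((n ^ 2 : ℕ) :) := by
  let e := (baseChangeEquiv n q R k).toRingEquiv
  have h1 := mem_of_mem_minimalPrimes_ringEquiv e hm
  rw [← ringKrullDim_quotient_eq (k := k) hq.natCast_ne_zero_of_algebra
    (fun i hi => (hqi i hi).natCast_pow_ne_one_of_algebra) h1]
  exact ringKrullDim_eq_of_ringEquiv (Ideal.quotientEquiv _ _ e (Ideal.comap_symm e))

omit hq hqi in
theorem exists_algEquiv_quotient_baseChange : ∃ (c : ℕ) (f : Fin c → MvPolynomial (Fin (c + n ^ 2)) k),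
    Nonempty (k ⊗[R] CoordRing n q R ≃ₐ[k]
      (MvPolynomial (Fin (c + n ^ 2)) k ⧸ Ideal.span (Set.range f))) := by
  obtain ⟨c, f, ⟨e⟩⟩ := exists_algEquiv_quotient n q k
  exact ⟨c, f, ⟨(baseChangeEquiv n q R k).trans e⟩⟩

theorem isCompleteIntersection_baseChange :
    IsCompleteIntersection k (k ⊗[R] CoordRing n q R) (n ^ 2) :=
  ⟨exists_algEquiv_quotient_baseChange k, ringKrullDim_baseChange hq hqi k⟩

end

variable {E : Type u} [Field E] [Algebra R E] [Module.Flat R (CoordRing n q R)]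
  (hE : Function.Injective (algebraMap R E))
include hE

/-- By flatness the ring embeds in its base change to E, which is reduced. -/
theorem isReduced_of_flat : IsReduced (CoordRing n q R) := by
  have := isReduced_baseChange hq hqi E
  exact isReduced_of_injective
    (Algebra.TensorProduct.includeRight : CoordRing n q R →ₐ[R] E ⊗[R] CoordRing n q R)
    (Algebra.TensorProduct.includeRight_injective hE)

theorem flatReducedIdeal_eq_bot : flatReducedIdeal n q R = ⊥ := by
  have h1 := isReduced_of_flat hq hqi hE
  refine le_bot_iff.1 (sInf_le ⟨?_, ?_⟩)
  · exact isReduced_of_injective (AlgEquiv.quotientBot R (CoordRing n q R)).toRingEquiv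
      (AlgEquiv.quotientBot R (CoordRing n q R)).injective
  · exact Module.Flat.of_linearEquiv (AlgEquiv.quotientBot R (CoordRing n q R)).toLinearEquiv

end

section
variable {ℓ : ℕ} [Fact ℓ.Prime] {n q : ℕ} (hq : IsBanal ℓ n q)
include hq

/-- The special fibre has the expected dimension n², so ℓ is a nonzerodivisor on this complete
intersection. -/
theorem flat_padicInt : Module.Flat ℤ_[ℓ] (CoordRing n q ℤ_[ℓ]) := by
  apply Module.flat_padicInt_of_isSMulRegular
  have hmax : (Ideal.span {(ℓ : ℤ_[ℓ])}).IsMaximal := by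
    rw [← PadicInt.maximalIdeal_eq_span_p]; infer_instance
  obtain ⟨c, f, ⟨e⟩⟩ := exists_algEquiv_quotient n q ℤ_[ℓ]
  refine isSMulRegular_of_ringKrullDim_quotient_le _ ?_ hmax f e ?_
  · intro x y hxy
    exact mul_left_cancel₀ (by exact_mod_cast (Fact.out : ℓ.Prime).ne_zero) hxy
  · let k := ℤ_[ℓ] ⧸ Ideal.span {(ℓ : ℤ_[ℓ])}
    let _ : Field k := Ideal.Quotient.field _
    have h1 := ringKrullDim_baseChange (PadicInt.isUnit_natCast_of_isBanal hq)
      (PadicInt.isUnit_pow_sub_one_of_isBanal hq) k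
    have h2 := ringKrullDim_eq_of_ringEquiv (Algebra.TensorProduct.quotIdealMapEquivQuotTensor
      (CoordRing n q ℤ_[ℓ]) (Ideal.span {(ℓ : ℤ_[ℓ])})).toRingEquiv
    rw [Ideal.map_span, Set.image_singleton] at h2
    exact (h2.trans h1).le

/-- Flatness is preserved by base change from ℤ_ℓ, so nothing about the structure of R is needed. -/
theorem flat_of_algebra_padicInt (R : Type*) [CommRing R] [Algebra ℤ_[ℓ] R] :
    Module.Flat R (CoordRing n q R) := by
  have := flat_padicInt hq
  exact Module.Flat.of_linearEquiv (baseChangeEquiv n q ℤ_[ℓ] R).symm.toLinearEquiv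

end

end NTilde

/-- The structure map of the ring of integers of an extension of `ℚ_ℓ`. -/
def IsIntegralClosure.ringHom (R A B : Type*) [CommRing R] [CommRing A] [CommRing B] [Algebra R B]
    [Algebra A B] [IsIntegralClosure A R B] : R →+* A where
  toFun x := mk' A (algebraMap R B x) isIntegral_algebraMap
  map_one' := by
    apply algebraMap_injective A R B
    rw [algebraMap_mk', map_one, map_one]
  map_zero' := by
    apply algebraMap_injective A R B
    rw [algebraMap_mk', map_zero, map_zero]
  map_mul' x y := by
    apply algebraMap_injective A R B
    rw [map_mul (algebraMap A B), algebraMap_mk', algebraMap_mk', algebraMap_mk', map_mul]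
  map_add' x y := by
    apply algebraMap_injective A R B
    rw [map_add (algebraMap A B), algebraMap_mk', algebraMap_mk', algebraMap_mk', map_add]

end

/-! ### Geometric consequences over ℤ_ℓ-algebras; separation by points -/

section

theorem isUnit_natCast_of_isBanal {ℓ : ℕ} [Fact ℓ.Prime] {n q : ℕ} (hq : IsBanal ℓ n q)
    {R : Type*} [CommRing R] [Algebra ℤ_[ℓ] R] : IsUnit (q : R) := by
  simpa using (PadicInt.isUnit_natCast_of_isBanal hq).map (algebraMap ℤ_[ℓ] R)

theorem isUnit_pow_sub_one_of_isBanal {ℓ : ℕ} [Fact ℓ.Prime] {n q : ℕ} (hq : IsBanal ℓ n q)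
    {R : Type*} [CommRing R] [Algebra ℤ_[ℓ] R] :
    ∀ i ∈ Finset.Icc 1 n, IsUnit ((q : R) ^ i - 1) := by
  intro i hi
  simpa using (PadicInt.isUnit_pow_sub_one_of_isBanal hq i hi).map (algebraMap ℤ_[ℓ] R)

section
variable {ℓ : ℕ} [Fact ℓ.Prime] {n q : ℕ} (hq : IsBanal ℓ n q)
  {R A : Type*} [CommRing R] [Algebra ℤ_[ℓ] R] [CommRing A] [Algebra R A]
  (e : A ≃ₐ[R] NTilde.CoordRing n q R)

/-- Base change of an isomorphism with the coordinate ring. -/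
def NTilde.baseChangeCongr (k : Type*) [CommRing k] [Algebra R k] :
    k ⊗[R] A ≃ₐ[k] k ⊗[R] NTilde.CoordRing n q R :=
  Algebra.TensorProduct.congr AlgEquiv.refl e

include hq e

theorem isReduced_baseChange_of_algEquiv (k : Type u) [Field k] [Algebra R k] :
    IsReduced (k ⊗[R] A) := by
  have := NTilde.isReduced_baseChange (isUnit_natCast_of_isBanal (R := R) hq)
    (isUnit_pow_sub_one_of_isBanal hq) k
  exact isReduced_of_injective (NTilde.baseChangeCongr e k) (NTilde.baseChangeCongr e k).injective

theorem isCompleteIntersection_of_algEquiv (k : Type u) [Field k] [Algebra R k] :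
    IsCompleteIntersection k (k ⊗[R] A) (n ^ 2) := by
  obtain ⟨⟨c, f, ⟨e'⟩⟩, h⟩ := NTilde.isCompleteIntersection_baseChange
    (isUnit_natCast_of_isBanal (R := R) hq) (isUnit_pow_sub_one_of_isBanal hq) k
  refine ⟨⟨c, f, ⟨(NTilde.baseChangeCongr e k).trans e'⟩⟩, ?_⟩
  rw [ringKrullDim_eq_of_ringEquiv (NTilde.baseChangeCongr e k).toRingEquiv, h]

theorem isRelativeCompleteIntersection_of_algEquiv :
    IsRelativeCompleteIntersection R A (n ^ 2) := by
  obtain ⟨c, f, ⟨e'⟩⟩ := NTilde.exists_algEquiv_quotient n q R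
  exact ⟨⟨c, f, ⟨e.trans e'⟩⟩, fun p =>
    (isCompleteIntersection_of_algEquiv hq e p.asIdeal.ResidueField).2⟩

theorem isRelativelyEquidimensional_of_algEquiv :
    IsRelativelyEquidimensional R A (n ^ 2) := by
  intro p m hm
  let e' := (NTilde.baseChangeCongr e p.asIdeal.ResidueField).toRingEquiv
  rw [← NTilde.ringKrullDim_baseChange_quotient (isUnit_natCast_of_isBanal (R := R) hq)
    (isUnit_pow_sub_one_of_isBanal hq) p.asIdeal.ResidueField
    (mem_of_mem_minimalPrimes_ringEquiv e' hm)]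
  exact ringKrullDim_eq_of_ringEquiv (Ideal.quotientEquiv _ _ e' (Ideal.comap_symm e'))

end

/-- A point of a reduced algebra of finite type over an algebraically closed field separates any
nonzero function from zero. -/
theorem exists_algHom_ne_zero {K A : Type*} [Field K] [IsAlgClosed K] [CommRing A] [Algebra K A]
    [Algebra.FiniteType K A] [IsReduced A] {a : A} (ha : a ≠ 0) : ∃ x : A →ₐ[K] K, x a ≠ 0 := by
  -- In a reduced Jacobson ring the maximal ideals meet in 0, and the residue fields are K by the
  -- Nullstellensatz.
  have hJ : IsJacobsonRing A := isJacobsonRing_of_finiteType (A := K)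
  have h1 : (⊥ : Ideal A).jacobson = ⊥ := by
    rw [← Ideal.radical_eq_jacobson]
    exact (Ideal.isRadical_bot (R := A)).radical
  obtain ⟨m, hm, ham⟩ : ∃ m : Ideal A, m.IsMaximal ∧ a ∉ m := by
    by_contra! h
    apply ha
    have : a ∈ (⊥ : Ideal A).jacobson := by
      rw [Ideal.jacobson, Ideal.mem_sInf]
      exact fun {J} hJ => h J hJ.2
    rwa [h1] at this
  let _ : Field (A ⧸ m) := Ideal.Quotient.field m
  have h2 : Module.Finite K (A ⧸ m) := finite_of_finite_type_of_isJacobsonRing K (A ⧸ m)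
  let e := AlgEquiv.ofBijective (Algebra.ofId K (A ⧸ m))
    (IsAlgClosed.algebraMap_bijective_of_isIntegral (k := K) (K := A ⧸ m))
  refine ⟨e.symm.toAlgHom.comp (Ideal.Quotient.mkₐ K m), fun h => ham ?_⟩
  have h3 : e.symm (Ideal.Quotient.mk m a) = 0 := h
  exact Ideal.Quotient.eq_zero_iff_mem.1 ((map_eq_zero_iff _ e.symm.injective).1 h3)

instance {n q : ℕ} {R : Type*} [CommRing R] : Algebra.FiniteType R (NTilde.CoordRing n q R) :=
  Algebra.FiniteType.of_surjective (NTilde.mk n q R) NTilde.mk_surjective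

/-- By flatness a nonzero function stays nonzero over K, where the coordinate ring is reduced of
finite type and K-points separate functions. -/
theorem NTilde.exists_algHom_ne_zero {ℓ : ℕ} [Fact ℓ.Prime] {n q : ℕ} (hq : IsBanal ℓ n q)
    {R : Type*} [CommRing R] [Algebra ℤ_[ℓ] R] {K : Type u} [Field K] [IsAlgClosed K] [Algebra R K]
    (hK : Function.Injective (algebraMap R K)) {a : CoordRing n q R} (ha : a ≠ 0) :
    ∃ x : CoordRing n q R →ₐ[R] K, x a ≠ 0 := by
  have hflat := flat_of_algebra_padicInt hq R
  have hred := isReduced_baseChange (isUnit_natCast_of_isBanal (R := R) hq)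
    (isUnit_pow_sub_one_of_isBanal hq) K
  obtain ⟨x, hx⟩ := _root_.exists_algHom_ne_zero (K := K) (a := (1 : K) ⊗ₜ[R] a) fun h => ha
    (Algebra.TensorProduct.includeRight_injective (A := K) (B := CoordRing n q R) hK
      (h.trans (TensorProduct.tmul_zero _ _).symm))
  exact ⟨(x.restrictScalars R).comp Algebra.TensorProduct.includeRight, hx⟩

end

/-! ### Truncated exponential and logarithm -/

section

open Polynomial in
/-- A polynomial solving `(1 + aX)p' = bp` modulo `X ^ (n - 1)` with `p(0) = 0` vanishes modulo
`X ^ n`. -/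
theorem Polynomial.X_pow_dvd_of_derivative {S : Type*} [CommRing S] {n : ℕ}
    (hS : ∀ k ∈ Finset.Icc 1 n, IsUnit (k : S)) {p : S[X]} (a b : S) (h0 : p.coeff 0 = 0)
    (h : X ^ (n - 1) ∣ (1 + C a * X) * derivative p - C b * p) : X ^ n ∣ p := by
  rw [X_pow_dvd_iff] at h ⊢
  intro d
  -- The coefficient of X^d in the equation reads (d+1)p_(d+1) + (ad - b)p_d = 0, and d + 1 is a
  -- unit.
  induction d with
  | zero => exact fun _ => h0
  | succ d ih =>
    intro hd
    have h1 := h d (by omega)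
    have h2 := ih (by omega)
    have h3 : (X * derivative p).coeff d = 0 := by
      cases d with
      | zero => simp
      | succ d => rw [coeff_X_mul, coeff_derivative, h2, zero_mul]
    rw [coeff_sub, add_mul, coeff_add, one_mul, mul_assoc, coeff_C_mul, coeff_C_mul, h2, h3,
      coeff_derivative, mul_zero, mul_zero, add_zero, sub_zero] at h1
    have hu := hS (d + 1) (Finset.mem_Icc.2 ⟨by omega, by omega⟩)
    push_cast at hu
    exact hu.mul_left_eq_zero.1 h1

section
open Polynomial
variable (n : ℕ) (S : Type*) [CommRing S]

/-- The exponential series truncated at degree `n`. -/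
def expTrunc : S[X] := ∑ k ∈ Finset.range n, C (Ring.inverse ((k.factorial : ℕ) : S)) * X ^ k

/-- The series of `log (1 + X)` truncated after degree `n`. -/
def logTrunc : S[X] := ∑ k ∈ Finset.Icc 1 n, C ((-1 : S) ^ (k - 1) * Ring.inverse (k : S)) * X ^ k

variable {n S}

theorem coeff_expTrunc (k : ℕ) :
    (expTrunc n S).coeff k = if k < n then Ring.inverse ((k.factorial : ℕ) : S) else 0 := by
  simp [expTrunc, coeff_X_pow]

theorem X_dvd_logTrunc : X ∣ logTrunc n S :=
  Finset.dvd_sum fun k hk => Dvd.dvd.mul_left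
    (dvd_pow_self _ (by have := (Finset.mem_Icc.1 hk).1; omega)) _

theorem X_dvd_expTrunc_sub_one (hn : n ≠ 0) : X ∣ expTrunc n S - 1 := by
  rw [X_dvd_iff, coeff_sub, coeff_expTrunc, if_pos (Nat.pos_of_ne_zero hn)]
  simp

theorem X_pow_dvd_expTrunc_sub_one_pow : X ^ n ∣ (expTrunc n S - 1) ^ n := by
  rcases eq_or_ne n 0 with rfl | hn
  · simp
  · exact pow_dvd_pow_of_dvd (X_dvd_expTrunc_sub_one hn) n

variable (hS : ∀ k ∈ Finset.Icc 1 n, IsUnit (k : S))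
include hS

theorem isUnit_factorial {k : ℕ} (hk : k ≤ n) : IsUnit ((k.factorial : ℕ) : S) := by
  induction k with
  | zero => simp
  | succ k ih =>
    rw [Nat.factorial_succ, Nat.cast_mul]
    exact (hS _ (Finset.mem_Icc.2 ⟨by omega, hk⟩)).mul (ih (by omega))

/-- The derivative lacks the top term of degree n - 1, so the equation y' = y holds only modulo
X^(n-1). That is the precision `X_pow_dvd_of_derivative` asks for. -/
theorem X_pow_dvd_derivative_expTrunc_sub :
    X ^ (n - 1) ∣ derivative (expTrunc n S) - expTrunc n S := by
  rw [X_pow_dvd_iff]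
  intro d hd
  rw [coeff_sub, coeff_derivative, coeff_expTrunc, coeff_expTrunc, if_pos (by omega),
    if_pos (by omega), sub_eq_zero]
  have h1 := isUnit_factorial hS (k := d) (by omega)
  have h2 := isUnit_factorial hS (k := d + 1) (by omega)
  apply h2.mul_right_cancel
  have h3 : ((d + 1).factorial : S) = (d + 1 : S) * d.factorial := by
    rw [Nat.factorial_succ]; push_cast; ring
  calc Ring.inverse ((d + 1).factorial : S) * (d + 1) * ((d + 1).factorial : S)
      = (Ring.inverse ((d + 1).factorial : S) * ((d + 1).factorial : S)) * (d + 1) := by ring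
    _ = d + 1 := by rw [Ring.inverse_mul_cancel _ h2, one_mul]
    _ = (Ring.inverse (d.factorial : S) * (d.factorial : S)) * (d + 1) := by
      rw [Ring.inverse_mul_cancel _ h1, one_mul]
    _ = _ := by rw [h3]; ring

/-- The derivative is the geometric sum in -X, so the difference is exactly -(-X)^n. -/
theorem X_pow_dvd_derivative_logTrunc :
    X ^ n ∣ (1 + X) * derivative (logTrunc n S) - 1 := by
  have h1 : derivative (logTrunc n S) = ∑ k ∈ Finset.range n, (-X) ^ k := by
    rw [logTrunc, derivative_sum, Finset.range_eq_Ico, Finset.sum_Ico_eq_sum_range]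
    rw [← Finset.Ico_succ_right_eq_Icc, Finset.sum_Ico_eq_sum_range]
    refine Finset.sum_congr (by simp) fun k hk => ?_
    have hk' : k < n := by simpa using hk
    have hu := hS (1 + k) (Finset.mem_Icc.2 ⟨by omega, by omega⟩)
    rw [derivative_C_mul_X_pow, mul_assoc, Ring.inverse_mul_cancel _ hu, neg_pow (X : S[X])]
    simp
  have h2 : (1 + X) * ∑ k ∈ Finset.range n, (-X : S[X]) ^ k = 1 - (-X) ^ n := by
    rw [← mul_neg_geom_sum, sub_neg_eq_add]
  rw [h1, h2, sub_sub_cancel_left, neg_pow]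
  exact (Dvd.intro_left _ rfl).neg_right

/-- Write E for exp and L for log(1 + X), both truncated. L(E - 1) - X vanishes at 0, and its
derivative is congruent to E·L'(E - 1) - 1, hence to 0. -/
theorem X_pow_dvd_logTrunc_comp : X ^ n ∣ (logTrunc n S).comp (expTrunc n S - 1) - X := by
  rcases eq_or_ne n 0 with rfl | hn
  · simp
  refine X_pow_dvd_of_derivative hS 0 0 ?_ ?_
  · have h1 := X_dvd_iff.1 (X_dvd_expTrunc_sub_one (S := S) hn)
    rw [coeff_zero_eq_eval_zero] at h1
    rw [coeff_zero_eq_eval_zero, eval_sub, eval_comp, h1, eval_X, sub_zero,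
      ← coeff_zero_eq_eval_zero, X_dvd_iff.1 X_dvd_logTrunc]
  · have h1 : X ^ n ∣ expTrunc n S * (derivative (logTrunc n S)).comp (expTrunc n S - 1) - 1 := by
      obtain ⟨r, hr⟩ := X_pow_dvd_derivative_logTrunc hS
      have := congrArg (fun p => p.comp (expTrunc n S - 1)) hr
      simp only [sub_comp, mul_comp, add_comp, one_comp, X_comp, pow_comp, add_sub_cancel] at this
      rw [this]
      exact X_pow_dvd_expTrunc_sub_one_pow.mul_right _
    have h2 := (X_pow_dvd_derivative_expTrunc_sub hS).mul_left
      ((derivative (logTrunc n S)).comp (expTrunc n S - 1))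
    convert dvd_add ((pow_dvd_pow X (Nat.sub_le n 1)).trans h1) h2 using 1
    simp only [derivative_sub, derivative_comp, derivative_X, derivative_one, C_0]
    ring

/-- exp(log(1 + X)) and 1 + X both solve (1 + X)y' = y to the given precision and agree at 0. -/
theorem X_pow_dvd_expTrunc_comp : X ^ n ∣ (expTrunc n S).comp (logTrunc n S) - (1 + X) := by
  rcases eq_or_ne n 0 with rfl | hn
  · simp
  refine X_pow_dvd_of_derivative hS 1 1 ?_ ?_
  · have h1 := X_dvd_iff.1 (X_dvd_logTrunc (n := n) (S := S))
    rw [coeff_zero_eq_eval_zero] at h1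
    rw [coeff_zero_eq_eval_zero, eval_sub, eval_comp, h1, ← coeff_zero_eq_eval_zero,
      coeff_expTrunc, if_pos (Nat.pos_of_ne_zero hn)]
    simp
  · have h1 := ((pow_dvd_pow X (Nat.sub_le n 1)).trans (X_pow_dvd_derivative_logTrunc hS)).mul_right
      ((derivative (expTrunc n S)).comp (logTrunc n S))
    have h2 : X ^ (n - 1) ∣ (derivative (expTrunc n S) - expTrunc n S).comp (logTrunc n S) := by
      obtain ⟨r, hr⟩ := X_pow_dvd_derivative_expTrunc_sub hS
      rw [hr, mul_comp, pow_comp, X_comp]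
      exact (pow_dvd_pow_of_dvd X_dvd_logTrunc _).mul_right _
    convert dvd_add h1 h2 using 1
    simp only [derivative_sub, derivative_comp, derivative_add, derivative_X, derivative_one, C_1,
      sub_comp]
    ring

/-- exp(X)^q and exp(qX) both solve y' = qy to the given precision and agree at 0. -/
theorem X_pow_dvd_expTrunc_pow_sub (q : ℕ) :
    X ^ n ∣ expTrunc n S ^ q - (expTrunc n S).comp (C (q : S) * X) := by
  rcases eq_or_ne n 0 with rfl | hn
  · simp
  refine X_pow_dvd_of_derivative hS 0 (q : S) ?_ ?_
  · simp [coeff_zero_eq_eval_zero, eval_comp]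
    simp [← coeff_zero_eq_eval_zero, coeff_expTrunc, Nat.pos_of_ne_zero hn]
  · have h1 := (X_pow_dvd_derivative_expTrunc_sub hS).mul_left (C (q : S) * expTrunc n S ^ (q - 1))
    have h2 : X ^ (n - 1) ∣ (derivative (expTrunc n S) - expTrunc n S).comp (C (q : S) * X) := by
      obtain ⟨r, hr⟩ := X_pow_dvd_derivative_expTrunc_sub hS
      rw [hr, mul_comp, pow_comp, X_comp]
      exact (pow_dvd_pow_of_dvd (Dvd.intro_left _ rfl) _).mul_right _
    convert dvd_sub h1 (h2.mul_left (C (q : S))) using 1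
    have h3 : C (q : S) * expTrunc n S ^ (q - 1) * expTrunc n S = C (q : S) * expTrunc n S ^ q := by
      rcases eq_or_ne q 0 with rfl | hq
      · simp
      · rw [mul_assoc, pow_sub_one_mul hq]
    simp only [derivative_sub, derivative_comp, derivative_pow, derivative_mul, derivative_C,
      derivative_X, sub_comp, mul_sub, h3, C_0]
    ring

end

section
open Polynomial Matrix
variable {n : ℕ} {S : Type*} [CommRing S]

/-- The exponential of a nilpotent matrix. -/
def unipExp (N : Matrix (Fin n) (Fin n) S) : Matrix (Fin n) (Fin n) S := aeval N (expTrunc n S)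

theorem unipLog_eq_aeval (X : Matrix (Fin n) (Fin n) S) :
    unipLog X = aeval (X - 1) (logTrunc n S) := by
  rw [unipLog, logTrunc, map_sum]
  refine Finset.sum_congr rfl fun k _ => ?_
  rw [map_mul, aeval_C, map_pow, aeval_X, Algebra.smul_def]

theorem aeval_eq_zero_of_X_pow_dvd {N : Matrix (Fin n) (Fin n) S} (hN : N ^ n = 0) {p : S[X]}
    (h : X ^ n ∣ p) : aeval N p = 0 := by
  obtain ⟨r, rfl⟩ := h
  rw [map_mul, map_pow, aeval_X, hN, zero_mul]

theorem mul_aeval_eq_aeval_mul {Φ N M : Matrix (Fin n) (Fin n) S} (h : Φ * N = M * Φ) (p : S[X]) :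
    Φ * aeval N p = aeval M p * Φ := by
  induction p using Polynomial.induction_on' with
  | add p q hp hq => rw [map_add, map_add, mul_add, add_mul, hp, hq]
  | monomial k a =>
    have h1 : Φ * N ^ k = M ^ k * Φ := (show SemiconjBy Φ N M from h).pow_right k
    rw [aeval_monomial, aeval_monomial, ← Algebra.smul_def, ← Algebra.smul_def, mul_smul_comm, h1,
      smul_mul_assoc]

theorem unipExp_sub_one_pow {N : Matrix (Fin n) (Fin n) S} (hN : N ^ n = 0) :
    (unipExp N - 1) ^ n = 0 := by
  have := aeval_eq_zero_of_X_pow_dvd hN X_pow_dvd_expTrunc_sub_one_pow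
  simpa [unipExp] using this

theorem unipLog_pow {X : Matrix (Fin n) (Fin n) S} (hX : (X - 1) ^ n = 0) : unipLog X ^ n = 0 := by
  have := aeval_eq_zero_of_X_pow_dvd hX (pow_dvd_pow_of_dvd (X_dvd_logTrunc (n := n)) n)
  rwa [map_pow, ← unipLog_eq_aeval] at this

variable (hS : ∀ k ∈ Finset.Icc 1 n, IsUnit (k : S))
include hS

theorem unipLog_unipExp {N : Matrix (Fin n) (Fin n) S} (hN : N ^ n = 0) :
    unipLog (unipExp N) = N := by
  have := aeval_eq_zero_of_X_pow_dvd hN (X_pow_dvd_logTrunc_comp hS)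
  rw [map_sub, aeval_comp, map_sub, map_one, aeval_X, sub_eq_zero] at this
  rw [unipLog_eq_aeval]
  exact this

theorem unipExp_unipLog {X : Matrix (Fin n) (Fin n) S} (hX : (X - 1) ^ n = 0) :
    unipExp (unipLog X) = X := by
  have := aeval_eq_zero_of_X_pow_dvd hX (X_pow_dvd_expTrunc_comp hS)
  rw [map_sub, aeval_comp, map_add, map_one, aeval_X, ← unipLog_eq_aeval, add_sub_cancel,
    sub_eq_zero] at this
  exact this

theorem unipExp_smul {N : Matrix (Fin n) (Fin n) S} (hN : N ^ n = 0) (q : ℕ) :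
    unipExp ((q : S) • N) = unipExp N ^ q := by
  have := aeval_eq_zero_of_X_pow_dvd hN (X_pow_dvd_expTrunc_pow_sub hS q)
  rw [map_sub, aeval_comp, map_mul, aeval_C, aeval_X, ← Algebra.smul_def, map_pow,
    sub_eq_zero] at this
  exact this.symm

theorem mul_unipExp {Φ N : Matrix (Fin n) (Fin n) S} {q : ℕ} (hN : N ^ n = 0)
    (h : Φ * N = (q : S) • (N * Φ)) : Φ * unipExp N = unipExp N ^ q * Φ := by
  rw [← unipExp_smul hS hN]
  exact mul_aeval_eq_aeval_mul (by rw [h, smul_mul_assoc]) _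

theorem mul_unipLog {Φ X : Matrix (Fin n) (Fin n) S} {q : ℕ} (hX : (X - 1) ^ n = 0)
    (h : Φ * X = X ^ q * Φ) : Φ * unipLog X = (q : S) • (unipLog X * Φ) := by
  have hN := unipLog_pow hX
  -- Write X as exp of its logarithm N, so that X^q = exp(qN), and take the logarithm.
  have h1 : unipLog (X ^ q) = (q : S) • unipLog X := by
    conv_lhs => rw [← unipExp_unipLog hS hX, ← unipExp_smul hS hN]
    exact unipLog_unipExp hS (by rw [_root_.smul_pow, hN, smul_zero])
  rw [← smul_mul_assoc, ← h1, unipLog_eq_aeval, unipLog_eq_aeval]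
  exact mul_aeval_eq_aeval_mul (by rw [mul_sub, sub_mul, h, mul_one, one_mul]) _

omit hS in
theorem Ring.inverse_map_of_isUnit {T : Type*} [CommRing T] (f : S →+* T) {a : S} (ha : IsUnit a) :
    f (Ring.inverse a) = Ring.inverse (f a) := by
  apply (ha.map f).mul_left_cancel
  rw [← map_mul, Ring.mul_inverse_cancel _ ha, Ring.mul_inverse_cancel _ (ha.map f), map_one]

omit hS in
theorem aeval_map_matrix {T : Type*} [CommRing T] (f : S →+* T) (N : Matrix (Fin n) (Fin n) S)
    (p : S[X]) : (aeval N p).map f = aeval (N.map f) (p.map f) := by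
  induction p using Polynomial.induction_on' with
  | add p q hp hq =>
    rw [map_add, Matrix.map_add _ (map_add f), hp, hq, Polynomial.map_add, map_add]
  | monomial k a =>
    rw [aeval_monomial, Polynomial.map_monomial, aeval_monomial, ← Algebra.smul_def,
      ← Algebra.smul_def, Matrix.map_smul' _ _ _ (map_mul f), ← RingHom.mapMatrix_apply, map_pow]
    rfl

/-- Invertibility of the denominators is needed because `Ring.inverse` is preserved by a ring map
only on units. -/
theorem unipExp_map {T : Type*} [CommRing T] (f : S →+* T) (N : Matrix (Fin n) (Fin n) S) :
    (unipExp N).map f = unipExp (N.map f) := by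
  rw [unipExp, aeval_map_matrix, unipExp]
  congr 1
  simp only [expTrunc, Polynomial.map_sum, Polynomial.map_mul, map_C, Polynomial.map_pow, map_X]
  refine Finset.sum_congr rfl fun k hk => ?_
  rw [Ring.inverse_map_of_isUnit f (isUnit_factorial hS (Finset.mem_range.1 hk).le), map_natCast]

theorem unipLog_map {T : Type*} [CommRing T] (f : S →+* T) (X : Matrix (Fin n) (Fin n) S) :
    (unipLog X).map f = unipLog (X.map f) := by
  rw [unipLog_eq_aeval, aeval_map_matrix, unipLog_eq_aeval, Matrix.map_sub _ (map_sub f),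
    Matrix.map_one _ (map_zero f) (map_one f)]
  congr 1
  simp only [logTrunc, Polynomial.map_sum, Polynomial.map_mul, map_C, Polynomial.map_pow, map_X,
    map_mul, map_pow, map_neg, map_one, Polynomial.map_neg, Polynomial.map_one]
  refine Finset.sum_congr rfl fun k hk => ?_
  rw [Ring.inverse_map_of_isUnit f (hS k hk), map_natCast]

end

end

/-! ### Newton's identities and rigidity of the unipotent locus -/

section
open Matrix

namespace Matrix
open Polynomial
variable {n : ℕ} {D : Type*} [CommRing D] (U : Matrix (Fin n) (Fin n) D)

/-- Jacobi's formula: differentiate the determinant of t - U one column at a time. Each derivative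
is a principal cofactor. -/
theorem derivative_charpoly : derivative U.charpoly = U.charmatrix.adjugate.trace := by
  have h1 (i j : Fin n) : derivative (U.charmatrixᵀ i j) = Pi.single (M := fun _ => D[X]) j 1 i := by
    rcases eq_or_ne j i with rfl | hij
    · simp [Matrix.charmatrix_apply_eq]
    · rw [Matrix.transpose_apply, Matrix.charmatrix_apply_ne _ _ _ hij, Pi.single_eq_of_ne hij.symm]
      simp
  have h2 (i : Fin n) : U.charmatrix.adjugate i i =
      (U.charmatrixᵀ.updateCol i (Pi.single i 1)).det := by
    rw [Matrix.adjugate_apply, ← Matrix.det_transpose, ← Matrix.updateCol_transpose]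
  rw [Matrix.trace, Matrix.charpoly, ← Matrix.det_transpose]
  simp only [Matrix.diag_apply, h2, Matrix.det_apply]
  rw [Finset.sum_comm, derivative_sum]
  refine Finset.sum_congr rfl fun σ _ => ?_
  rw [← Finset.smul_sum, Units.smul_def, Units.smul_def, map_zsmul, derivative_prod_finset]
  congr 1
  refine Finset.sum_congr rfl fun i _ => ?_
  rw [h1, ← Finset.mul_prod_erase _ _ (Finset.mem_univ i), mul_comm, Matrix.updateCol_self]
  congr 1
  refine Finset.prod_congr rfl fun j hj => ?_
  rw [Matrix.updateCol_ne (Finset.ne_of_mem_erase hj)]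

/-- The coefficients of the adjugate of the characteristic matrix. -/
def adjugateCoeff (m : ℕ) : Matrix (Fin n) (Fin n) D :=
  U.charmatrix.adjugate.map fun p => p.coeff m

/-- Compare the coefficients of t^(m+1) in (t - U) adj(t - U) = χ(t). -/
theorem adjugateCoeff_recursion (m : ℕ) :
    adjugateCoeff U m = U * adjugateCoeff U (m + 1) + U.charpoly.coeff (m + 1) • 1 := by
  have h := U.charmatrix.mul_adjugate
  ext i j
  have h1 := congrArg (fun p => p.coeff (m + 1)) (congrFun (congrFun h i) j)
  have h2 : (U.charmatrix * U.charmatrix.adjugate) i j =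
      X * U.charmatrix.adjugate i j - ∑ k, C (U i k) * U.charmatrix.adjugate k j := by
    rw [Matrix.charmatrix, Matrix.sub_mul, Matrix.sub_apply, Matrix.mul_apply, Matrix.mul_apply,
      Finset.sum_eq_single i]
    · simp
    · intro k _ hk
      simp [hk.symm]
    · simp
  simp only [h2, coeff_sub, coeff_X_mul, finsetSum_coeff, coeff_C_mul] at h1
  rw [Matrix.add_apply, Matrix.mul_apply, Matrix.smul_apply]
  simp only [adjugateCoeff, Matrix.map_apply]
  rw [sub_eq_iff_eq_add'] at h1
  rw [h1]
  congr 1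
  rw [Matrix.smul_apply, smul_eq_mul, smul_eq_mul, Matrix.one_apply, Matrix.one_apply]
  split_ifs
  · rw [mul_one, mul_one]; rfl
  · simp

theorem trace_adjugateCoeff (m : ℕ) :
    (adjugateCoeff U m).trace = (m + 1) * U.charpoly.coeff (m + 1) := by
  have h := congrArg (fun p => p.coeff m) (derivative_charpoly U)
  simp only [coeff_derivative, Matrix.trace, finsetSum_coeff] at h
  rw [mul_comm, h]
  rfl

/-- The coefficients vanish in high degree, and the recursion carries this down to degree n because
χ has none above n. -/
theorem adjugateCoeff_eq_zero [Nontrivial D] {m : ℕ} (hm : n ≤ m) : adjugateCoeff U m = 0 := by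
  obtain ⟨N, hN⟩ : ∃ N, ∀ m ≥ N, adjugateCoeff U m = 0 := by
    refine ⟨(Finset.univ.sup fun x : Fin n × Fin n =>
      (U.charmatrix.adjugate x.1 x.2).natDegree) + 1, fun m hm => ?_⟩
    ext i j
    refine coeff_eq_zero_of_natDegree_lt ?_
    have := Finset.le_sup (f := fun x : Fin n × Fin n =>
      (U.charmatrix.adjugate x.1 x.2).natDegree) (Finset.mem_univ (i, j))
    change (U.charmatrix.adjugate i j).natDegree < m
    simp only at this
    omega
  have hdeg : U.charpoly.natDegree = n := by simp
  have key (k : ℕ) : ∀ m, n ≤ m → N ≤ m + k → adjugateCoeff U m = 0 := by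
    induction k with
    | zero => exact fun m _ hm => hN m hm
    | succ k ih =>
      intro m hm hk
      rw [adjugateCoeff_recursion, ih (m + 1) (by omega) (by omega), mul_zero,
        coeff_eq_zero_of_natDegree_lt (by omega), zero_smul, add_zero]
  exact key N m hm (by omega)

theorem trace_pow_mul_adjugateCoeff [Nontrivial D] (r i m : ℕ) (h : m + r + 1 = n) :
    (U ^ i * adjugateCoeff U m).trace =
      ∑ s ∈ Finset.range (r + 1), U.charpoly.coeff (n - s) * (U ^ (i + r - s)).trace := by
  induction r generalizing i m with
  | zero =>
    rw [adjugateCoeff_recursion, adjugateCoeff_eq_zero U (by omega)]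
    have : m + 1 = n := by omega
    simp [this]
  | succ r ih =>
    rw [adjugateCoeff_recursion, mul_add, ← mul_assoc, ← pow_succ, Matrix.trace_add,
      ih (i + 1) (m + 1) (by omega), Finset.sum_range_succ _ (r + 1)]
    have h1 : n - (r + 1) = m + 1 := by omega
    have h2 : i + (r + 1) - (r + 1) = i := by omega
    rw [h1, h2, mul_smul_comm, mul_one, Matrix.trace_smul, smul_eq_mul]
    congr 1
    refine Finset.sum_congr rfl fun s _ => ?_
    congr 4
    omega

/-- Newton's identities for the traces of the powers of a matrix. -/
theorem newton_charpoly [Nontrivial D] {r : ℕ} (hr : r < n) :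
    ∑ s ∈ Finset.range (r + 1), U.charpoly.coeff (n - s) * (U ^ (r - s)).trace =
      ((n - r : ℕ) : D) * U.charpoly.coeff (n - r) := by
  have h := trace_pow_mul_adjugateCoeff U r 0 (n - r - 1) (by omega)
  have h1 : n - r - 1 + 1 = n - r := by omega
  rw [pow_zero, one_mul, trace_adjugateCoeff, h1] at h
  simp only [zero_add] at h
  rw [← h, ← h1]
  push_cast
  rfl

/-- This is the trace of U^(r-n) times the Cayley–Hamilton relation. -/
theorem newton_charpoly_of_le [Nontrivial D] {r : ℕ} (hr : n ≤ r) :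
    ∑ s ∈ Finset.range (n + 1), U.charpoly.coeff (n - s) * (U ^ (r - s)).trace = 0 := by
  have h := U.aeval_self_charpoly
  have hdeg : U.charpoly.natDegree = n := by simp
  rw [aeval_eq_sum_range, hdeg] at h
  have h1 := congrArg (fun M => (U ^ (r - n) * M).trace) h
  simp only [Finset.mul_sum, mul_zero, Matrix.trace_zero, Matrix.trace_sum, mul_smul_comm,
    Matrix.trace_smul, ← pow_add, smul_eq_mul] at h1
  rw [← h1, ← Finset.sum_range_reflect]
  refine Finset.sum_congr rfl fun s hs => ?_
  have := Finset.mem_range.1 hs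
  congr 3 <;> omega

end Matrix

section
open Polynomial
variable {n q : ℕ} {D : Type*} [CommRing D] {Φ U : Matrix (Fin n) (Fin n) D}

/-- U is conjugate to (1 + U)^q - 1 = U g(U) with g(0) = q. The k-th power of the latter is q^k U^k
plus multiples of U^(k+1), which have trace 0 by assumption. -/
theorem trace_pow_eq_of_conj (hΦ : IsUnit Φ.det) (h : Φ * (1 + U) = (1 + U) ^ q * Φ) {k : ℕ}
    (hk : ∀ j > k, (U ^ j).trace = 0) : (U ^ k).trace = (q : D) ^ k * (U ^ k).trace := by
  obtain ⟨g, hg⟩ : ∃ g : D[X], (1 + X) ^ q - 1 = X * g := by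
    refine X_dvd_iff.2 ?_
    rw [coeff_sub, coeff_one_add_X_pow]
    simp
  have hg0 : g.coeff 0 = q := by
    have := congrArg (fun p => p.coeff 1) hg
    simp only [coeff_sub, coeff_one_add_X_pow, coeff_X_mul, coeff_one] at this
    simpa using this.symm
  obtain ⟨r, hr⟩ : X ∣ g ^ k - C ((q : D) ^ k) := by
    rw [X_dvd_iff, coeff_sub, coeff_C_zero, coeff_zero_eq_eval_zero, eval_pow,
      ← coeff_zero_eq_eval_zero, hg0, sub_self]
  obtain ⟨V, hV⟩ : ∃ V, V = (1 + U) ^ q - 1 := ⟨_, rfl⟩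
  have h1 : Φ * U = V * Φ := by
    rw [hV, sub_mul, ← h, mul_add, mul_one, one_mul, add_sub_cancel_left]
  have h2 : Φ * U ^ k = V ^ k * Φ := (show SemiconjBy Φ U V from h1).pow_right k
  have h3 : (V ^ k).trace = (U ^ k).trace := by
    have hinv := Matrix.mul_nonsing_inv Φ hΦ
    calc (V ^ k).trace = (V ^ k * Φ * Φ⁻¹).trace := by rw [mul_assoc, hinv, mul_one]
      _ = (Φ⁻¹ * (Φ * U ^ k)).trace := by rw [← h2, Matrix.trace_mul_comm]
      _ = _ := by rw [← mul_assoc, Matrix.nonsing_inv_mul Φ hΦ, one_mul]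
  have h4 : V = U * aeval U g := by
    have := congrArg (aeval U) hg
    simpa [hV] using this
  have h5 : V ^ k = (q : D) ^ k • U ^ k + U ^ (k + 1) * aeval U r := by
    have hc : Commute U (aeval U g) := by
      have := (Commute.all X g).map (aeval U)
      rwa [aeval_X] at this
    have := congrArg (aeval U) hr
    rw [map_sub, map_pow, aeval_C, map_mul, aeval_X, sub_eq_iff_eq_add'] at this
    rw [h4, hc.mul_pow, this, mul_add, pow_succ, mul_assoc, Algebra.smul_def,
      Algebra.commutes]
  have h6 : (U ^ (k + 1) * aeval U r).trace = 0 := by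
    rw [aeval_eq_sum_range, Finset.mul_sum, Matrix.trace_sum]
    refine Finset.sum_eq_zero fun j _ => ?_
    rw [mul_smul_comm, ← pow_add, Matrix.trace_smul, hk _ (by omega), smul_zero]
  conv_lhs => rw [← h3, h5, Matrix.trace_add, h6, add_zero, Matrix.trace_smul, smul_eq_mul]

/-- Rigidity of the unipotent locus under square-zero thickenings. Newton's identities translate
between coefficients and power traces, and conjugation by Φ multiplies the leading part of tr U^k by
q^k, where q^k - 1 is a unit. -/
theorem charpoly_eq_X_pow_of_mem_ideal (hS : ∀ k ∈ Finset.Icc 1 n, IsUnit (k : D))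
    (hqi : ∀ i ∈ Finset.Icc 1 n, IsUnit ((q : D) ^ i - 1)) (hΦ : IsUnit Φ.det)
    (h : Φ * (1 + U) = (1 + U) ^ q * Φ) {I : Ideal D} (hI : ∀ a ∈ I, ∀ b ∈ I, a * b = 0)
    (hU : ∀ m < n, U.charpoly.coeff m ∈ I) : U.charpoly = X ^ n := by
  nontriviality D
  have hdeg : U.charpoly.natDegree = n := by simp
  have hlead : U.charpoly.coeff n = 1 := by
    have := U.charpoly_monic
    rwa [Monic, leadingCoeff, hdeg] at this
  have hsum (r N : ℕ) : ∑ s ∈ Finset.range (N + 1), U.charpoly.coeff (n - s) * (U ^ (r - s)).trace =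
      (U ^ r).trace + ∑ s ∈ Finset.range N,
        U.charpoly.coeff (n - (s + 1)) * (U ^ (r - (s + 1))).trace := by
    rw [Finset.sum_range_succ', add_comm, Nat.sub_zero, hlead, one_mul, Nat.sub_zero]
  have hmem (r N : ℕ) (hN : N ≤ n) : ∑ s ∈ Finset.range N,
      U.charpoly.coeff (n - (s + 1)) * (U ^ (r - (s + 1))).trace ∈ I :=
    sum_mem fun s hs => I.mul_mem_right _ (hU _ (by have := Finset.mem_range.1 hs; omega))
  have hp (r : ℕ) (hr : 1 ≤ r) : (U ^ r).trace ∈ I := by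
    rcases lt_or_ge r n with hlt | hge
    · have h1 := newton_charpoly U hlt
      rw [hsum] at h1
      rw [eq_sub_of_add_eq h1]
      exact sub_mem (I.mul_mem_left _ (hU _ (by omega))) (hmem r r hlt.le)
    · have h1 := newton_charpoly_of_le U hge
      rw [hsum] at h1
      rw [eq_neg_of_add_eq_zero_left h1]
      exact neg_mem (hmem r n le_rfl)
  -- For r > n every trace in the identity is that of a positive power, so each term is a product of
  -- two elements of I.
  have hp0 (r : ℕ) (hr : n < r) : (U ^ r).trace = 0 := by
    have h1 := newton_charpoly_of_le U hr.le
    rw [hsum, Finset.sum_eq_zero, add_zero] at h1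
    · exact h1
    · intro s hs
      have := Finset.mem_range.1 hs
      exact hI _ (hU _ (by omega)) _ (hp _ (by omega))
  -- Descending induction on k, with m bounding the distance down from n: once all higher traces
  -- vanish, (q^k - 1) tr U^k = 0.
  have hall (m : ℕ) : ∀ k, 1 ≤ k → n < k + m → (U ^ k).trace = 0 := by
    induction m with
    | zero => exact fun k _ hk => hp0 k hk
    | succ m ih =>
      intro k hk hkm
      rcases lt_or_ge n k with hlt | hge
      · exact hp0 k hlt
      · have h1 := trace_pow_eq_of_conj hΦ h (k := k) fun j hj => ih j (by omega) (by omega)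
        have h2 : ((q : D) ^ k - 1) * (U ^ k).trace = 0 := by rw [sub_mul, ← h1, one_mul, sub_self]
        exact (hqi k (Finset.mem_Icc.2 ⟨hk, hge⟩)).mul_right_eq_zero.1 h2
  -- With tr U^0 = n the only trace left, Newton's identity reads nχ_(n-r) = (n - r)χ_(n-r), so
  -- rχ_(n-r) = 0.
  have hcoeff (r : ℕ) (hr : 1 ≤ r) (hrn : r ≤ n) : U.charpoly.coeff (n - r) = 0 := by
    have h1 : ∑ s ∈ Finset.range r, U.charpoly.coeff (n - (s + 1)) * (U ^ (r - (s + 1))).trace =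
        U.charpoly.coeff (n - r) * n := by
      obtain ⟨r, rfl⟩ : ∃ r', r = r' + 1 := ⟨r - 1, by omega⟩
      rw [Finset.sum_range_succ, Finset.sum_eq_zero, zero_add]
      · simp
      · intro s hs
        have := Finset.mem_range.1 hs
        rw [hall n _ (by omega) (by omega), mul_zero]
    have h2 : U.charpoly.coeff (n - r) * n = ((n - r : ℕ) : D) * U.charpoly.coeff (n - r) := by
      rcases lt_or_eq_of_le hrn with hlt | rfl
      · rw [← newton_charpoly U hlt, hsum, hall n r hr (by omega), zero_add, h1]
      · have := newton_charpoly_of_le U (le_refl r)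
        rw [hsum, hall r r hr (by omega), zero_add, h1] at this
        rw [this]; simp
    rw [Nat.cast_sub hrn] at h2
    have h3 : (r : D) * U.charpoly.coeff (n - r) = 0 := by linear_combination h2
    exact (hS r (Finset.mem_Icc.2 ⟨hr, hrn⟩)).mul_right_eq_zero.1 h3
  ext m
  rw [coeff_X_pow]
  split_ifs with hm
  · rw [hm, hlead]
  · rcases lt_or_gt_of_ne hm with hlt | hlt
    · have := hcoeff (n - m) (by omega) (by omega)
      rwa [Nat.sub_sub_self hlt.le] at this
    · exact coeff_eq_zero_of_natDegree_lt (hdeg.trans_lt hlt)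

end

end

/-! ### The space of pairs (Φ, Σ) and unipotent matrices -/

section
open Matrix

theorem Matrix.map_pow_of_algHom {R A B : Type*} [CommRing R] [CommRing A] [CommRing B]
    [Algebra R A] [Algebra R B] (f : A →ₐ[R] B) {n : ℕ} (M : Matrix (Fin n) (Fin n) A) (q : ℕ) :
    (M ^ q).map f = M.map f ^ q := by
  rw [← AlgHom.mapMatrix_apply, map_pow, AlgHom.mapMatrix_apply]

namespace MSpace

variable {n q : ℕ} {R : Type*} [CommRing R]

theorem Phi_mul_Sigma : Phi n q R * Sigma n q R = Sigma n q R ^ q * Phi n q R := by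
  have h1 : (polyPhi n R * polySigma n R).map (mk n q R) =
      (polySigma n R ^ q * polyPhi n R).map (mk n q R) := by
    ext i j
    have h : (polyPhi n R * polySigma n R - polySigma n R ^ q * polyPhi n R) i j
        ∈ relations n q R := Ideal.subset_span (Or.inr ⟨(i, j), rfl⟩)
    have h2 : mk n q R ((polyPhi n R * polySigma n R - polySigma n R ^ q * polyPhi n R) i j) = 0 :=
      Ideal.Quotient.eq_zero_iff_mem.2 h
    rwa [Matrix.sub_apply, map_sub, sub_eq_zero] at h2
  rw [Matrix.map_mul_of_algHom, Matrix.map_mul_of_algHom] at h1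
  exact h1.trans (congrArg (· * _) (Matrix.map_pow_of_algHom (mk n q R) _ q))

theorem mk_polyDetPhiInv_mul : mk n q R (polyDetPhiInv n R) * (Phi n q R).det = 1 := by
  have h : polyDetPhiInv n R * (polyPhi n R).det - 1 ∈ relations n q R :=
    Ideal.subset_span (Or.inl (Or.inl rfl))
  have h2 : mk n q R (polyDetPhiInv n R * (polyPhi n R).det - 1) = 0 :=
    Ideal.Quotient.eq_zero_iff_mem.2 h
  rw [map_sub, map_mul, map_one, sub_eq_zero, AlgHom.map_det] at h2
  exact h2

theorem mk_polyDetSigmaInv_mul : mk n q R (polyDetSigmaInv n R) * (Sigma n q R).det = 1 := by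
  have h : polyDetSigmaInv n R * (polySigma n R).det - 1 ∈ relations n q R :=
    Ideal.subset_span (Or.inl (Or.inr rfl))
  have h2 : mk n q R (polyDetSigmaInv n R * (polySigma n R).det - 1) = 0 :=
    Ideal.Quotient.eq_zero_iff_mem.2 h
  rw [map_sub, map_mul, map_one, sub_eq_zero, AlgHom.map_det] at h2
  exact h2

theorem isUnit_det_Phi : IsUnit (Phi n q R).det :=
  IsUnit.of_mul_eq_one _ ((mul_comm _ _).trans mk_polyDetPhiInv_mul)

theorem mk_surjective : Function.Surjective (mk n q R) := Ideal.Quotient.mk_surjective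

theorem algHom_ext {S : Type*} [CommRing S] [Algebra R S] {f g : CoordRing n q R →ₐ[R] S}
    (h1 : (Phi n q R).map f = (Phi n q R).map g) (h2 : (Sigma n q R).map f = (Sigma n q R).map g) :
    f = g := by
  have key {a : CoordRing n q R} {M : Matrix (Fin n) (Fin n) (CoordRing n q R)}
      (hM : M.map f = M.map g) (ha : a * M.det = 1) : f a = g a := by
    have h3 : f a * (M.map f).det = 1 := by
      rw [← AlgHom.mapMatrix_apply, ← AlgHom.map_det, ← map_mul, ha, map_one]
    have h4 : g a * (M.map f).det = 1 := by
      rw [hM, ← AlgHom.mapMatrix_apply, ← AlgHom.map_det, ← map_mul, ha, map_one]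
    exact (IsUnit.of_mul_eq_one _ ((mul_comm _ _).trans h3)).mul_right_cancel (h3.trans h4.symm)
  have h : f.comp (mk n q R) = g.comp (mk n q R) := by
    apply MvPolynomial.algHom_ext
    rintro (⟨i, j⟩ | ⟨i, j⟩ | ⟨⟩ | ⟨⟩)
    · exact congrFun (congrFun h1 i) j
    · exact congrFun (congrFun h2 i) j
    · exact key h1 mk_polyDetPhiInv_mul
    · exact key h2 mk_polyDetSigmaInv_mul
  ext x
  obtain ⟨y, rfl⟩ := mk_surjective x
  exact DFunLike.congr_fun h y

variable {S : Type*} [CommRing S] [Algebra R S]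

/-- The homomorphism from the coordinate ring given by a pair `(Φ, Σ)`. -/
def lift (Φ X : Matrix (Fin n) (Fin n) S) (hΦ : IsUnit Φ.det) (hX : IsUnit X.det)
    (h : Φ * X = X ^ q * Φ) : CoordRing n q R →ₐ[R] S :=
  Ideal.Quotient.liftₐ (relations n q R)
    (MvPolynomial.aeval (Sum.elim (fun x : Fin n × Fin n => Φ x.1 x.2)
      (Sum.elim (fun x : Fin n × Fin n => X x.1 x.2)
        fun b => Ring.inverse (bif b then X.det else Φ.det)))) <| by
    obtain ⟨φ, hφ⟩ : ∃ φ : MvPolynomial (Var n) R →ₐ[R] S, φ = MvPolynomial.aeval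
      (Sum.elim (fun x : Fin n × Fin n => Φ x.1 x.2)
      (Sum.elim (fun x : Fin n × Fin n => X x.1 x.2)
        fun b => Ring.inverse (bif b then X.det else Φ.det))) := ⟨_, rfl⟩
    rw [← hφ]
    have h1 : (polyPhi n R).map φ = Φ := by ext i j; simp [polyPhi, hφ]
    have h2 : (polySigma n R).map φ = X := by ext i j; simp [polySigma, hφ]
    have h3 : φ (polyDetPhiInv n R) = Ring.inverse Φ.det := by simp [polyDetPhiInv, hφ]
    have h4 : φ (polyDetSigmaInv n R) = Ring.inverse X.det := by simp [polyDetSigmaInv, hφ]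
    suffices relations n q R ≤ RingHom.ker φ from fun _ ha => this ha
    refine Ideal.span_le.2 ?_
    rintro _ ((rfl | rfl) | ⟨⟨i, j⟩, rfl⟩)
    · change φ _ = 0
      rw [map_sub, map_mul, AlgHom.map_det, AlgHom.mapMatrix_apply, h1, h3, map_one,
        Ring.inverse_mul_cancel _ hΦ, sub_self]
    · change φ _ = 0
      rw [map_sub, map_mul, AlgHom.map_det, AlgHom.mapMatrix_apply, h2, h4, map_one,
        Ring.inverse_mul_cancel _ hX, sub_self]
    · change φ ((polyPhi n R * polySigma n R - polySigma n R ^ q * polyPhi n R) i j) = 0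
      rw [Matrix.sub_apply, map_sub, sub_eq_zero]
      have h5 := Matrix.map_mul_of_algHom φ (polyPhi n R) (polySigma n R)
      have h6 := Matrix.map_mul_of_algHom φ (polySigma n R ^ q) (polyPhi n R)
      have h7 : (polySigma n R ^ q).map φ = X ^ q := by
        rw [← h2]; exact Matrix.map_pow_of_algHom φ _ q
      rw [h1, h2] at h5
      rw [h7, h1, ← h, ← h5] at h6
      exact (congrFun (congrFun h6 i) j).symm

variable (Φ X : Matrix (Fin n) (Fin n) S) (hΦ : IsUnit Φ.det) (hX : IsUnit X.det)
  (h : Φ * X = X ^ q * Φ)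

theorem Phi_map_lift : (Phi n q R).map (lift (R := R) Φ X hΦ hX h) = Φ := by
  ext i j
  change MvPolynomial.aeval _ (polyPhi n R i j) = _
  simp [polyPhi]

theorem Sigma_map_lift : (Sigma n q R).map (lift (R := R) Φ X hΦ hX h) = X := by
  ext i j
  change MvPolynomial.aeval _ (polySigma n R i j) = _
  simp [polySigma]

variable (n q R) in
/-- The ideal expressing that `Σ - 1` has characteristic polynomial `t ^ n`. -/
def charpolyIdeal : Ideal (CoordRing n q R) :=
  Ideal.span (Set.range fun i : Fin n => (Sigma n q R - 1).charpoly.coeff i)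

end MSpace

open Polynomial in
theorem Matrix.charpoly_eq_X_pow_iff_coeff {A : Type*} [CommRing A] {n : ℕ}
    {U : Matrix (Fin n) (Fin n) A} : U.charpoly = X ^ n ↔ ∀ m < n, U.charpoly.coeff m = 0 := by
  nontriviality A
  have hdeg : U.charpoly.natDegree = n := by simp
  constructor
  · intro h m hm
    rw [h, coeff_X_pow, if_neg hm.ne]
  · intro h
    ext m
    rcases lt_trichotomy m n with hm | rfl | hm
    · rw [h m hm, coeff_X_pow, if_neg hm.ne]
    · have := U.charpoly_monic
      rw [Monic, leadingCoeff, hdeg] at this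
      rw [this, coeff_X_pow, if_pos rfl]
    · rw [coeff_eq_zero_of_natDegree_lt (hdeg.trans_lt hm), coeff_X_pow, if_neg hm.ne']

-- Over any ring the lower coefficients are nilpotent; reducedness makes them zero.
open Polynomial in
theorem Matrix.charpoly_eq_X_pow_of_isReduced {A : Type*} [CommRing A] [IsReduced A] {n : ℕ}
    {U : Matrix (Fin n) (Fin n) A} (hU : IsNilpotent U) : U.charpoly = X ^ n := by
  have h := Matrix.isNilpotent_charpoly_sub_pow_of_isNilpotent hU
  rw [Fintype.card_fin] at h
  rw [Polynomial.isNilpotent_iff] at h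
  exact sub_eq_zero.1 (Polynomial.ext fun i => by simpa using (h i).eq_zero)

theorem Matrix.isUnit_det_of_isNilpotent_sub_one {A : Type*} [CommRing A] {n : ℕ}
    {X : Matrix (Fin n) (Fin n) A} (h : IsNilpotent (X - 1)) : IsUnit X.det := by
  rw [← Matrix.isUnit_iff_isUnit_det]
  simpa using h.isUnit_add_one

/-- By Fermat q^(ℓ-1) ≡ 1 mod ℓ, so banality forces n < ℓ, and 1, …, n are prime to ℓ. -/
theorem isUnit_natCast_of_mem_Icc_of_isBanal {ℓ : ℕ} [Fact ℓ.Prime] {n q : ℕ} (hq : IsBanal ℓ n q)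
    {R : Type*} [CommRing R] [Algebra ℤ_[ℓ] R] : ∀ k ∈ Finset.Icc 1 n, IsUnit (k : R) := by
  intro k hk
  rw [Finset.mem_Icc] at hk
  have hl : n < ℓ := by
    by_contra! hle
    have hp : ℓ.Prime := Fact.out
    have h1 : q.Coprime ℓ := by
      rw [Nat.coprime_comm, hp.coprime_iff_not_dvd]
      exact fun hd => hq.1 ((Nat.modEq_zero_iff_dvd).2 hd)
    have h2 := Nat.ModEq.pow_totient h1
    rw [Nat.totient_prime hp] at h2
    have := hp.two_le
    exact hq.2 (ℓ - 1) (Finset.mem_Icc.2 ⟨by omega, by omega⟩) h2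
  have h : IsUnit ((k : ℤ) : ℤ_[ℓ]) := PadicInt.isUnit_intCast (by
    rw [Int.natCast_dvd_natCast]
    exact fun hd => by have := Nat.le_of_dvd (by omega) hd; omega)
  simpa using h.map (algebraMap ℤ_[ℓ] R)

end

/-! ### The unipotent locus: idempotent ideal and logarithm isomorphism -/

section
open Matrix

open Polynomial in
theorem Matrix.charpoly_sub_one_eq_X_pow_iff {A : Type*} [CommRing A] {n : ℕ}
    {M : Matrix (Fin n) (Fin n) A} : (M - 1).charpoly = X ^ n ↔ M.charpoly = (X - 1) ^ n := by
  have h : (M - 1).charpoly = M.charpoly.comp (X + 1) := by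
    simpa using Matrix.charpoly_sub_scalar M 1
  rw [h]
  constructor
  · intro h1
    have := congrArg (fun p => p.comp (X - 1 : A[X])) h1
    simpa [comp_assoc] using this
  · intro h1
    rw [h1]
    simp

namespace MSpace

section
variable {n q : ℕ} {R : Type*} [CommRing R]

theorem charpolyIdeal_le_ker_iff {S : Type*} [CommRing S] [Algebra R S]
    (f : CoordRing n q R →ₐ[R] S) : charpolyIdeal n q R ≤ RingHom.ker f ↔
      ((Sigma n q R).map f - 1).charpoly = Polynomial.X ^ n := by
  have h : ((Sigma n q R).map f - 1).charpoly =
      (Sigma n q R - 1).charpoly.map (f : CoordRing n q R →+* S) := by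
    rw [← Matrix.charpoly_map]
    congr 1
    rw [Matrix.map_sub _ (map_sub _), Matrix.map_one _ (map_zero _) (map_one _)]
    rfl
  rw [h, ← Matrix.charpoly_map, Matrix.charpoly_eq_X_pow_iff_coeff, Matrix.charpoly_map,
    charpolyIdeal, Ideal.span_le]
  simp only [Polynomial.coeff_map]
  constructor
  · intro h1 m hm
    exact h1 ⟨⟨m, hm⟩, rfl⟩
  · rintro h1 _ ⟨i, rfl⟩
    exact h1 i i.2

theorem charpoly_sigma_quotient : ((Sigma n q R).map (Ideal.Quotient.mkₐ R (charpolyIdeal n q R))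
    - 1).charpoly = Polynomial.X ^ n := by
  rw [← charpolyIdeal_le_ker_iff]
  exact (Ideal.Quotient.mkₐ_ker R _).ge

variable (hS : ∀ k ∈ Finset.Icc 1 n, IsUnit (k : R)) (hq : IsUnit (q : R))
  (hqi : ∀ i ∈ Finset.Icc 1 n, IsUnit ((q : R) ^ i - 1))
include hS hqi

omit hqi in
theorem isUnit_natCast_of_algebra (S : Type*) [CommRing S] [Algebra R S] :
    ∀ k ∈ Finset.Icc 1 n, IsUnit (k : S) := fun k hk => by
  simpa using (hS k hk).map (algebraMap R S)

/-- The characteristic polynomial of `Σ - 1` equals `t ^ n` on an open and closed subscheme. -/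
theorem isIdempotentElem_charpolyIdeal : IsIdempotentElem (charpolyIdeal n q R) := by
  let J := charpolyIdeal n q R
  -- Modulo J² the image of J has square zero, so rigidity makes the characteristic polynomial t^n
  -- already there, that is, J ≤ J².
  let π := Ideal.Quotient.mkₐ R (J * J)
  have h1 : ((Sigma n q R).map π - 1).charpoly = Polynomial.X ^ n := by
    refine charpoly_eq_X_pow_of_mem_ideal (Φ := (Phi n q R).map π) (q := q)
      (I := J.map (Ideal.Quotient.mk (J * J)))
      (isUnit_natCast_of_algebra hS _) ?_ ?_ ?_ ?_ ?_
    · intro i hi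
      simpa using (hqi i hi).map (algebraMap R (CoordRing n q R ⧸ (J * J)))
    · rw [← AlgHom.mapMatrix_apply, ← AlgHom.map_det]
      exact isUnit_det_Phi.map π
    · rw [add_sub_cancel, ← Matrix.map_mul_of_algHom, Phi_mul_Sigma, Matrix.map_mul_of_algHom,
        Matrix.map_pow_of_algHom]
    · intro a ha b hb
      have := Ideal.mul_mem_mul ha hb
      rwa [← Ideal.map_mul, Ideal.map_quotient_self] at this
    · intro m hm
      have h : ((Sigma n q R).map π - 1).charpoly =
          (Sigma n q R - 1).charpoly.map (π : CoordRing n q R →+* _) := by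
        rw [← Matrix.charpoly_map]
        congr 1
        rw [Matrix.map_sub _ (map_sub _), Matrix.map_one _ (map_zero _) (map_one _)]
        rfl
      rw [h, Polynomial.coeff_map]
      exact Ideal.mem_map_of_mem _ (Ideal.subset_span ⟨⟨m, hm⟩, rfl⟩)
  rw [← charpolyIdeal_le_ker_iff] at h1
  exact le_antisymm Ideal.mul_le_left (h1.trans (Ideal.Quotient.mkₐ_ker R (J * J)).le)

theorem exists_charpolyIdeal_eq_span :
    ∃ e : CoordRing n q R, IsIdempotentElem e ∧ charpolyIdeal n q R = Ideal.span {e} :=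
  (Ideal.isIdempotentElem_iff_of_fg _ ((Submodule.fg_def).2 ⟨_, Set.finite_range _, rfl⟩)).1
    (isIdempotentElem_charpolyIdeal hS hqi)

include hq

/-- log and exp define maps in both directions through the universal properties; they are mutually
inverse because they are so on nilpotent and unipotent matrices. -/
theorem exists_algEquiv_charpolyIdeal [IsReduced (NTilde.CoordRing n q R)] :
    ∃ e : NTilde.CoordRing n q R ≃ₐ[R] CoordRing n q R ⧸ charpolyIdeal n q R,
      (NTilde.Phi n q R).map e =
        (Phi n q R).map (Ideal.Quotient.mkₐ R (charpolyIdeal n q R)) ∧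
      (NTilde.N n q R).map e =
        unipLog ((Sigma n q R).map (Ideal.Quotient.mkₐ R (charpolyIdeal n q R))) := by
  let A := NTilde.CoordRing n q R
  let π := Ideal.Quotient.mkₐ R (charpolyIdeal n q R)
  have hA := isUnit_natCast_of_algebra hS A
  have hC := isUnit_natCast_of_algebra hS (CoordRing n q R ⧸ charpolyIdeal n q R)
  have hX : ((Sigma n q R).map π - 1) ^ n = 0 :=
    Matrix.pow_eq_zero_of_charpoly_eq_X_pow charpoly_sigma_quotient
  have hN : NTilde.N n q R ^ n = 0 := by
    refine Matrix.pow_eq_zero_of_charpoly_eq_X_pow (Matrix.charpoly_eq_X_pow_of_mul_eq_smul_mul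
      (q := q) NTilde.isUnit_det_Phi NTilde.Phi_mul_N ?_ fun i hi => ?_)
    · simpa using hq.map (algebraMap R A)
    · simpa using (hqi i hi).map (algebraMap R A)
  have hE := unipExp_sub_one_pow hN
  have h1 : IsUnit ((Phi n q R).map π).det := by
    rw [← AlgHom.mapMatrix_apply, ← AlgHom.map_det]
    exact isUnit_det_Phi.map π
  have h2 : (Phi n q R).map π * (Sigma n q R).map π =
      (Sigma n q R).map π ^ q * (Phi n q R).map π := by
    rw [← Matrix.map_mul_of_algHom, Phi_mul_Sigma, Matrix.map_mul_of_algHom,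
      Matrix.map_pow_of_algHom]
  have h3 := mul_unipLog hC hX h2
  let f : A →ₐ[R] CoordRing n q R ⧸ charpolyIdeal n q R := NTilde.lift _ _ h1 h3
  have hf1 : (NTilde.Phi n q R).map f = (Phi n q R).map π := NTilde.Phi_map_lift _ _ h1 h3
  have hf2 : (NTilde.N n q R).map f = unipLog ((Sigma n q R).map π) :=
    NTilde.N_map_lift _ _ h1 h3
  have h4 : IsUnit (unipExp (NTilde.N n q R)).det :=
    Matrix.isUnit_det_of_isNilpotent_sub_one ⟨n, hE⟩
  have h5 := mul_unipExp hA hN NTilde.Phi_mul_N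
  let g₀ : CoordRing n q R →ₐ[R] A := lift _ _ NTilde.isUnit_det_Phi h4 h5
  have hg1 : (Phi n q R).map g₀ = NTilde.Phi n q R := Phi_map_lift _ _ NTilde.isUnit_det_Phi h4 h5
  have hg2 : (Sigma n q R).map g₀ = unipExp (NTilde.N n q R) :=
    Sigma_map_lift _ _ NTilde.isUnit_det_Phi h4 h5
  -- Reducedness enters here: a priori exp N - 1 is only nilpotent, while the ideal asks for its
  -- characteristic polynomial.
  have h6 : charpolyIdeal n q R ≤ RingHom.ker g₀ := by
    rw [charpolyIdeal_le_ker_iff, hg2]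
    exact Matrix.charpoly_eq_X_pow_of_isReduced ⟨n, hE⟩
  let g : (CoordRing n q R ⧸ charpolyIdeal n q R) →ₐ[R] A :=
    Ideal.Quotient.liftₐ _ g₀ fun _ ha => h6 ha
  have hgπ (M : Matrix (Fin n) (Fin n) (CoordRing n q R)) : (M.map π).map g = M.map g₀ := rfl
  refine ⟨AlgEquiv.ofAlgHom f g ?_ ?_, hf1, hf2⟩
  · refine Ideal.Quotient.algHom_ext R (algHom_ext ?_ ?_)
    · calc (((Phi n q R).map π).map g).map f = (NTilde.Phi n q R).map f := by rw [hgπ, hg1]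
        _ = _ := hf1
    · calc (((Sigma n q R).map π).map g).map f = (unipExp (NTilde.N n q R)).map f := by
            rw [hgπ, hg2]
        _ = unipExp ((NTilde.N n q R).map f) := unipExp_map hA f.toRingHom _
        _ = _ := by rw [hf2]; exact unipExp_unipLog hC hX
  · refine NTilde.algHom_ext ?_ ?_
    · calc ((NTilde.Phi n q R).map f).map g = ((Phi n q R).map π).map g := by rw [hf1]
        _ = NTilde.Phi n q R := hg1
        _ = _ := by ext; rfl
    · calc ((NTilde.N n q R).map f).map g = (unipLog ((Sigma n q R).map π)).map g := by rw [hf2]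
        _ = unipLog (((Sigma n q R).map π).map g) := unipLog_map hC (g : _ →+* A) _
        _ = NTilde.N n q R := by rw [hgπ, hg2]; exact unipLog_unipExp hA hN
        _ = _ := by ext; rfl

end

/-- The strongly unipotent points are those of the quotient by `charpolyIdeal`. That quotient is
isomorphic to the space of pairs (Φ, N), on which geometric points separate functions. -/
theorem unipIdeal_eq_charpolyIdeal {ℓ : ℕ} [Fact ℓ.Prime] {n q : ℕ} (hq : IsBanal ℓ n q)
    {R : Type*} [CommRing R] [Algebra ℤ_[ℓ] R] {E : Type*} [Field E] [Algebra R E]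
    (hE : Function.Injective (algebraMap R E)) [IsReduced (NTilde.CoordRing n q R)] :
    unipIdeal n q R E = charpolyIdeal n q R := by
  obtain ⟨e, -⟩ := exists_algEquiv_charpolyIdeal
    (isUnit_natCast_of_mem_Icc_of_isBanal (R := R) hq) (isUnit_natCast_of_isBanal hq)
    (isUnit_pow_sub_one_of_isBanal hq)
  have hK : Function.Injective (algebraMap R (AlgebraicClosure E)) := by
    rw [IsScalarTower.algebraMap_eq R E (AlgebraicClosure E)]
    exact (algebraMap E (AlgebraicClosure E)).injective.comp hE
  refine le_antisymm (fun a ha => ?_) (le_iInf fun x => ?_)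
  · by_contra hJ
    have h1 : e.symm (Ideal.Quotient.mkₐ R (charpolyIdeal n q R) a) ≠ 0 := by
      rw [Ne, map_eq_zero_iff _ e.symm.injective]
      exact fun h => hJ (Ideal.Quotient.eq_zero_iff_mem.1 h)
    obtain ⟨x, hx⟩ := NTilde.exists_algHom_ne_zero hq hK h1
    let y : CoordRing n q R →ₐ[R] AlgebraicClosure E :=
      (x.comp e.symm.toAlgHom).comp (Ideal.Quotient.mkₐ R (charpolyIdeal n q R))
    have hy : ((Sigma n q R).map y).charpoly = (Polynomial.X - 1) ^ n := by
      rw [← Matrix.charpoly_sub_one_eq_X_pow_iff, ← charpolyIdeal_le_ker_iff]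
      intro b hb
      change x (e.symm (Ideal.Quotient.mk _ b)) = 0
      rw [Ideal.Quotient.eq_zero_iff_mem.2 hb, map_zero, map_zero]
    exact hx ((Submodule.mem_iInf _).1 ha ⟨y, hy⟩)
  · rw [charpolyIdeal_le_ker_iff, Matrix.charpoly_sub_one_eq_X_pow_iff]
    exact x.2

end MSpace

end

/-! ### Connectedness of the unipotent locus -/

section
open Matrix

/-- Modulo a prime p the ring (A/p)[X] is a domain, so the idempotent becomes 0 or 1. Its higher
coefficients lie in every prime, hence vanish. -/
theorem Polynomial.exists_eq_C_of_isIdempotentElem {A : Type*} [CommRing A] [IsReduced A]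
    {f : Polynomial A} (hf : IsIdempotentElem f) : ∃ c, f = Polynomial.C c := by
  refine ⟨f.coeff 0, Polynomial.ext fun m => ?_⟩
  rw [Polynomial.coeff_C]
  split_ifs with hm
  · rw [hm]
  refine IsNilpotent.eq_zero ?_
  rw [← mem_nilradical, nilradical_eq_sInf, Ideal.mem_sInf]
  intro p (hp : p.IsPrime)
  rw [← Ideal.Quotient.eq_zero_iff_mem, ← Polynomial.coeff_map]
  have h : IsIdempotentElem (f.map (Ideal.Quotient.mk p)) :=
    hf.map (Polynomial.mapRingHom (Ideal.Quotient.mk p))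
  rcases IsIdempotentElem.iff_eq_zero_or_one.1 h with h | h
  · rw [h, Polynomial.coeff_zero]
  · rw [h, Polynomial.coeff_one, if_neg hm]

namespace NTilde

variable {n q : ℕ} {R : Type*} [CommRing R] [IsDomain R] [IsReduced (CoordRing n q R)]

/-- The family (Φ, XN) joins the identity at X = 1 to the projection (Φ, N) ↦ (Φ, 0) at X = 0.
Idempotents of A[X] are constant, so e is determined by its restriction to N = 0, that is to GL_n
over R, whose coordinate ring is a domain. -/
theorem eq_zero_or_one_of_isIdempotentElem {e : CoordRing n q R} (he : IsIdempotentElem e) :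
    e = 0 ∨ e = 1 := by
  let A := CoordRing n q R
  let P := MvPolynomial (Fin n × Fin n) R
  let M : Matrix (Fin n) (Fin n) P := Matrix.mvPolynomialX (Fin n) (Fin n) R
  have hM : M.det ≠ 0 := Matrix.det_mvPolynomialX_ne_zero _ _
  let L := Localization.Away M.det
  have hL : IsDomain L :=
    IsLocalization.isDomain_localization (powers_le_nonZeroDivisors_of_noZeroDivisors hM)
  -- the retraction onto the locus `N = 0` is homotopic to the identity
  let c : A →ₐ[R] Polynomial A := (Polynomial.CAlgHom : A →ₐ[A] Polynomial A).restrictScalars R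
  have h1 : IsUnit ((Phi n q R).map c).det := by
    rw [← AlgHom.mapMatrix_apply, ← AlgHom.map_det]
    exact isUnit_det_Phi.map c
  have h2 : (Phi n q R).map c * ((Polynomial.X : Polynomial A) • (N n q R).map c) =
      (q : Polynomial A) • (((Polynomial.X : Polynomial A) • (N n q R).map c) *
        (Phi n q R).map c) := by
    rw [mul_smul_comm, smul_mul_assoc, smul_comm, ← Matrix.map_smul_mul_of_algHom, ← Phi_mul_N,
      Matrix.map_mul_of_algHom]
  let φ : A →ₐ[R] Polynomial A := lift _ _ h1 h2
  have hφ1 : (Phi n q R).map φ = (Phi n q R).map c := Phi_map_lift _ _ h1 h2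
  have hφ2 : (N n q R).map φ = (Polynomial.X : Polynomial A) • (N n q R).map c :=
    N_map_lift _ _ h1 h2
  let ev (a : A) : Polynomial A →ₐ[R] A := (Polynomial.aeval a).restrictScalars R
  have hev1 : (ev 1).comp φ = AlgHom.id R A := by
    refine algHom_ext ?_ ?_
    · calc ((Phi n q R).map φ).map (ev 1) = ((Phi n q R).map c).map (ev 1) := by rw [hφ1]
        _ = _ := by ext i j; simp [ev, c]; rfl
    · calc ((N n q R).map φ).map (ev 1) =
          ((Polynomial.X : Polynomial A) • (N n q R).map c).map (ev 1) := by rw [hφ2]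
        _ = _ := by ext i j; simp [ev, c]; rfl
  -- The pulled-back idempotent is constant in X, so its values at 0 and 1 agree.
  obtain ⟨y, hy⟩ := Polynomial.exists_eq_C_of_isIdempotentElem (he.map φ)
  have h3 : ((ev 0).comp φ) e = e := by
    have h : ev 1 (φ e) = e := DFunLike.congr_fun hev1 e
    change ev 0 (φ e) = e
    rw [hy] at h ⊢
    simpa [ev] using h
  -- the locus `N = 0` is integral
  let l : P →ₐ[R] L := IsScalarTower.toAlgHom R P L
  have h4 : IsUnit (M.map l).det := by
    rw [← AlgHom.mapMatrix_apply, ← AlgHom.map_det]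
    exact IsLocalization.Away.algebraMap_isUnit _
  let r : A →ₐ[R] L := lift (M.map l) 0 h4 (by simp)
  have hr1 : (Phi n q R).map r = M.map l := Phi_map_lift _ _ h4 _
  have hr2 : (N n q R).map r = 0 := N_map_lift _ _ h4 _
  let s₀ : P →ₐ[R] A := MvPolynomial.aeval fun x => Phi n q R x.1 x.2
  have hs₀ : M.map s₀ = Phi n q R := by ext i j; simp [s₀, M, P]
  have h5 : IsUnit (s₀ M.det) := by
    rw [AlgHom.map_det, AlgHom.mapMatrix_apply, hs₀]
    exact isUnit_det_Phi
  have h6 (y : Submonoid.powers M.det) : IsUnit (s₀ y) := by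
    obtain ⟨_, k, rfl⟩ := y
    simpa using h5.pow k
  let s : L →ₐ[R] A := IsLocalization.liftAlgHom (f := s₀) h6
  have hsl (y : P) : s (l y) = s₀ y := IsLocalization.lift_eq _ y
  have hs : s.comp r = (ev 0).comp φ := by
    refine algHom_ext ?_ ?_
    · calc ((Phi n q R).map r).map s = M.map s₀ := by rw [hr1]; ext i j; exact hsl _
        _ = ((Phi n q R).map c).map (ev 0) := by rw [hs₀]; ext i j; simp [ev, c]
        _ = _ := by rw [← hφ1]; rfl
    · calc ((N n q R).map r).map s = 0 := by rw [hr2]; ext i j; simp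
        _ = ((Polynomial.X : Polynomial A) • (N n q R).map c).map (ev 0) := by
          ext i j; simp [ev, c]
        _ = _ := by rw [← hφ2]; rfl
  have h7 : s (r e) = e := (DFunLike.congr_fun hs e).trans h3
  rcases IsIdempotentElem.iff_eq_zero_or_one.1 (he.map r) with h | h
  · left; rw [← h7, h, map_zero]
  · right; rw [← h7, h, map_one]

end NTilde

theorem PrimeSpectrum.preconnectedSpace_of_isIdempotentElem {A : Type*} [CommRing A]
    (h : ∀ e : A, IsIdempotentElem e → e = 0 ∨ e = 1) : PreconnectedSpace (PrimeSpectrum A) := by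
  rw [preconnectedSpace_iff_clopen]
  intro s hs
  obtain ⟨e, he, rfl⟩ := exists_idempotent_basicOpen_eq_of_isClopen hs
  rcases h e he with rfl | rfl
  · left; simp
  · right; simp

/-- The closed subscheme defined by an idempotent is a connected component if it has no nontrivial
idempotents. -/
theorem PrimeSpectrum.exists_zeroLocus_eq_connectedComponent {B : Type*} [CommRing B] {J : Ideal B}
    {e : B} (he : IsIdempotentElem e) (hJ : J = Ideal.span {e}) (hJ' : J ≠ ⊤)
    (h : ∀ f : B ⧸ J, IsIdempotentElem f → f = 0 ∨ f = 1) :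
    ∃ x : PrimeSpectrum B, zeroLocus (J : Set B) = connectedComponent x := by
  have := preconnectedSpace_of_isIdempotentElem h
  have h1 : zeroLocus (J : Set B) = Set.range (comap (Ideal.Quotient.mk J)) := by
    rw [range_comap_of_surjective _ _ Ideal.Quotient.mk_surjective, Ideal.mk_ker]
  have h2 : IsPreconnected (zeroLocus (J : Set B)) := by
    rw [h1]
    exact isPreconnected_range (continuous_comap _)
  have h3 : IsClopen (zeroLocus (J : Set B)) := by
    rw [hJ, zeroLocus_span]
    exact isClopen_iff_zeroLocus.2 ⟨e, he, rfl⟩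
  obtain ⟨x, hx⟩ : (zeroLocus (J : Set B)).Nonempty := by
    rw [Set.nonempty_iff_ne_empty, Ne, zeroLocus_empty_iff_eq_top]
    exact hJ'
  exact ⟨x, (h2.subset_connectedComponent hx).antisymm (h3.connectedComponent_subset hx)⟩

end

end

/-! ### The main theorem -/

theorem mainTheorem9 (ℓ : ℕ) [Fact ℓ.Prime]
    -- `E` is a finite extension of `ℚ_ℓ`
    (E : Type*) [Field E] [Algebra ℚ_[ℓ] E] [FiniteDimensional ℚ_[ℓ] E]
    [Algebra ℤ_[ℓ] E] [IsScalarTower ℤ_[ℓ] ℚ_[ℓ] E]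
    -- `O` is its ring of integers, `ϖ` a uniformizer (so that `𝔽 = O ⧸ (ϖ)`)
    (O : Type*) [CommRing O] [Algebra O E] [IsIntegralClosure O ℤ_[ℓ] E]
    (ϖ : O) (hϖ : (Ideal.span {ϖ}).IsMaximal)
    (n q : ℕ) (hq : IsBanal ℓ n q) :
    -- the maximal reduced flat closed subscheme is the whole space of pairs `(Φ, N)`
    NTilde.flatReducedIdeal n q O = ⊥ ∧
    -- it is a complete intersection, reduced, flat and equidimensional over `O`
    (IsRelativeCompleteIntersection O (NCoordRing n q O) (n ^ 2) ∧
      IsReduced (NCoordRing n q O) ∧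
      Module.Flat O (NCoordRing n q O) ∧
      IsRelativelyEquidimensional O (NCoordRing n q O) (n ^ 2)) ∧
    -- its special fibre is a reduced complete intersection
    (IsReduced ((O ⧸ Ideal.span {ϖ}) ⊗[O] NCoordRing n q O) ∧
      IsCompleteIntersection (O ⧸ Ideal.span {ϖ})
        ((O ⧸ Ideal.span {ϖ}) ⊗[O] NCoordRing n q O) (n ^ 2)) ∧
    -- the logarithm of `Σ` makes sense on `ℳ^unip(n, q)` ...
    ((∀ k ∈ Finset.Icc 1 n, IsUnit (k : MUnipCoordRing n q O E)) ∧
      (MUnipCoordRing.Sigma n q O E - 1) ^ n = 0) ∧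
    -- ... and `(Φ, Σ) ↦ (Φ, log Σ)` is an isomorphism from `ℳ^unip(n, q)` to `𝒩(n, q)`
    (∃ e : NCoordRing n q O ≃ₐ[O] MUnipCoordRing n q O E,
      (NCoordRing.Phi n q O).map e = MUnipCoordRing.Phi n q O E ∧
      (NCoordRing.N n q O).map e = unipLog (MUnipCoordRing.Sigma n q O E)) ∧
    -- `ℳ^unip(n, q)` is a connected component of `ℳ(n, q)`, as a set and as an open subscheme
    ((∃ x : PrimeSpectrum (MSpace.CoordRing n q O),
        PrimeSpectrum.zeroLocus (MSpace.unipIdeal n q O E : Set (MSpace.CoordRing n q O)) =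
          connectedComponent x) ∧
      ∃ e : MSpace.CoordRing n q O, IsIdempotentElem e ∧
        MSpace.unipIdeal n q O E = Ideal.span {e}) := by
  -- As a ℤ_ℓ-algebra, O inherits from ℤ_ℓ both the units supplied by banality and the flatness.
  let _ : Algebra ℤ_[ℓ] O := (IsIntegralClosure.ringHom ℤ_[ℓ] O E).toAlgebra
  have hE : Function.Injective (algebraMap O E) := IsIntegralClosure.algebraMap_injective O ℤ_[ℓ] E
  have hO : IsDomain O := hE.isDomain
  have hu := isUnit_natCast_of_mem_Icc_of_isBanal (R := O) hq
  have hq1 := isUnit_natCast_of_isBanal (R := O) hq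
  have hqi := isUnit_pow_sub_one_of_isBanal (R := O) hq
  have hflat := NTilde.flat_of_algebra_padicInt hq O
  have hred := NTilde.isReduced_of_flat hq1 hqi hE
  have hbot := NTilde.flatReducedIdeal_eq_bot hq1 hqi hE
  have hJ := MSpace.unipIdeal_eq_charpolyIdeal hq hE
  let _ : Field (O ⧸ Ideal.span {ϖ}) := Ideal.Quotient.field _
  let e₀ : NCoordRing n q O ≃ₐ[O] NTilde.CoordRing n q O :=
    (Ideal.quotientEquivAlgOfEq O hbot).trans (AlgEquiv.quotientBot O _)
  have he₀ (a : NTilde.CoordRing n q O) : e₀ (Ideal.Quotient.mk _ a) = a := rfl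
  obtain ⟨e₁, h1, h2⟩ := MSpace.exists_algEquiv_charpolyIdeal hu hq1 hqi
  let e₂ := Ideal.quotientEquivAlgOfEq O hJ.symm
  have he₂ (a : MSpace.CoordRing n q O) : e₂ (Ideal.Quotient.mk _ a) = Ideal.Quotient.mk _ a := rfl
  have hSigma : ((MSpace.Sigma n q O).map (Ideal.Quotient.mkₐ O (MSpace.charpolyIdeal n q O))).map
      e₂ = MUnipCoordRing.Sigma n q O E := rfl
  have hu' := MSpace.isUnit_natCast_of_algebra hu (MSpace.CoordRing n q O ⧸ MSpace.charpolyIdeal n q O)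
  refine ⟨hbot, ⟨isRelativeCompleteIntersection_of_algEquiv hq e₀, ?_, ?_,
    isRelativelyEquidimensional_of_algEquiv hq e₀⟩,
    ⟨isReduced_baseChange_of_algEquiv hq e₀ _, isCompleteIntersection_of_algEquiv hq e₀ _⟩,
    ⟨MSpace.isUnit_natCast_of_algebra hu _, ?_⟩, ⟨(e₀.trans e₁).trans e₂, ?_, ?_⟩, ?_, ?_⟩
  · exact isReduced_of_injective e₀ e₀.injective
  · exact Module.Flat.of_linearEquiv e₀.toLinearEquiv
  · refine Matrix.pow_eq_zero_of_charpoly_eq_X_pow ?_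
    exact (MSpace.charpolyIdeal_le_ker_iff (Ideal.Quotient.mkₐ O (MSpace.unipIdeal n q O E))).1
      (hJ.ge.trans (Ideal.Quotient.mkₐ_ker O _).ge)
  · calc _ = ((NTilde.Phi n q O).map e₁).map e₂ := rfl
      _ = _ := by rw [h1]; rfl
  · calc _ = ((NTilde.N n q O).map e₁).map e₂ := rfl
      _ = _ := by
        rw [h2, ← hSigma]
        exact unipLog_map hu' e₂.toRingEquiv.toRingHom _
  · rw [hJ]
    obtain ⟨e, he, hJe⟩ := MSpace.exists_charpolyIdeal_eq_span (q := q) hu hqi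
    -- A connected component is nonempty, so J must be proper; the trivial pair Φ = 1, N = 0 already
    -- shows this on the isomorphic ring.
    have : Nontrivial (MSpace.CoordRing n q O ⧸ MSpace.charpolyIdeal n q O) :=
      e₁.symm.toRingEquiv.toEquiv.nontrivial
    refine PrimeSpectrum.exists_zeroLocus_eq_connectedComponent he hJe
      (Ideal.Quotient.nontrivial_iff.1 this) fun f hf => ?_
    rcases NTilde.eq_zero_or_one_of_isIdempotentElem (hf.map e₁.symm) with h | h
    · exact Or.inl ((map_eq_zero_iff _ e₁.symm.injective).1 h)
    · exact Or.inr ((map_eq_one_iff _ e₁.symm.injective).1 h)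
  · rw [hJ]
    exact MSpace.exists_charpolyIdeal_eq_span hu hqi
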